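/- Let $n\ge 1$ and let $\mathcal C_n$ be the half-cylinder with $n$ marked points, i.e. the annulus with $n$ marked points on one of its boundary components. Its universal cover $\overline{\mathcal C}_n$ has marked points $\alpha_i$ ($i\in\mathbb Z$) in this order along a boundary line. An edge $[\alpha_u,\alpha_v]$ of $\overline{\mathcal C}_n$ is the isotopy class of curves joining the two distinct marked points $\alpha_u,\alpha_v$, and its length is $|v-u|$; two edges intersect if, up to exchanging them, their endpoints satisfy $a_1<a_2<b_1<b_2$ for $[\alpha_{a_1},\alpha_{b_1}]$ and $[\alpha_{a_2},\alpha_{b_2}]$. The edges of $\mathcal C_n$ are the edges of $\overline{\mathcal C}_n$ up to translation of indices by multiples of $n$, with the same length; let $\pi$ denote the projection. A set of edges of $\overline{\mathcal C}_n$ is $3$-crossing-free if no three of its edges pairwise intersect. A $2$-triangulation of $\mathcal C_n$ is an inclusion-maximal set $T$ of edges of $\mathcal C_n$ such that $\pi^{-1}(T)$ is $3$-crossing-free. An edge of $\mathcal C_n$ is $2$-relevant if its length $\ell$ satisfies $2<\ell\le 2n$. The flip graph has the $2$-triangulations of $\mathcal C_n$ as vertices, and $T,T'$ are adjacent if $T'=(T\setminus\{e\})\cup\{f\}$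 for some edges $e\in T$ and $f\notin T$. The simplicial complex $\Delta_{\mathcal C_n,2}$ has the $2$-relevant edges of $\mathcal C_n$ as vertices, and its faces are the nonempty finite sets $F$ of $2$-relevant edges such that $\pi^{-1}(F)$ is $3$-crossing-free. **Theorem.** For every $n\ge 1$: 1. The flip graph of $2$-triangulations of $\mathcal C_n$ is regular, of degree $2(n-1)$. 2. Mapping a $2$-triangulation to its set of $2$-relevant edges is injective, and the facets (maximal faces) of $\Delta_{\mathcal C_n,2}$ are exactly the nonempty sets of $2$-relevant edges arising in this way. The complex $\Delta_{\mathcal C_n,2}$ is pure: every face lies in a facet, and every facet has exactly $2(n-1)$ vertices. It is moreover a weak pseudomanifold (without boundary): every face with $2(n-1)-1$ elements lies in exactly two facets. -/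

import Mathlib

namespace HalfCylinder

/-- An edge of the universal cover of the half-cylinder.  The marked points of the universal cover
are `α_i`, `i ∈ ℤ`, in this order along its boundary line; since the cover is simply connected, an
isotopy class of curves joining two different marked points is determined by its two endpoints,
recorded here as `lo < hi`. -/
@[ext]
structure CoverEdge where
  lo : ℤ
  hi : ℤ
  lt : lo < hi

namespace CoverEdge

/-- The edge `[u + j, v + j]`, for `e = [u, v]`. -/
def shift (e : CoverEdge) (j : ℤ) : CoverEdge :=
  ⟨e.lo + j, e.hi + j, by have := e.lt; omega⟩

/-- The length `|v - u|` of the edge `[u, v]`. -/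
def length (e : CoverEdge) : ℕ := (e.hi - e.lo).toNat

/-- Two edges intersect if, in the cyclic order of the marked points, their endpoints are pairwise
distinct and alternate. -/
def Intersects (e f : CoverEdge) : Prop :=
  (e.lo < f.lo ∧ f.lo < e.hi ∧ e.hi < f.hi) ∨ (f.lo < e.lo ∧ e.lo < f.hi ∧ f.hi < e.hi)

/-- `e` and `f` are translations of each other by a multiple of `n`. -/
def translationSetoid (n : ℕ) : Setoid CoverEdge where
  r e f := ∃ l : ℤ, f = e.shift (l * n)
  iseqv :=
    { refl := fun e => ⟨0, by ext <;> simp [shift]⟩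
      symm := by
        rintro e f ⟨l, rfl⟩
        exact ⟨-l, by ext <;> simp [shift]⟩
      trans := by
        rintro e f g ⟨l, rfl⟩ ⟨m, rfl⟩
        exact ⟨l + m, by ext <;> simp [shift] <;> ring⟩ }

end CoverEdge

/-- A `k`-crossing: a set of `k` pairwise intersecting edges of the universal cover. -/
def IsCrossing (k : ℕ) (s : Finset CoverEdge) : Prop :=
  s.card = k ∧ (s : Set CoverEdge).Pairwise CoverEdge.Intersects

/-- A set of edges of the universal cover that contains no `k`-crossing. -/
def CrossingFree (k : ℕ) (E : Set CoverEdge) : Prop :=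
  ∀ s : Finset CoverEdge, (s : Set CoverEdge) ⊆ E → ¬ IsCrossing k s

/-- The edges of the half-cylinder with `n` marked points. -/
def Edge (n : ℕ) : Type := Quotient (CoverEdge.translationSetoid n)

/-- The covering map on edges. -/
def proj (n : ℕ) (e : CoverEdge) : Edge n := Quotient.mk (CoverEdge.translationSetoid n) e

/-- The length of an edge of the half-cylinder: the length of any of its lifts. -/
def Edge.length {n : ℕ} (e : Edge n) : ℕ :=
  Quotient.lift CoverEdge.length
    (by rintro a b ⟨l, rfl⟩; simp [CoverEdge.length, CoverEdge.shift]) e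

/-- The lift to the universal cover of a set of edges of the half-cylinder. -/
def lift {n : ℕ} (T : Set (Edge n)) : Set CoverEdge := proj n ⁻¹' T

/-- A `k`-triangulation of the half-cylinder: a maximal set of edges whose lift contains no
`(k + 1)`-crossing. -/
def IsTriangulation {n : ℕ} (k : ℕ) (T : Set (Edge n)) : Prop :=
  Maximal (fun S : Set (Edge n) => CrossingFree (k + 1) (lift S)) T

/-- The `k`-relevant edges of the half-cylinder. -/
def Edge.IsRelevant {n : ℕ} (k : ℕ) (e : Edge n) : Prop :=
  k < e.length ∧ e.length ≤ k * n

/-- The flip graph: its vertices are the `k`-triangulations, and two of them are adjacent if one is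
obtained from the other by replacing one edge by an edge that was not there. (The edges exchanged
are automatically `k`-relevant: edges of length at most `k` intersect too few edges
to be in any `(k + 1)`-crossing, so they are in all `k`-triangulations, while edges of
length more than `k * n` are in none.) -/
def flipGraph (n k : ℕ) : SimpleGraph {T : Set (Edge n) // IsTriangulation k T} where
  Adj T T' := ∃ e f : Edge n, e ∈ T.1 ∧ f ∉ T.1 ∧ T'.1 = insert f (T.1 \ {e})
  symm := ⟨by
    rintro ⟨T, hT⟩ ⟨T', hT'⟩ ⟨e, f, he, hf, h⟩
    dsimp only at he hf h
    subst h
    have hef : e ≠ f := fun h => hf (h ▸ he)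
    refine ⟨f, e, by simp, by simp [hef], ?_⟩
    ext x
    by_cases hx : x = e <;> by_cases hy : x = f <;> simp_all⟩
  loopless := ⟨by
    rintro ⟨T, hT⟩ ⟨e, f, he, hf, h⟩
    dsimp only at he hf h
    exact hf (h ▸ Set.mem_insert f _)⟩

/-- The `k`-relevant edges of the half-cylinder, as a type. -/
abbrev RelevantEdge (n k : ℕ) : Type := {e : Edge n // e.IsRelevant k}

/-- The set of `k`-relevant edges that belong to `T`. -/
def relevantPart {n : ℕ} (k : ℕ) (T : Set (Edge n)) : Set (RelevantEdge n k) := {e | e.1 ∈ T}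

theorem CrossingFree.mono {k : ℕ} {E F : Set CoverEdge} (h : E ⊆ F) (hF : CrossingFree k F) :
    CrossingFree k E :=
  fun s hs => hF s (hs.trans h)

/-- A single `k`-relevant edge lifts to a set without `(k + 1)`-crossing. -/
theorem crossingFree_lift_singleton {n k : ℕ} (e : RelevantEdge n k) :
    CrossingFree (k + 1) (lift {e.1}) := by
  obtain ⟨e, he⟩ := e
  induction e using Quotient.inductionOn with
  | _ a =>
  obtain ⟨h1, h2⟩ := he
  change k < a.length at h1
  change a.length ≤ k * n at h2
  intro s hs ⟨hc, hp⟩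
  have hlt := a.lt
  have hlen : a.hi - a.lo ≤ k * n := by
    have : ((a.hi - a.lo).toNat : ℤ) ≤ ((k * n : ℕ) : ℤ) := by exact_mod_cast h2
    push_cast at this
    omega
  have hs' : ∀ f ∈ s, ∃ l : ℤ, f = a.shift (l * n) := by
    intro f hf
    have h : proj n f = proj n a := hs hf
    exact Quotient.exact h.symm
  have hne : s.Nonempty := Finset.card_pos.mp (by omega)
  choose! l hl using hs'
  have hinj : Set.InjOn l (s : Set CoverEdge) := by
    intro x hx y hy hxy
    rw [hl x hx, hl y hy, hxy]
  obtain ⟨f, hf, hmin⟩ := Finset.exists_min_image s l hne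
  have hsub : s.image l ⊆ Finset.Ico (l f) (l f + k) := by
    intro m hm
    obtain ⟨g, hg, rfl⟩ := Finset.mem_image.mp hm
    rw [Finset.mem_Ico]
    refine ⟨hmin g hg, ?_⟩
    by_contra! hge
    have hn : (0 : ℤ) ≤ n := by positivity
    have hmul : (l f + k) * (n : ℤ) ≤ l g * n := mul_le_mul_of_nonneg_right hge hn
    have hkey : a.hi + l f * n ≤ a.lo + l g * n := by linarith
    have hne : f ≠ g := by
      rintro rfl
      linarith
    have hI := hp hf hg hne
    rw [hl f hf, hl g hg] at hI
    simp only [CoverEdge.Intersects, CoverEdge.shift] at hI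
    omega
  have := Finset.card_le_card hsub
  rw [Finset.card_image_of_injOn hinj, hc, Int.card_Ico] at this
  omega

/-- The simplicial complex whose vertices are the `k`-relevant edges of the half-cylinder and
whose faces are the nonempty finite sets of `k`-relevant edges with `(k + 1)`-crossing-free lift. -/
def complex (n k : ℕ) : AbstractSimplicialComplex (RelevantEdge n k) where
  faces := {s | s.Nonempty ∧ CrossingFree (k + 1) (lift (Subtype.val '' (s : Set (RelevantEdge n k))))}
  isRelLowerSet_faces := by
    rintro s ⟨hs, hc⟩
    refine ⟨hs, fun t hts ht => ⟨ht, hc.mono ?_⟩⟩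
    exact Set.preimage_mono (Set.image_mono (by exact_mod_cast hts))
  singleton_mem := fun e => ⟨Finset.singleton_nonempty e, by
    simpa using crossingFree_lift_singleton e⟩

end HalfCylinder

section SimplicialComplex

variable {V : Type*}

/-- The facets of a simplicial complex are its maximal faces. -/
def AbstractSimplicialComplex.IsFacet (K : AbstractSimplicialComplex V) (s : Finset V) : Prop :=
  Maximal (fun t => t ∈ K.faces) s

/-- The complex is pure, with `d` vertices in every facet (so of dimension `d - 1`). -/
def AbstractSimplicialComplex.IsPure (K : AbstractSimplicialComplex V) (d : ℕ) : Prop :=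
  (∀ t ∈ K.faces, ∃ s, K.IsFacet s ∧ t ⊆ s) ∧ ∀ s, K.IsFacet s → s.card = d

/-- A weak pseudomanifold (without boundary) with `d` vertices in every facet: the complex is pure,
and every face of codimension one lies in exactly two facets. -/
def AbstractSimplicialComplex.IsWeakPseudomanifold (K : AbstractSimplicialComplex V) (d : ℕ) :
    Prop :=
  K.IsPure d ∧
    ∀ r ∈ K.faces, r.card + 1 = d → {s : Finset V | K.IsFacet s ∧ r ⊆ s}.encard = 2

end SimplicialComplex

/-! Edges of length at most 2 lie in no 3-crossing, and an edge of length greater than 2n crosses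
two of its own translates. So a 2-triangulation is a maximal face of relevant edges together with
all short edges (`withShort`).

A relevant edge has length at most 2n, so it can be drawn as a chord of the 5n-gon, with rotation by
n in place of translation. Three crossing chords that surround the centre become a 3-crossing of the
cover once two of them are rotated, so faces are the rotation-invariant chord sets without three
pairwise crossing chords (`isFace_iff`). The factor 5 has two uses. Chords of length strictly
between 2n and 3n exclude themselves (`Good.length_le`), so no invariant set is lost. And since 5 is
odd, no rotation by a multiple of n reverses a chord, so every orbit counts for exactly two oriented
chords (`orb_count`).

It remains to show that all maximal invariant sets have the same number of orbits, and that each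
orbit of long chords can be exchanged in exactly one way. Both go by induction on m, from the
pentagon and the decagon (`count_and_hasFlips`). For m at least 3, every maximal set contains the
pentagram on some vertices 0, 1, 2, p, q (`MaxGood.exists_star`). Collapsing it and its rotations,
so that 0 and 2 become neighbours and the chords at 1 are shared between them, gives a maximal set
for m - 1 (`Star.collapse_maxGood`). The orbits of (0,1), (0,2), (1,2) merge into one, (0,p) merges
with (1,p), and (1,q) with (2,q): four orbits are lost (`Star.count_eq`).

A long chord outside the star stays long, and is exchanged by exchanging its collapse
(`Star.exists_flip_of_not_mem`). For a chord of the star, the greedy construction of stars provides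
another completion (`Star.exists_good`). There is no third one: by the constant count every
completion adds a single orbit, the stars of the completions constrain one another, and among three
completions two coincide (`Completion.eq_or_eq`). -/

namespace HalfCylinder

/-! ### Rotation-invariant chord sets of the 5m-gon and their maximal elements. -/

section

/-- A set of chords of the `5 * m`-gon invariant under rotation by `m`.  The chord joining the
vertices `u < v < u + 5 * m` of the universal cover is recorded both as `(u, v)` and as
`(v, u + 5 * m)`. -/
structure Periodic (m : ℤ) (E : Set (ℤ × ℤ)) : Prop where
  shift : ∀ j u v, (u, v) ∈ E → (u + j * m, v + j * m) ∈ E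
  twist : ∀ u v, (u, v) ∈ E → (v, u + 5 * m) ∈ E
  lt : ∀ u v, (u, v) ∈ E → u < v
  lt_add : ∀ u v, (u, v) ∈ E → v < u + 5 * m

/-- No three chords pairwise cross. -/
def NoTriple (m : ℤ) (E : Set (ℤ × ℤ)) : Prop :=
  ∀ a b c a' b' c' : ℤ, a < b → b < c → c < a' → a' < b' → b' < c' → c' < a + 5 * m →
    (a, a') ∈ E → (b, b') ∈ E → (c, c') ∈ E → False

/-- An invariant set of chords without three pairwise crossing ones. -/
structure Good (m : ℤ) (E : Set (ℤ × ℤ)) : Prop extends Periodic m E where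
  noTriple : NoTriple m E

/-- A maximal invariant set of chords without three pairwise crossing ones. -/
def MaxGood (m : ℤ) (E : Set (ℤ × ℤ)) : Prop := Maximal (Good m) E

/-- The rotations of a chord. -/
def orb (m a b : ℤ) : Set (ℤ × ℤ) :=
  {z | ∃ j : ℤ, z = (a + j * m, b + j * m) ∨ z = (b + j * m, a + 5 * m + j * m)}

/-- The chords of length at most two. -/
def boundary (m : ℤ) : Set (ℤ × ℤ) :=
  {z | z.1 < z.2 ∧ z.2 < z.1 + 5 * m ∧ (z.2 ≤ z.1 + 2 ∨ z.1 + 5 * m ≤ z.2 + 2)}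

variable {m n : ℤ} {E F : Set (ℤ × ℤ)} {a b u v : ℤ}

theorem self_mem_orb : (a, b) ∈ orb m a b := ⟨0, Or.inl (by simp)⟩

namespace Periodic

theorem pos (h : Periodic m E) (hE : E.Nonempty) : 0 < m := by
  obtain ⟨⟨u, v⟩, hz⟩ := hE
  have := h.lt _ _ hz
  have := h.lt_add _ _ hz
  omega

theorem shift_iff (h : Periodic m E) (j : ℤ) : (u + j * m, v + j * m) ∈ E ↔ (u, v) ∈ E := by
  refine ⟨fun hz => ?_, h.shift j u v⟩
  have := h.shift (-j) _ _ hz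
  simpa using this

theorem of_eq_shift (h : Periodic m E) {u' v' : ℤ} (j : ℤ) (hz : (u, v) ∈ E)
    (h1 : u' = u + j * m) (h2 : v' = v + j * m) : (u', v') ∈ E := by
  subst h1 h2; exact h.shift j u v hz

theorem of_eq_twist (h : Periodic m E) {u' v' : ℤ} (j : ℤ) (hz : (u, v) ∈ E)
    (h1 : u' = v + j * m) (h2 : v' = u + 5 * m + j * m) : (u', v') ∈ E := by
  subst h1 h2; exact h.shift j _ _ (h.twist _ _ hz)

theorem untwist (h : Periodic m E) (hz : (v, u + 5 * m) ∈ E) : (u, v) ∈ E :=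
  h.of_eq_twist (-5) hz (by ring) (by ring)

theorem orb_subset (h : Periodic m E) (hz : (a, b) ∈ E) : orb m a b ⊆ E := by
  rintro z ⟨j, rfl | rfl⟩
  · exact h.shift _ _ _ hz
  · exact h.shift _ _ _ (h.twist _ _ hz)

theorem union (h : Periodic m E) (h' : Periodic m F) : Periodic m (E ∪ F) where
  shift j u v := Or.imp (h.shift j u v) (h'.shift j u v)
  twist u v := Or.imp (h.twist u v) (h'.twist u v)
  lt u v := fun hz => hz.elim (h.lt u v) (h'.lt u v)
  lt_add u v := fun hz => hz.elim (h.lt_add u v) (h'.lt_add u v)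

theorem diff (h : Periodic m E) (h' : Periodic m F) : Periodic m (E \ F) where
  shift j u v := fun hz => ⟨h.shift j u v hz.1, fun h2 => hz.2 ((h'.shift_iff j).1 h2)⟩
  twist u v := fun hz => ⟨h.twist u v hz.1, fun h2 => hz.2 (h'.untwist h2)⟩
  lt u v := fun hz => h.lt u v hz.1
  lt_add u v := fun hz => h.lt_add u v hz.1

theorem orb (h1 : a < b) (h2 : b < a + 5 * m) : Periodic m (orb m a b) where
  shift j u v := by
    rintro ⟨i, hi⟩
    refine ⟨i + j, hi.imp ?_ ?_⟩ <;> rintro ⟨⟩ <;> ext <;> ring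
  twist u v := by
    rintro ⟨i, hi | hi⟩
    · obtain ⟨rfl, rfl⟩ := Prod.ext_iff.1 hi
      exact ⟨i, Or.inr (by ext <;> ring)⟩
    · obtain ⟨rfl, rfl⟩ := Prod.ext_iff.1 hi
      exact ⟨i + 5, Or.inl (by ext <;> ring)⟩
  lt u v := by
    rintro ⟨i, hi | hi⟩ <;> obtain ⟨rfl, rfl⟩ := Prod.ext_iff.1 hi <;> dsimp only <;> omega
  lt_add u v := by
    rintro ⟨i, hi | hi⟩ <;> obtain ⟨rfl, rfl⟩ := Prod.ext_iff.1 hi <;> dsimp only <;> omega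

end Periodic

theorem boundary_periodic : Periodic m (boundary m) where
  shift j u v := by simp only [boundary, Set.mem_ofPred_eq]; omega
  twist u v := by simp only [boundary, Set.mem_ofPred_eq]; omega
  lt u v := fun h => h.1
  lt_add u v := fun h => h.2.1

theorem mem_orb_comm (h : (u, v) ∈ orb m a b) : (a, b) ∈ orb m u v := by
  obtain ⟨j, hj | hj⟩ := h <;> obtain ⟨rfl, rfl⟩ := Prod.ext_iff.1 hj
  · exact ⟨-j, Or.inl (by ext <;> ring)⟩
  · exact ⟨-j - 5, Or.inr (by ext <;> ring)⟩

theorem mem_orb_trans {c d : ℤ} (h : (u, v) ∈ orb m a b) (h' : (a, b) ∈ orb m c d) :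
    (u, v) ∈ orb m c d := by
  obtain ⟨j, hj | hj⟩ := h <;> obtain ⟨rfl, rfl⟩ := Prod.ext_iff.1 hj <;>
  obtain ⟨i, hi | hi⟩ := h' <;> obtain ⟨rfl, rfl⟩ := Prod.ext_iff.1 hi
  · exact ⟨i + j, Or.inl (by ext <;> ring)⟩
  · exact ⟨i + j, Or.inr (by ext <;> ring)⟩
  · exact ⟨i + j, Or.inr (by ext <;> ring)⟩
  · exact ⟨i + j + 5, Or.inl (by ext <;> ring)⟩

theorem Good.of_subset (hE : Good m E) (hF : Periodic m F) (h : F ⊆ E) : Good m F :=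
  ⟨hF, fun a b c a' b' c' h1 h2 h3 h4 h5 h6 ha hb hc =>
    hE.noTriple a b c a' b' c' h1 h2 h3 h4 h5 h6 (h ha) (h hb) (h hc)⟩

theorem Good.diff_orb (hE : Good m E) (hab : (a, b) ∈ E) : Good m (E \ orb m a b) :=
  hE.of_subset (hE.toPeriodic.diff (.orb (hE.lt _ _ hab) (hE.lt_add _ _ hab))) Set.sdiff_subset

/-- A weakly monotone reparametrization of the endpoints that is strict on crossing long chords
reflects the absence of three pairwise crossing chords. -/
theorem noTriple_of_map {G E : Set (ℤ × ℤ)} (hG : Periodic m G) (hE : NoTriple n E)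
    (μ : ℤ → ℤ → ℤ) (hμ : ∀ a b, (a, b) ∈ G → μ (a + 5 * m) (b + 5 * m) = μ a b + 5 * n)
    (hmem : ∀ a b, (a, b) ∈ G → a + 3 ≤ b → b + 3 ≤ a + 5 * m →
      (μ a b, μ b (a + 5 * m)) ∈ E)
    (hlt : ∀ a b c a' b' c', a < b → b < c → c < a' → a' < b' → b' < c' → c' < a + 5 * m →
      (a, a') ∈ G → (b, b') ∈ G → (c, c') ∈ G → μ a a' < μ b b') :
    NoTriple m G := by
  intro a b c a' b' c' h1 h2 h3 h4 h5 h6 ha hb hc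
  have ta := hG.twist _ _ ha
  have tb := hG.twist _ _ hb
  have tc := hG.twist _ _ hc
  have ta' := hG.twist _ _ ta
  have tb' := hG.twist _ _ tb
  have e := hμ a a' ha
  -- `hlt` only compares the first two endpoints of a triple. Reading the chords from their other
  -- ends rotates the triple cyclically, and the six rotations give the six inequalities.
  refine hE (μ a a') (μ b b') (μ c c') (μ a' (a + 5 * m)) (μ b' (b + 5 * m)) (μ c' (c + 5 * m))
    (hlt _ _ _ _ _ _ ?_ ?_ ?_ ?_ ?_ ?_ ha hb hc) (hlt _ _ _ _ _ _ ?_ ?_ ?_ ?_ ?_ ?_ hb hc ta)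
    (hlt _ _ _ _ _ _ ?_ ?_ ?_ ?_ ?_ ?_ hc ta tb) (hlt _ _ _ _ _ _ ?_ ?_ ?_ ?_ ?_ ?_ ta tb tc)
    (hlt _ _ _ _ _ _ ?_ ?_ ?_ ?_ ?_ ?_ tb tc ta')
    (e ▸ hlt _ _ _ _ _ _ ?_ ?_ ?_ ?_ ?_ ?_ tc ta' tb')
    (hmem _ _ ha ?_ ?_) (hmem _ _ hb ?_ ?_) (hmem _ _ hc ?_ ?_) <;> omega

/-- Each chord of a crossing triple separates two endpoints from two others, so it has length at
least 3 on both sides: the identity reparametrization suffices. -/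
theorem Good.union_boundary (hE : Good m E) : Good m (E ∪ boundary m) := by
  have hP := hE.toPeriodic.union (boundary_periodic (m := m))
  refine ⟨hP, noTriple_of_map hP hE.noTriple (fun a _ => a) (fun _ _ _ => rfl) ?_ ?_⟩
  · rintro a b (h | h) h1 h2
    · exact h
    · simp only [boundary, Set.mem_ofPred_eq] at h; omega
  · intros; assumption

theorem MaxGood.good (h : MaxGood m E) : Good m E := h.prop

theorem MaxGood.periodic (h : MaxGood m E) : Periodic m E := h.prop.toPeriodic

theorem MaxGood.eq_of_subset (h : MaxGood m E) (hF : Good m F) (hEF : E ⊆ F) : F = E :=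
  Set.Subset.antisymm (h.le_of_ge hF hEF) hEF

theorem MaxGood.boundary_subset (h : MaxGood m E) : boundary m ⊆ E := by
  have := h.le_of_ge h.good.union_boundary Set.subset_union_left
  exact Set.subset_union_right.trans this

/-- Zorn's lemma: a crossing triple involves only three chords, so in a union of a chain it already
lies in one member. -/
theorem Good.exists_maxGood (hE : Good m E) : ∃ F, E ⊆ F ∧ MaxGood m F := by
  obtain ⟨F, hEF, hF⟩ := zorn_subset_nonempty {F | Good m F} (fun C hC hchain hne => by
    refine ⟨⋃₀ C, ⟨⟨?_, ?_, ?_, ?_⟩, ?_⟩, fun s hs => Set.subset_sUnion_of_mem hs⟩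
    · rintro j u v ⟨s, hs, hz⟩
      exact ⟨s, hs, (hC hs).shift j u v hz⟩
    · rintro u v ⟨s, hs, hz⟩
      exact ⟨s, hs, (hC hs).twist u v hz⟩
    · rintro u v ⟨s, hs, hz⟩
      exact (hC hs).lt u v hz
    · rintro u v ⟨s, hs, hz⟩
      exact (hC hs).lt_add u v hz
    · rintro a b c a' b' c' h1 h2 h3 h4 h5 h6 ⟨s, hs, ha⟩ ⟨t, ht, hb⟩ ⟨r, hr, hc⟩
      obtain ⟨w, hw, hsw, htw⟩ := hchain.directedOn s hs t ht
      obtain ⟨x, hx, hwx, hrx⟩ := hchain.directedOn w hw r hr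
      exact (hC hx).noTriple a b c a' b' c' h1 h2 h3 h4 h5 h6 (hwx (hsw ha)) (hwx (htw hb))
        (hrx hc)) E hE
  exact ⟨F, hEF, hF⟩

/-! ### Counting chords up to rotation -/

/-- The chords `(u, v)` with `0 ≤ u < m`. -/
def window (m : ℤ) (E : Set (ℤ × ℤ)) : Set (ℤ × ℤ) := {z | z ∈ E ∧ 0 ≤ z.1 ∧ z.1 < m}

/-- The number of oriented chords up to rotation. -/
noncomputable def count (m : ℤ) (E : Set (ℤ × ℤ)) : ℕ := (window m E).ncard

theorem window_finite (hE : Periodic m E) : (window m E).Finite := by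
  refine ((Set.finite_Icc (0 : ℤ) m).prod (Set.finite_Icc (0 : ℤ) (6 * m))).subset ?_
  rintro ⟨u, v⟩ ⟨h, h1, h2⟩
  have := hE.lt _ _ h
  have := hE.lt_add _ _ h
  simp only [Set.mem_prod, Set.mem_Icc] at *
  omega

/-- The translate of a pair whose first entry lies in `[0, m)`. -/
def toWindow (m : ℤ) (z : ℤ × ℤ) : ℤ × ℤ := (z.1 + -(z.1 / m) * m, z.2 + -(z.1 / m) * m)

theorem toWindow_mem (hm : 0 < m) (hE : ∀ j u v, (u, v) ∈ E → (u + j * m, v + j * m) ∈ E)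
    {z : ℤ × ℤ} (hz : z ∈ E) : toWindow m z ∈ window m E := by
  refine ⟨hE _ _ _ hz, ?_, ?_⟩
  · have := Int.ediv_mul_le z.1 hm.ne'
    simp only [toWindow]; linarith
  · have := Int.lt_ediv_add_one_mul_self z.1 hm
    simp only [toWindow]; linarith

theorem toWindow_of_mem (hm : 0 < m) {z : ℤ × ℤ} (h0 : 0 ≤ z.1) (h1 : z.1 < m) (j : ℤ) :
    toWindow m (z.1 + j * m, z.2 + j * m) = z := by
  have : (z.1 + j * m) / m = j := by
    rw [Int.add_mul_ediv_right _ _ hm.ne', Int.ediv_eq_zero_of_lt h0 h1, zero_add]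
  simp [toWindow, this]

/-- An equivariant bijection preserves the number of orbits, even when the period changes from `m`
to `n`; this is how counts are compared across a collapse. -/
theorem count_eq_of_bijOn (hm : 0 < m) (hn : 0 < n) {E' : Set (ℤ × ℤ)} (hE : Periodic m E)
    (hE' : Periodic n E') (Φ : ℤ × ℤ → ℤ × ℤ)
    (hΦ : ∀ j u v, Φ (u + j * m, v + j * m) = ((Φ (u, v)).1 + j * n, (Φ (u, v)).2 + j * n))
    (h : Set.BijOn Φ E E') : count m E = count n E' := by
  have himg : window n E' = (fun z => toWindow n (Φ z)) '' window m E := by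
    ext z
    constructor
    · rintro ⟨hz, h0, h1⟩
      obtain ⟨w, hw, rfl⟩ := h.surjOn hz
      refine ⟨toWindow m w, toWindow_mem hm hE.shift hw, ?_⟩
      have := hΦ (-(w.1 / m)) w.1 w.2
      simp only [toWindow] at this ⊢
      rw [this]
      exact toWindow_of_mem hn h0 h1 _
    · rintro ⟨w, hw, rfl⟩
      exact toWindow_mem hn hE'.shift (h.mapsTo hw.1)
  rw [count, count, himg, Set.InjOn.ncard_image]
  rintro ⟨u, v⟩ ⟨hz, h0, h1⟩ ⟨x, y⟩ ⟨hw, h0', h1'⟩ heq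
  simp only [toWindow, Prod.mk.injEq] at heq h0 h1 h0' h1'
  set i := (Φ (u, v)).1 / n
  set k := (Φ (x, y)).1 / n
  have e : Φ (x + (i - k) * m, y + (i - k) * m) = Φ (u, v) := by
    rw [hΦ]
    ext <;> simp only <;> linarith [heq.1, heq.2]
  have e2 := h.injOn (hE.shift _ _ _ hw) hz e
  obtain ⟨e3, e4⟩ := Prod.ext_iff.1 e2
  simp only at e3 e4
  have : i - k = 0 := by
    have l1 : (i - k) * m < 1 * m := by linarith
    have l2 : (-1) * m < (i - k) * m := by linarith
    have := lt_of_mul_lt_mul_right l1 hm.le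
    have := lt_of_mul_lt_mul_right l2 hm.le
    omega
  rw [this] at e3 e4
  ext <;> simp only <;> linarith

theorem orb_window (hm : 0 < m) :
    window m (orb m a b) = {toWindow m (a, b), toWindow m (b, a + 5 * m)} := by
  ext z
  constructor
  · rintro ⟨⟨j, rfl | rfl⟩, h0, h1⟩
    · have := toWindow_of_mem (z := (a + j * m, b + j * m)) hm h0 h1 (-j)
      left; rw [← this]; congr 1; ext <;> simp
    · have := toWindow_of_mem (z := (b + j * m, a + 5 * m + j * m)) hm h0 h1 (-j)
      right; rw [Set.mem_singleton_iff, ← this]; congr 1; ext <;> simp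
  · have hs : ∀ j u v, (u, v) ∈ orb m a b → (u + j * m, v + j * m) ∈ orb m a b := by
      rintro j u v ⟨i, hi⟩
      refine ⟨i + j, hi.imp ?_ ?_⟩ <;> rintro ⟨⟩ <;> ext <;> ring
    rintro (rfl | rfl)
    · exact toWindow_mem hm hs self_mem_orb
    · exact toWindow_mem hm hs ⟨0, Or.inr (by simp)⟩

/-- The two orientations of a chord could be translates of each other only if 5m were an even
multiple of m. -/
theorem orb_count (hm : 0 < m) : (window m (orb m a b)).ncard = 2 := by
  rw [orb_window hm, Set.ncard_pair]
  intro h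
  simp only [toWindow, Prod.mk.injEq] at h
  set i := a / m
  set k := b / m
  have : 5 * m = (2 * (k - i)) * m := by linarith [h.1, h.2]
  have := mul_right_cancel₀ hm.ne' this
  omega

theorem count_diff_orb (hE : Periodic m E) (hab : (a, b) ∈ E) :
    count m E = count m (E \ orb m a b) + 2 := by
  have hm := hE.pos ⟨_, hab⟩
  have hO := Periodic.orb (m := m) (hE.lt _ _ hab) (hE.lt_add _ _ hab)
  have : window m E = window m (E \ orb m a b) ∪ window m (orb m a b) := by
    ext z
    have := @hE.orb_subset m E a b hab z
    simp only [window, Set.mem_union, Set.mem_ofPred_eq, Set.mem_sdiff]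
    tauto
  rw [count, this, Set.ncard_union_eq ?_ (window_finite (hE.diff hO)) (window_finite hO),
    orb_count hm, count]
  rw [Set.disjoint_left]
  rintro z ⟨⟨_, h⟩, _⟩ ⟨h', _⟩
  exact h h'

theorem eq_of_count_le (hm : 0 < m) (hE : Periodic m E) (hF : Periodic m F) (h : E ⊆ F)
    (hc : count m F ≤ count m E) : E = F := by
  have hw : window m E ⊆ window m F := fun _ hz => ⟨h hz.1, hz.2⟩
  have : window m E = window m F := Set.eq_of_subset_of_ncard_le hw hc (window_finite hF)
  refine Set.Subset.antisymm h fun z hz => ?_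
  have hw := toWindow_mem hm hF.shift hz
  rw [← this] at hw
  have := (hE.shift_iff (u := z.1) (v := z.2) (-(z.1 / m))).1 hw.1
  exact this

end

/-! ### Existence of a star at the vertices 0, 1, 2. -/

section

variable {m : ℤ} {E F : Set (ℤ × ℤ)}

theorem lt_of_mul_lt {a b : ℤ} (hm : 0 < m) (h : a * m < b * m) : a < b :=
  lt_of_mul_lt_mul_right h hm.le

/-- A chord and two of its rotations cross unless the chord is short. -/
theorem Good.length_le (hF : Good m F) {a b : ℤ} (h : (a, b) ∈ F) :
    b ≤ a + 2 * m ∨ a + 3 * m ≤ b := by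
  have hm := hF.pos ⟨_, h⟩
  by_contra! hlt
  exact hF.noTriple a (a + 1 * m) (a + 2 * m) b (b + 1 * m) (b + 2 * m) (by omega) (by omega)
    (by omega) (by omega) (by omega) (by omega) h (hF.shift 1 _ _ h) (hF.shift 2 _ _ h)

open Classical in
/-- If `p` is the first neighbour of `0` after `2`, then the chord from `1` to `p` can be added. -/
theorem Good.union_orb_one (hm : 3 ≤ m) (hF : Good m F) {p : ℤ} (h0 : (0, p) ∈ F) (hp : 2 < p)
    (hfirst : ∀ y, 2 < y → y < p → (0, y) ∉ F) : Good m (F ∪ orb m 1 p) := by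
  have hpN := hF.lt_add _ _ h0
  have hO : Periodic m (orb m 1 p) := .orb (by omega) (by omega)
  have hG := hF.toPeriodic.union hO
  have hm0 : 0 < m := by omega
  -- A new chord is never a translate of its own reversal, so at most one of its two ends is moved
  -- below.
  have hshift : ∀ i j : ℤ, p + j * m = 1 + i * m → 1 + 5 * m + j * m = p + i * m → False := by
    intro i j h1 h2
    have : 5 * m = (2 * (i - j)) * m := by linarith
    have := mul_right_cancel₀ hm0.ne' this
    omega
  -- `C` selects the new chords read from their translate of 1. Moving that end back by one turns
  -- them into translates of (0,p), which is in `F`.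
  set C : ℤ → ℤ → Prop := fun a b => (a, b) ∉ F ∧ ∃ j : ℤ, a = 1 + j * m ∧ b = p + j * m with hC
  refine ⟨hG, noTriple_of_map hG hF.noTriple (fun a b => if C a b then a - 1 else a) ?_ ?_ ?_⟩
  · intro a b _
    have : C (a + 5 * m) (b + 5 * m) ↔ C a b := by
      refine and_congr (not_congr (hF.shift_iff 5)) ⟨?_, ?_⟩
      · rintro ⟨j, h1, h2⟩
        exact ⟨j - 5, by linarith, by linarith⟩
      · rintro ⟨j, h1, h2⟩
        exact ⟨j + 5, by linarith, by linarith⟩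
    simp only [this]
    split_ifs <;> ring
  · rintro a b hab - -
    by_cases hF1 : (a, b) ∈ F
    · have h1 : ¬ C a b := fun h => h.1 hF1
      have h2 : ¬ C b (a + 5 * m) := fun h => h.1 (hF.twist _ _ hF1)
      simpa only [h1, h2, if_false] using hF1
    have hF2 : (b, a + 5 * m) ∉ F := fun h => hF1 (hF.untwist h)
    obtain ⟨j, hj | hj⟩ := hab.resolve_left hF1 <;> obtain ⟨rfl, rfl⟩ := Prod.ext_iff.1 hj
    · have h1 : C (1 + j * m) (p + j * m) := ⟨hF1, j, rfl, rfl⟩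
      have h2 : ¬ C (p + j * m) (1 + j * m + 5 * m) := fun ⟨_, i, e1, e2⟩ =>
        hshift i j e1 (by linarith)
      simp only [h1, h2, if_true, if_false]
      exact hF.of_eq_shift j h0 (by ring) rfl
    · have h1 : ¬ C (p + j * m) (1 + 5 * m + j * m) := fun ⟨_, i, e1, e2⟩ =>
        hshift i j e1 (by linarith)
      have h2 : C (1 + 5 * m + j * m) (p + j * m + 5 * m) :=
        ⟨hF2, j + 5, by ring, by ring⟩
      simp only [h1, h2, if_true, if_false]
      exact hF.of_eq_twist j h0 rfl (by ring)
  · intro a b c a' b' c' h1 h2 h3 h4 h5 h6 ha hb hc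
    by_cases hb1 : C b b'
    swap
    · rw [if_neg hb1]; split_ifs <;> omega
    have hb3 := hb1
    obtain ⟨hb2, j, rfl, rfl⟩ := hb1
    rw [if_pos hb3]
    split_ifs with ha1
    · omega
    -- Strictness can fail only if the preceding chord starts at the vertex onto which the new one
    -- is moved. It then ends strictly between the translates of 2 and `p`.
    by_contra hcon
    obtain rfl : a = j * m := by omega
    rcases ha with ha | ⟨i, hi | hi⟩
    · exact hfirst (a' - j * m) (by omega) (by omega) (hF.of_eq_shift (-j) ha (by ring) (by ring))
    · obtain ⟨e1, -⟩ := Prod.ext_iff.1 hi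
      have : 1 = (j - i) * m := by linarith
      have := Int.eq_one_or_neg_one_of_mul_eq_one' this.symm
      omega
    · obtain ⟨e1, e2⟩ := Prod.ext_iff.1 hi
      simp only at e1 e2
      -- The preceding chord is a reversed new chord, so `p` is a multiple tm. Reversing (0,p) then
      -- gives the neighbour (5 - t)m of 0, before `p`.
      obtain ⟨t, rfl⟩ : ∃ t, i = j - t := ⟨j - i, by ring⟩
      obtain rfl : p = t * m := by linarith
      have t1 : (5 - t) * m < t * m := by linarith
      have t2 : 0 * m < (5 - t) * m := by linarith
      have t3 : 1 ≤ 5 - t := lt_of_mul_lt hm0 t2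
      have t4 : 1 * m ≤ (5 - t) * m := mul_le_mul_of_nonneg_right t3 hm0.le
      exact hfirst ((5 - t) * m) (by omega) t1 (hF.of_eq_twist (-t) h0 (by ring) (by ring))

section

variable {p r : ℤ}

/-- The configurations in which the chord from `2` to `r` cannot be replaced by the chord
from `1` to `r`. -/
theorem Good.two_aux (hm : 3 ≤ m) (hF : Good m F) (h0 : (0, p) ∈ F) (hp : 2 < p)
    (hfirst : ∀ y, 2 < y → y < p → (0, y) ∉ F) (hpr : p < r)
    (h1r : (1, r) ∈ F) (hr : r < 5 * m) (hnext : ∀ y, p < y → y < r → (1, y) ∉ F)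
    {c a' c' : ℤ} (hc : 2 < c) (hca : c < a') (har : a' < r) (hrc : r < c') (hc' : c' ≤ 5 * m)
    (ha : (1, a') ∈ F ∪ orb m 2 r) (hh : (c, c') ∈ F ∪ orb m 2 r) : False := by
  have hm0 : 0 < m := by omega
  -- Such a chord would cross both (0,p) and (1,r), which cross each other.
  have key : ∀ x y, (x, y) ∈ F → 1 < x → x < p → r < y → y < 5 * m → False :=
      fun x y h h1 h2 h3 h4 =>
    hF.noTriple 0 1 x p r y (by omega) h1 h2 hpr h3 (by omega) h0 h1r h
  have key' : ∀ x y, (x, y) ∈ F → 2 < x → x < p → r < y → y ≤ 5 * m → False := by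
    intro x y h h1 h2 h3 h4
    rcases h4.lt_or_eq with h4 | rfl
    · exact key x y h (by omega) h2 h3 h4
    · exact hfirst x h1 h2 (hF.untwist (by simpa using h))
  have le_p : ∀ y, (1, y) ∈ F → y < r → y ≤ p := fun y h h1 => by
    by_contra! h2
    exact hnext y h2 h1 h
  -- Otherwise (1,r) reversed is (1, 1 + 2m), forcing `p` past 2m. By `Good.length_le`, `p` is then
  -- 3m, and (0,p) reversed gives the earlier neighbour 2m.
  have hr3 : r ≠ 1 + 3 * m := by
    rintro rfl
    have h2 := le_p (1 + 2 * m) (hF.of_eq_twist (-3) h1r (by ring) (by ring)) (by omega)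
    have h3 := hF.length_le h0
    obtain rfl : p = 3 * m := by omega
    exact hfirst (2 * m) (by omega) (by omega) (hF.of_eq_twist (-3) h0 (by ring) (by ring))
  rcases ha with ha | ⟨j, hj | hj⟩
  · have hap := le_p a' ha har
    rcases hh with hh | ⟨j, hj | hj⟩
    · exact key' c c' hh hc (by omega) hrc hc'
    · obtain ⟨rfl, rfl⟩ := Prod.ext_iff.1 hj
      simp only at *
      have : 0 < j := lt_of_mul_lt hm0 (by linarith)
      have : 1 * m ≤ j * m := mul_le_mul_of_nonneg_right this hm0.le
      exact key' (1 + j * m) (r + j * m) (hF.shift _ _ _ h1r) (by omega) (by omega) hrc hc'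
    · obtain ⟨rfl, rfl⟩ := Prod.ext_iff.1 hj
      simp only at *
      have hx : (r + j * m, 1 + 5 * m + j * m) ∈ F := hF.of_eq_twist j h1r rfl (by ring)
      by_cases hry : r < 1 + 5 * m + j * m
      · exact key _ _ hx (by omega) (by omega) hry (by omega)
      obtain ⟨t, rfl⟩ : ∃ t, j = t - 5 := ⟨j + 5, by ring⟩
      obtain rfl : r = 1 + t * m := by linarith
      have t1 : t < 5 := lt_of_mul_lt hm0 (by linarith)
      have t2 : 0 < 2 * t - 5 := lt_of_mul_lt hm0 (by linarith)
      obtain rfl | rfl : t = 3 ∨ t = 4 := by omega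
      · exact hr3 rfl
      by_cases h4 : a' < 4 * m
      · exact key (1 + m) (a' + m) (hF.of_eq_shift 1 ha (by ring) (by ring)) (by omega) (by omega)
          (by omega) (by omega)
      obtain rfl : p = 4 * m := by omega
      exact hfirst m (by omega) (by omega) (hF.of_eq_twist (-4) h0 (by ring) (by ring))
  · obtain ⟨e1, e2⟩ := Prod.ext_iff.1 hj
    simp only at e1 e2
    have : -1 = j * m := by linarith
    have : (-j) * m = 1 := by linarith
    have := Int.eq_one_or_neg_one_of_mul_eq_one' this
    omega
  · obtain ⟨e1, e2⟩ := Prod.ext_iff.1 hj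
    simp only at e1 e2
    obtain ⟨t, rfl⟩ : ∃ t, j = - t := ⟨-j, by ring⟩
    obtain rfl : r = 1 + t * m := by linarith
    obtain rfl : a' = 2 + (5 - t) * m := by linarith
    have t1 : t < 5 := lt_of_mul_lt hm0 (by linarith)
    have t2 : 5 - t < t := lt_of_mul_lt hm0 (by linarith)
    obtain rfl | rfl : t = 3 ∨ t = 4 := by omega
    · exact hr3 rfl
    have hmp := le_p (1 + m) (hF.of_eq_twist (-4) h1r (by ring) (by ring)) (by omega)
    rcases hh with hh | ⟨j, hj | hj⟩
    · by_cases hcp : c < p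
      · exact key' c c' hh hc hcp hrc hc'
      · obtain rfl : c = 1 + m := by omega
        obtain rfl : p = 1 + m := by omega
        exact hnext (c' - m) (by omega) (by omega) (hF.of_eq_shift (-1) hh (by ring) (by ring))
    · obtain ⟨rfl, rfl⟩ := Prod.ext_iff.1 hj
      simp only at *
      have : 0 < j := lt_of_mul_lt hm0 (by linarith)
      have : j < 1 := lt_of_mul_lt hm0 (by linarith)
      omega
    · obtain ⟨rfl, rfl⟩ := Prod.ext_iff.1 hj
      simp only at *
      have : 0 < 4 + j := lt_of_mul_lt hm0 (by linarith)
      have : 4 + j < 2 := lt_of_mul_lt hm0 (by linarith)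
      obtain rfl : j = -3 := by omega
      omega

open Classical in
/-- If `p` is the first neighbour of `0` after `2`, and `r` the next neighbour of `1` after `p`,
then the chord from `2` to `r` can be added. -/
theorem Good.union_orb_two (hm : 3 ≤ m) (hF : Good m F) (h0 : (0, p) ∈ F) (hp : 2 < p)
    (hfirst : ∀ y, 2 < y → y < p → (0, y) ∉ F) (hpr : p < r)
    (h1r : (1, r) ∈ F) (hr : r < 5 * m) (hnext : ∀ y, p < y → y < r → (1, y) ∉ F) :
    Good m (F ∪ orb m 2 r) := by
  have hO : Periodic m (orb m 2 r) := .orb (by omega) (by omega)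
  have hG := hF.toPeriodic.union hO
  have hm0 : 0 < m := by omega
  have hshift : ∀ i j : ℤ, r + j * m = 2 + i * m → 2 + 5 * m + j * m = r + i * m → False := by
    intro i j h1 h2
    have : 5 * m = (2 * (i - j)) * m := by linarith
    have := mul_right_cancel₀ hm0.ne' this
    omega
  -- As before, with the translates of 2 moved onto those of 1, so that a new chord becomes a
  -- translate of (1,r).
  set C : ℤ → ℤ → Prop := fun a b => (a, b) ∉ F ∧ ∃ j : ℤ, a = 2 + j * m ∧ b = r + j * m with hC
  refine ⟨hG, noTriple_of_map hG hF.noTriple (fun a b => if C a b then a - 1 else a) ?_ ?_ ?_⟩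
  · intro a b _
    have : C (a + 5 * m) (b + 5 * m) ↔ C a b := by
      refine and_congr (not_congr (hF.shift_iff 5)) ⟨?_, ?_⟩
      · rintro ⟨j, h1, h2⟩
        exact ⟨j - 5, by linarith, by linarith⟩
      · rintro ⟨j, h1, h2⟩
        exact ⟨j + 5, by linarith, by linarith⟩
    simp only [this]
    split_ifs <;> ring
  · rintro a b hab - -
    by_cases hF1 : (a, b) ∈ F
    · have h1 : ¬ C a b := fun h => h.1 hF1
      have h2 : ¬ C b (a + 5 * m) := fun h => h.1 (hF.twist _ _ hF1)
      simpa only [h1, h2, if_false] using hF1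
    have hF2 : (b, a + 5 * m) ∉ F := fun h => hF1 (hF.untwist h)
    obtain ⟨j, hj | hj⟩ := hab.resolve_left hF1 <;> obtain ⟨rfl, rfl⟩ := Prod.ext_iff.1 hj
    · have h1 : C (2 + j * m) (r + j * m) := ⟨hF1, j, rfl, rfl⟩
      have h2 : ¬ C (r + j * m) (2 + j * m + 5 * m) := fun ⟨_, i, e1, e2⟩ =>
        hshift i j e1 (by linarith)
      simp only [h1, h2, if_true, if_false]
      exact hF.of_eq_shift j h1r (by ring) rfl
    · have h1 : ¬ C (r + j * m) (2 + 5 * m + j * m) := fun ⟨_, i, e1, e2⟩ =>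
        hshift i j e1 (by linarith)
      have h2 : C (2 + 5 * m + j * m) (r + j * m + 5 * m) :=
        ⟨hF2, j + 5, by ring, by ring⟩
      simp only [h1, h2, if_true, if_false]
      exact hF.of_eq_twist j h1r rfl (by ring)
  · intro a b c a' b' c' h1 h2 h3 h4 h5 h6 ha hb hc
    by_cases hb1 : C b b'
    swap
    · rw [if_neg hb1]; split_ifs <;> omega
    have hb3 := hb1
    obtain ⟨hb2, j, rfl, rfl⟩ := hb1
    rw [if_pos hb3]
    split_ifs with ha1
    · omega
    by_contra hcon
    obtain rfl : a = 1 + j * m := by omega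
    exact hF.two_aux hm h0 hp hfirst hpr h1r hr hnext (c := c - j * m) (a' := a' - j * m)
      (c' := c' - j * m) (by omega) (by omega) (by omega) (by omega) (by omega)
      (hG.of_eq_shift (-j) ha (by ring) (by ring)) (hG.of_eq_shift (-j) hc (by ring) (by ring))

end

theorem exists_least {P : ℤ → Prop} (b y : ℤ) (hb : ∀ x, P x → b < x) (hy : P y) :
    ∃ p, P p ∧ p ≤ y ∧ ∀ x, P x → p ≤ x := by
  classical
  obtain ⟨p, hp, hle⟩ := Int.exists_least_of_bdd (P := P) ⟨b, fun z hz => (hb z hz).le⟩ ⟨y, hy⟩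
  exact ⟨p, hp, hle y hy, hle⟩

/-- The first neighbour of `0` after `2`. -/
theorem exists_first (hm : 1 ≤ m) (hE : boundary m ⊆ E) :
    ∃ p, 2 < p ∧ p + 2 ≤ 5 * m ∧ (0, p) ∈ E ∧ ∀ y, 2 < y → y < p → (0, y) ∉ E := by
  obtain ⟨p, ⟨h1, h2⟩, h3, h4⟩ := exists_least (P := fun y => 2 < y ∧ (0, y) ∈ E) 2 (5 * m - 2)
    (fun x hx => hx.1) ⟨by omega, hE (by simp only [boundary, Set.mem_ofPred_eq]; omega)⟩
  exact ⟨p, h1, by omega, h2, fun y hy hyp h => by have := h4 y ⟨hy, h⟩; omega⟩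

/-- The next neighbour of `1` after `p`. -/
theorem exists_next (hE : boundary m ⊆ E) {p : ℤ} (hp : 2 < p) (hp' : p + 2 ≤ 5 * m) :
    ∃ r, p < r ∧ r < 5 * m ∧ (1, r) ∈ E ∧ ∀ y, p < y → y < r → (1, y) ∉ E := by
  obtain ⟨r, ⟨h1, h2⟩, h3, h4⟩ := exists_least (P := fun y => p < y ∧ (1, y) ∈ E) p (5 * m - 1)
    (fun x hx => hx.1) ⟨by omega, hE (by simp only [boundary, Set.mem_ofPred_eq]; omega)⟩
  exact ⟨r, h1, by omega, h2, fun y hy hyr h => by have := h4 y ⟨hy, h⟩; omega⟩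

/-- The four chords of the star with vertices `0`, `1`, `2`, `p`, `q` other than `(0, 2)`. -/
structure Star (m : ℤ) (E : Set (ℤ × ℤ)) (p q : ℤ) : Prop where
  two_lt : 2 < p
  lt : p < q
  lt_five : q < 5 * m
  zero_p : (0, p) ∈ E
  one_p : (1, p) ∈ E
  one_q : (1, q) ∈ E
  two_q : (2, q) ∈ E

/-- A greedy choice: with `p` the first neighbour of 0 after 2 and `r` the next neighbour of 1 after
`p`, the missing chords (1,p) and (2,r) create no triple, so maximality supplies them. -/
theorem MaxGood.exists_star (hm : 3 ≤ m) (hE : MaxGood m E) : ∃ p q, Star m E p q := by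
  obtain ⟨p, hp, hp', h0, hfirst⟩ := exists_first (by omega) hE.boundary_subset
  have h1 : (1, p) ∈ E := hE.le_of_ge (hE.good.union_orb_one hm h0 hp hfirst)
    Set.subset_union_left (Or.inr self_mem_orb)
  obtain ⟨r, hr, hr', h1r, hnext⟩ := exists_next hE.boundary_subset hp hp'
  have h2 : (2, r) ∈ E := hE.le_of_ge
    (hE.good.union_orb_two hm h0 hp hfirst hr h1r hr' hnext)
    Set.subset_union_left (Or.inr self_mem_orb)
  exact ⟨p, r, hp, hr, hr', h0, h1, h1r, h2⟩

/-- Chords from `0`, `1`, `2` to `x < y < z` pairwise cross. -/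
theorem Good.not_fan (hE : Good m E) {x y z : ℤ} (hx : (0, x) ∈ E) (hy : (1, y) ∈ E)
    (hz : (2, z) ∈ E) (h2 : 2 < x) (hxy : x < y) (hyz : y < z) (hz5 : z < 5 * m) : False :=
  hE.noTriple 0 1 2 x y z (by omega) (by omega) h2 hxy hyz (by omega) hx hy hz

end

section

/-! ### Collapsing the stars at the multiples of `m` -/

/-- The position, after collapse, of the endpoint `u` of the chord from `u` to `x`: the vertices
`j * m` and `2 + j * m` become consecutive, and the chords at `1 + j * m` are distributed between
them. -/
def flat (m p u x : ℤ) : ℤ :=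
  u - u / m - (if u % m = 0 ∨ (u % m = 1 ∧ p + u - 1 < x) then 0 else 1)

variable {m p q : ℤ}

theorem mod_succ (hm : 0 < m) (u : ℤ) :
    ((u + 1) % m = 0 ∧ u % m = m - 1 ∧ (u + 1) / m = u / m + 1) ∨
    ((u + 1) % m = u % m + 1 ∧ u % m + 1 < m ∧ (u + 1) / m = u / m) := by
  have h0 := Int.emod_nonneg u hm.ne'
  have h1 := Int.emod_lt_of_pos u hm
  have h2 := Int.emod_def u m
  set s := u % m
  set j := u / m
  by_cases hs : s + 1 = m
  · have e : u + 1 = 0 + (j + 1) * m := by linarith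
    left
    rw [e, Int.add_mul_emod_self_right, Int.add_mul_ediv_right _ _ hm.ne']
    simp; omega
  · have e : u + 1 = (s + 1) + j * m := by linarith
    right
    rw [e, Int.add_mul_emod_self_right, Int.add_mul_ediv_right _ _ hm.ne',
      Int.emod_eq_of_lt (by omega) (by omega), Int.ediv_eq_zero_of_lt (by omega) (by omega)]
    omega

theorem flat_shift (hm : 0 < m) (j u x : ℤ) :
    flat m p (u + j * m) (x + j * m) = flat m p u x + j * (m - 1) := by
  have : p + (u + j * m) - 1 < x + j * m ↔ p + u - 1 < x := by constructor <;> intro <;> linarith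
  simp only [flat, Int.add_mul_emod_self_right, Int.add_mul_ediv_right _ _ hm.ne', this]
  ring

theorem flat_zero (hm : 3 ≤ m) (j x : ℤ) : flat m p (j * m) x = j * (m - 1) := by
  have := flat_shift (p := p) (by omega : 0 < m) j 0 (x - j * m)
  simpa [flat] using this

theorem flat_one_low (hm : 3 ≤ m) {j x : ℤ} (h : x ≤ p + j * m) :
    flat m p (1 + j * m) x = j * (m - 1) := by
  have := flat_shift (p := p) (by omega : 0 < m) j 1 (x - j * m)
  rw [sub_add_cancel] at this
  rw [this, flat, Int.emod_eq_of_lt (by omega) (by omega), Int.ediv_eq_zero_of_lt (by omega)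
    (by omega), if_neg (by omega)]
  ring

theorem flat_one_high (hm : 3 ≤ m) {j x : ℤ} (h : p + j * m < x) :
    flat m p (1 + j * m) x = 1 + j * (m - 1) := by
  have := flat_shift (p := p) (by omega : 0 < m) j 1 (x - j * m)
  rw [sub_add_cancel] at this
  rw [this, flat, Int.emod_eq_of_lt (by omega) (by omega), Int.ediv_eq_zero_of_lt (by omega)
    (by omega), if_pos (by omega)]
  ring

theorem flat_of_two_le {s : ℤ} (hs : 2 ≤ s) (hsm : s < m) (j x : ℤ) :
    flat m p (s + j * m) x = s - 1 + j * (m - 1) := by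
  have := flat_shift (p := p) (by omega : 0 < m) j s (x - j * m)
  rw [sub_add_cancel] at this
  rw [this, flat, Int.emod_eq_of_lt (by omega) (by omega), Int.ediv_eq_zero_of_lt (by omega)
    (by omega), if_neg (by omega)]
  ring

theorem flat_two (hm : 3 ≤ m) (j x : ℤ) : flat m p (2 + j * m) x = 1 + j * (m - 1) := by
  rw [flat_of_two_le (by omega) (by omega)]; ring

/-- The least possible value of `flat m p u x`. -/
def flatMin (m u : ℤ) : ℤ := u - u / m - (if u % m = 0 then 0 else 1)

theorem flatMin_succ (hm : 3 ≤ m) (u : ℤ) :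
    flatMin m (u + 1) = flatMin m u + (if u % m = 0 then 0 else 1) := by
  have h0 := Int.emod_nonneg u (by omega : m ≠ 0)
  simp only [flatMin]
  rcases mod_succ (by omega : 0 < m) u with ⟨h1, h2, h3⟩ | ⟨h1, h2, h3⟩ <;> rw [h1, h3] <;>
    split_ifs <;> omega

theorem flatMin_mono (hm : 3 ≤ m) : Monotone (flatMin m) := by
  refine monotone_int_of_le_succ fun u => ?_
  rw [flatMin_succ hm]
  split_ifs <;> omega

theorem flatMin_le (u x : ℤ) : flatMin m u ≤ flat m p u x := by
  simp only [flatMin, flat]; split_ifs <;> omega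

theorem flat_le_flatMin (u x : ℤ) :
    flat m p u x ≤ flatMin m u + (if u % m = 1 then 1 else 0) := by
  simp only [flatMin, flat]; split_ifs <;> omega

theorem flat_le_of_lt (hm : 3 ≤ m) {u w : ℤ} (h : u < w) (x y : ℤ) :
    flat m p u x ≤ flat m p w y := by
  have h1 := flat_le_flatMin (m := m) (p := p) u x
  have h2 := flatMin_succ hm u
  have h3 := flatMin_mono hm (by omega : u + 1 ≤ w)
  have h4 := flatMin_le (m := m) (p := p) w y
  split_ifs at * <;> omega

theorem flat_lt_of_add_two_le (hm : 3 ≤ m) {u w : ℤ} (h : u + 2 ≤ w) (x y : ℤ) :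
    flat m p u x < flat m p w y := by
  have h1 := flat_le_flatMin (m := m) (p := p) u x
  have h2 := flatMin_succ hm u
  have h3 := flatMin_succ hm (u + 1)
  have h4 := flatMin_mono hm (by omega : u + 1 + 1 ≤ w)
  have h5 := flatMin_le (m := m) (p := p) w y
  have h6 := mod_succ (by omega : 0 < m) u
  split_ifs at * <;> omega

theorem flat_lt_succ (hm : 3 ≤ m) {u : ℤ} (h0 : u % m ≠ 0) (h1 : u % m ≠ 1) (x y : ℤ) :
    flat m p u x < flat m p (u + 1) y := by
  have h2 := flat_le_flatMin (m := m) (p := p) u x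
  have h3 := flatMin_succ hm u
  have h4 := flatMin_le (m := m) (p := p) (u + 1) y
  rw [if_neg h0] at h3
  rw [if_neg h1] at h2
  omega

theorem eq_of_mod {u s : ℤ} (h : u % m = s) : ∃ j, u = s + j * m := by
  refine ⟨u / m, ?_⟩
  have := Int.emod_def u m
  linarith

theorem mod_of_eq {s : ℤ} (j : ℤ) (h0 : 0 ≤ s) (h1 : s < m) : (s + j * m) % m = s := by
  rw [Int.add_mul_emod_self_right, Int.emod_eq_of_lt h0 h1]

/-- Two different vertices are collapsed only if they are `j * m`, `1 + j * m` or
`1 + j * m`, `2 + j * m`. -/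
theorem succ_of_flat_eq (hm : 3 ≤ m) {u w x y : ℤ} (h : flat m p u x = flat m p w y) (huw : u < w) :
    w = u + 1 ∧ ((∃ j, u = j * m ∧ y ≤ p + j * m) ∨ (∃ j, u = 1 + j * m ∧ p + j * m < x)) := by
  have h1 : w = u + 1 := by
    by_contra hne
    have := flat_lt_of_add_two_le (p := p) hm (by omega : u + 2 ≤ w) x y
    omega
  subst h1
  refine ⟨rfl, ?_⟩
  by_cases h0 : u % m = 0
  · obtain ⟨j, rfl⟩ := eq_of_mod h0
    rw [zero_add] at *
    left
    refine ⟨j, rfl, ?_⟩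
    by_contra! hy
    rw [flat_zero hm, add_comm (j * m) 1, flat_one_high hm hy] at h
    omega
  by_cases h1 : u % m = 1
  · obtain ⟨j, rfl⟩ := eq_of_mod h1
    right
    refine ⟨j, rfl, ?_⟩
    by_contra! hy
    rw [flat_one_low hm hy, add_right_comm, one_add_one_eq_two, flat_two hm] at h
    omega
  · have := flat_lt_succ (p := p) hm h0 h1 x y
    omega

/-- Conversely, the collapse can separate equal endpoints only at a translate of 1, when the two
chords end on different sides of `p`. -/
theorem lt_of_flat_lt (hm : 3 ≤ m) {u w x y : ℤ} (h : flat m p u x < flat m p w y) :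
    u < w ∨ (u = w ∧ ∃ j, u = 1 + j * m ∧ x ≤ p + j * m ∧ p + j * m < y) := by
  rcases lt_trichotomy u w with h1 | rfl | h1
  · exact Or.inl h1
  · right
    refine ⟨rfl, ?_⟩
    have h1 : u % m = 1 := by
      by_contra h1
      simp [flat, h1] at h
    obtain ⟨j, rfl⟩ := eq_of_mod h1
    refine ⟨j, rfl, ?_⟩
    rw [flat, flat] at h
    split_ifs at h <;> omega
  · have := flat_le_of_lt (p := p) hm h1 y x
    omega

theorem le_of_flat_lt (hm : 3 ≤ m) {u w x y : ℤ} (h : flat m p u x < flat m p w y) : u ≤ w := by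
  rcases lt_of_flat_lt hm h with h | h
  · exact h.le
  · exact h.1.le

theorem flat_lt_self (hm : 3 ≤ m) (hp : 2 < p) (hp5 : p < 5 * m) {u v : ℤ} (h : u < v)
    (h' : v < u + 5 * m) : flat m p u v < flat m p v (u + 5 * m) := by
  refine lt_of_le_of_ne (flat_le_of_lt hm h _ _) fun he => ?_
  obtain ⟨rfl, ⟨j, rfl, hj⟩ | ⟨j, rfl, hj⟩⟩ := succ_of_flat_eq hm he h <;> omega

/-- The collapse on chords. -/
def collapse (m p : ℤ) (z : ℤ × ℤ) : ℤ × ℤ := (flat m p z.1 z.2, flat m p z.2 (z.1 + 5 * m))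

theorem collapse_shift (hm : 0 < m) (j u v : ℤ) : collapse m p (u + j * m, v + j * m) =
    ((collapse m p (u, v)).1 + j * (m - 1), (collapse m p (u, v)).2 + j * (m - 1)) := by
  simp only [collapse, flat_shift hm, Prod.mk.injEq, true_and]
  rw [← flat_shift hm, add_right_comm]

theorem flat_add_five (hm : 0 < m) (u x : ℤ) :
    flat m p (u + 5 * m) (x + 5 * m) = flat m p u x + 5 * (m - 1) := flat_shift hm 5 u x

theorem collapse_twist (hm : 0 < m) (u v : ℤ) : collapse m p (v, u + 5 * m) =
    ((collapse m p (u, v)).2, (collapse m p (u, v)).1 + 5 * (m - 1)) := by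
  simp only [collapse, flat_add_five hm]

theorem Periodic.collapse (hm : 3 ≤ m) (hp : 2 < p) (hp5 : p < 5 * m) {E : Set (ℤ × ℤ)}
    (hE : Periodic m E) : Periodic (m - 1) (collapse m p '' E) where
  shift := by
    rintro j x y ⟨⟨u, v⟩, h, he⟩
    refine ⟨_, hE.shift j u v h, ?_⟩
    rw [collapse_shift (by omega), he]
  twist := by
    rintro x y ⟨⟨u, v⟩, h, he⟩
    refine ⟨_, hE.twist u v h, ?_⟩
    rw [collapse_twist (by omega), he]
  lt := by
    rintro x y ⟨⟨u, v⟩, h, he⟩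
    obtain ⟨rfl, rfl⟩ := Prod.ext_iff.1 he
    exact flat_lt_self hm hp hp5 (hE.lt _ _ h) (hE.lt_add _ _ h)
  lt_add := by
    rintro x y ⟨⟨u, v⟩, h, he⟩
    obtain ⟨rfl, rfl⟩ := Prod.ext_iff.1 he
    have h' := hE.twist _ _ h
    have := flat_lt_self hm hp hp5 (hE.lt _ _ h') (hE.lt_add _ _ h')
    rwa [flat_add_five (by omega)] at this

/-! ### Chords compatible with a star, and lifting chords through the collapse. -/

/-- The condition on the endpoint `u` of a chord from `u` to `x` not to cross two chords of a star
that cross each other. -/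
structure Compatible (m p q u x : ℤ) : Prop where
  zero : ∀ j, u = j * m → x ≤ 2 + j * m ∨ p + j * m ≤ x
  one : ∀ j, u = 1 + j * m → x ≤ p + j * m ∨ q + j * m ≤ x
  two : ∀ j, u = 2 + j * m → x ≤ q + j * m ∨ 5 * m + j * m ≤ x

theorem Compatible.shift {u x : ℤ} (h : Compatible m p q u x) (j : ℤ) :
    Compatible m p q (u + j * m) (x + j * m) := by
  constructor <;> intro i hi
  · have := h.zero (i - j) (by linarith)
    rw [sub_mul] at this; omega
  · have := h.one (i - j) (by linarith)
    rw [sub_mul] at this; omega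
  · have := h.two (i - j) (by linarith)
    rw [sub_mul] at this; omega

/-- An excluded chord would form a fan from 0, 1, 2 with two star chords: (1,p) and (2,q), or (0,p)
and (2,q), or (0,p) and (1,q). -/
theorem Star.compatible {E : Set (ℤ × ℤ)} (hS : Star m E p q) (hE : Good m E) {u x : ℤ}
    (h : (u, x) ∈ E) : Compatible m p q u x := by
  obtain ⟨h1, h2, h3, h0p, h1p, h1q, h2q⟩ := hS
  have := hE.lt_add _ _ h
  constructor <;> rintro j rfl <;> by_contra! hx
  · exact hE.not_fan (hE.of_eq_shift (v' := x - j * m) (-j) h (by ring) (by ring)) h1p h2q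
      (by omega) (by omega) h2 h3
  · exact hE.not_fan h0p (hE.of_eq_shift (v' := x - j * m) (-j) h (by ring) (by ring)) h2q
      (by omega) (by omega) (by omega) h3
  · exact hE.not_fan h0p h1q (hE.of_eq_shift (v' := x - j * m) (-j) h (by ring) (by ring))
      (by omega) (by omega) (by omega) (by omega)

/-- The chords that do not cross two chords of a star that cross each other. -/
def region (m p q : ℤ) : Set (ℤ × ℤ) :=
  {z | z.1 < z.2 ∧ z.2 < z.1 + 5 * m ∧ Compatible m p q z.1 z.2 ∧
    Compatible m p q z.2 (z.1 + 5 * m)}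

theorem Star.subset_region {E : Set (ℤ × ℤ)} (hS : Star m E p q) (hE : Good m E) :
    E ⊆ region m p q := fun ⟨_, _⟩ h =>
  ⟨hE.lt _ _ h, hE.lt_add _ _ h, hS.compatible hE h, hS.compatible hE (hE.twist _ _ h)⟩

theorem region_periodic : Periodic m (region m p q) where
  shift j u v := by
    rintro ⟨h1, h2, h3, h4⟩
    refine ⟨by simpa using h1, by simp only at *; omega, h3.shift j, ?_⟩
    simpa [add_right_comm] using h4.shift j
  twist u v := by
    rintro ⟨h1, h2, h3, h4⟩
    exact ⟨h2, by simp only at *; omega, h4, h3.shift 5⟩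
  lt u v h := h.1
  lt_add u v h := h.2.1

/-- The chords whose collapse lies in `T`. -/
def pullback (m p q : ℤ) (T : Set (ℤ × ℤ)) : Set (ℤ × ℤ) :=
  {z | z ∈ region m p q ∧ collapse m p z ∈ T}

/-- Merging two successive endpoints of a crossing triple would force a chord into one of the gaps
excluded by `Compatible`, so the collapse maps triples in the region to triples. -/
theorem Good.pullback (hm : 3 ≤ m) {T : Set (ℤ × ℤ)}
    (hT : Good (m - 1) T) : Good m (pullback m p q T) := by
  have hP : Periodic m (HalfCylinder.pullback m p q T) := by
    refine ⟨fun j u v h => ⟨region_periodic.shift j u v h.1, ?_⟩,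
      fun u v h => ⟨region_periodic.twist u v h.1, ?_⟩, fun u v h => h.1.1, fun u v h => h.1.2.1⟩
    · rw [collapse_shift (by omega)]
      exact hT.shift _ _ _ h.2
    · rw [collapse_twist (by omega)]
      exact hT.twist _ _ h.2
  refine ⟨hP, noTriple_of_map hP hT.noTriple (flat m p) (fun a b _ => flat_add_five (by omega) a b)
    (fun a b h _ _ => h.2) ?_⟩
  rintro a b c a' b' c' h1 h2 h3 h4 h5 h6 ⟨⟨-, -, ha, -⟩, -⟩ ⟨⟨-, -, hb, -⟩, -⟩ -
  refine lt_of_le_of_ne (flat_le_of_lt hm h1 _ _) fun he => ?_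
  obtain ⟨rfl, ⟨j, rfl, hj⟩ | ⟨j, rfl, hj⟩⟩ := succ_of_flat_eq hm he h1
  · have := ha.zero j rfl
    simp only at this
    omega
  · have h7 := ha.one j rfl
    have h8 := hb.two j (by ring)
    simp only at h7 h8
    omega

theorem not_mul_eq {r : ℤ} (h0 : 0 < r) (h1 : r < m) (k : ℤ) : k * m ≠ r := by
  intro h
  have := mod_of_eq (m := m) 0 h0.le h1
  rw [← h, zero_mul, add_zero, Int.mul_emod_left] at this
  omega

theorem residue_inj {a b i j : ℤ} (ha : 0 ≤ a) (ha' : a < m) (hb : 0 ≤ b) (hb' : b < m)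
    (h : a + j * m = b + i * m) : a = b ∧ j = i := by
  have h3 := mod_of_eq (m := m) j ha ha'
  rw [h, mod_of_eq i hb hb'] at h3
  subst h3
  exact ⟨rfl, mul_right_cancel₀ (by omega : m ≠ 0) (add_left_cancel h)⟩

theorem compatible_zero (hm : 3 ≤ m) {j v : ℤ} (hv : v ≤ 2 + j * m ∨ p + j * m ≤ v) :
    Compatible m p q (j * m) v := by
  refine ⟨fun i hi => ?_, fun i hi => ?_, fun i hi => ?_⟩
  · rwa [← hi]
  · have := residue_inj (a := 0) (b := 1) (j := j) (i := i) (m := m) (by omega) (by omega)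
      (by omega) (by omega) (by simpa using hi)
    omega
  · have := residue_inj (a := 0) (b := 2) (j := j) (i := i) (m := m) (by omega) (by omega)
      (by omega) (by omega) (by simpa using hi)
    omega

theorem compatible_one (hm : 3 ≤ m) {j v : ℤ} (hv : v ≤ p + j * m ∨ q + j * m ≤ v) :
    Compatible m p q (1 + j * m) v := by
  refine ⟨fun i hi => ?_, fun i hi => ?_, fun i hi => ?_⟩
  · have := residue_inj (a := 1) (b := 0) (j := j) (i := i) (m := m) (by omega) (by omega)
      (by omega) (by omega) (by simpa using hi)
    omega
  · rwa [← add_left_cancel hi]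
  · have := residue_inj (a := 1) (b := 2) (j := j) (i := i) (m := m) (by omega) (by omega)
      (by omega) (by omega) hi
    omega

theorem compatible_two (hm : 3 ≤ m) {j v : ℤ} (hv : v ≤ q + j * m ∨ 5 * m + j * m ≤ v) :
    Compatible m p q (2 + j * m) v := by
  refine ⟨fun i hi => ?_, fun i hi => ?_, fun i hi => ?_⟩
  · have := residue_inj (a := 2) (b := 0) (j := j) (i := i) (m := m) (by omega) (by omega)
      (by omega) (by omega) (by simpa using hi)
    omega
  · have := residue_inj (a := 2) (b := 1) (j := j) (i := i) (m := m) (by omega) (by omega)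
      (by omega) (by omega) hi
    omega
  · rwa [← add_left_cancel hi]

theorem compatible_of_three_le {s : ℤ} (hs : 3 ≤ s) (hsm : s < m) (j v : ℤ) :
    Compatible m p q (s + j * m) v := by
  refine ⟨fun i hi => ?_, fun i hi => ?_, fun i hi => ?_⟩
  · have := residue_inj (a := s) (b := 0) (j := j) (i := i) (m := m) (by omega) (by omega)
      (by omega) (by omega) (by simpa using hi)
    omega
  · have := residue_inj (a := s) (b := 1) (j := j) (i := i) (m := m) (by omega) (by omega)
      (by omega) (by omega) hi
    omega
  · have := residue_inj (a := s) (b := 2) (j := j) (i := i) (m := m) (by omega) (by omega)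
      (by omega) (by omega) hi
    omega

/-- The candidates for the endpoint of a preimage of a chord. -/
theorem exists_lift_vertex (hm : 3 ≤ m) (hpq : p < q) (x : ℤ) :
    ∃ u P : ℤ, ∃ d : ℤ, (d = 0 ∨ d = 1) ∧
      (∀ v, P ≤ v → flat m p u v = x ∧ Compatible m p q u v) ∧
      (∀ v, v ≤ P → flat m p (u + d) v = x ∧ Compatible m p q (u + d) v) := by
  have hm1 : 0 < m - 1 := by omega
  obtain ⟨s, j, h0, h1, rfl⟩ : ∃ s j, 0 ≤ s ∧ s < m - 1 ∧ x = s + j * (m - 1) :=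
    ⟨x % (m - 1), x / (m - 1), Int.emod_nonneg x hm1.ne', Int.emod_lt_of_pos x hm1, by
      have := Int.emod_def x (m - 1)
      linarith⟩
  obtain hs | hs | hs : s = 0 ∨ s = 1 ∨ 2 ≤ s := by omega
  · refine ⟨j * m, p + j * m, 1, Or.inr rfl,
      fun v hv => ⟨?_, compatible_zero hm (Or.inr hv)⟩, fun v hv => ?_⟩
    · rw [flat_zero hm, hs, zero_add]
    · rw [add_comm]
      exact ⟨by rw [flat_one_low hm hv, hs, zero_add], compatible_one hm (Or.inl hv)⟩
  · refine ⟨1 + j * m, q + j * m, 1, Or.inr rfl,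
      fun v hv => ⟨?_, compatible_one hm (Or.inr hv)⟩, fun v hv => ?_⟩
    · rw [flat_one_high hm (by omega), hs]
    · rw [add_right_comm, one_add_one_eq_two]
      exact ⟨by rw [flat_two hm, hs], compatible_two hm (Or.inl hv)⟩
  · have h3 : ∀ v, flat m p (s + 1 + j * m) v = s + j * (m - 1) := by
      intro v
      rw [flat_of_two_le (by omega) (by omega)]; ring
    have h4 : ∀ v, Compatible m p q (s + 1 + j * m) v :=
      compatible_of_three_le (by omega) (by omega) j
    refine ⟨s + 1 + j * m, 0, 0, Or.inl rfl, fun v _ => ⟨h3 v, h4 v⟩, fun v _ => ?_⟩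
    rw [add_zero]
    exact ⟨h3 v, h4 v⟩

theorem one_two_mem_region (hm : 3 ≤ m) (hp : 2 < p) : (1, 2) ∈ region m p q := by
  refine ⟨by norm_num, by simp only; omega, ?_, ?_⟩
  · simpa using compatible_one (m := m) (p := p) (q := q) (j := 0) (v := 2) hm (by omega)
  · simpa using compatible_two (m := m) (p := p) (q := q) (j := 0) (v := 1 + 5 * m) hm (by omega)

theorem collapse_one_two (hm : 3 ≤ m) (hp : 2 < p) : collapse m p (1, 2) = (0, 1) := by
  have h1 := flat_one_low (m := m) (p := p) hm (j := 0) (x := 2) (by omega)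
  have h2 := flat_two (m := m) (p := p) hm 0 (1 + 5 * m)
  simp only [zero_mul, add_zero] at h1 h2
  simp [collapse, h1, h2]

/-- Surjectivity on the region is what carries maximality down to the collapse and exchanges back
up. -/
theorem exists_preimage (hm : 3 ≤ m) (hp : 2 < p) (hpq : p < q) (hq : q < 5 * m) {x y : ℤ}
    (hxy : x < y) (hyx : y < x + 5 * (m - 1)) : ∃ z ∈ region m p q, collapse m p z = (x, y) := by
  obtain ⟨u, v, hu, hu', hv, hv'⟩ : ∃ u v, flat m p u v = x ∧ Compatible m p q u v ∧
      flat m p v (u + 5 * m) = y ∧ Compatible m p q v (u + 5 * m) := by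
    obtain ⟨u, P, d, hd, h1, h2⟩ := exists_lift_vertex (p := p) (q := q) hm hpq x
    obtain ⟨v, Q, e, he, h3, h4⟩ := exists_lift_vertex (p := p) (q := q) hm hpq y
    -- Each end has two candidate vertices, chosen according to whether the other end lies before or
    -- after a threshold. As candidates differ by at most one, some pair of choices is consistent.
    by_cases hv : v + e ≤ P
    · by_cases hu : u + d + 5 * m ≤ Q
      · exact ⟨_, _, (h2 _ hv).1, (h2 _ hv).2, h4 _ hu⟩
      · exact ⟨_, _, (h2 v (by omega)).1, (h2 v (by omega)).2, h3 _ (by omega)⟩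
    · by_cases hu : u + 5 * m ≤ Q
      · exact ⟨_, _, (h1 (v + e) (by omega)).1, (h1 (v + e) (by omega)).2, h4 _ hu⟩
      · exact ⟨_, _, (h1 v (by omega)).1, (h1 v (by omega)).2, h3 _ (by omega)⟩
  have hlt : flat m p u v < flat m p v (u + 5 * m) := by omega
  have hlt' : flat m p v (u + 5 * m) < flat m p (u + 5 * m) (v + 5 * m) := by
    rw [flat_add_five (by omega)]; omega
  have h12 := one_two_mem_region (q := q) hm hp
  have hc12 := collapse_one_two hm hp
  -- If both ends were lifted to the same translate of 1, the chord is a side between merged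
  -- vertices, and a rotation of (1,2) maps to it.
  rcases lt_of_flat_lt hm hlt with h1 | ⟨rfl, j, rfl, h1, h2⟩
  · rcases lt_of_flat_lt hm hlt' with h3 | ⟨h3, j, rfl, h4, h5⟩
    · exact ⟨(u, v), ⟨h1, h3, hu', hv'⟩, by simp only [collapse, hu, hv]⟩
    · obtain rfl : u = 1 + (j - 5) * m := by linarith
      rw [flat_one_high hm (by linarith)] at hu
      rw [flat_one_low hm (by linarith)] at hv
      refine ⟨_, region_periodic.shift (j - 5) _ _ (region_periodic.twist _ _ h12), ?_⟩
      rw [collapse_shift (by omega), collapse_twist (by omega), hc12, ← hu, ← hv]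
      ext <;> simp only
      ring
  · rw [flat_one_low hm h1] at hu
    rw [flat_one_high hm h2] at hv
    refine ⟨_, region_periodic.shift j _ _ h12, ?_⟩
    rw [collapse_shift (by omega), hc12, ← hu, ← hv]
    ext <;> simp only
    ring

/-! ### The collapse creates no crossing triple. -/

/-- The collapsed endpoints of three chords alternate. -/
def Chain (m p a a' b b' c c' : ℤ) : Prop :=
  flat m p a a' < flat m p b b' ∧ flat m p b b' < flat m p c c' ∧
  flat m p c c' < flat m p a' (a + 5 * m) ∧
  flat m p a' (a + 5 * m) < flat m p b' (b + 5 * m) ∧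
  flat m p b' (b + 5 * m) < flat m p c' (c + 5 * m) ∧
  flat m p c' (c + 5 * m) < flat m p (a + 5 * m) (a' + 5 * m)

theorem Chain.rotate (hm : 0 < m) {a a' b b' c c' : ℤ} (h : Chain m p a a' b b' c c') :
    Chain m p b b' c c' a' (a + 5 * m) := by
  obtain ⟨h1, h2, h3, h4, h5, h6⟩ := h
  refine ⟨h2, h3, h4, h5, h6, ?_⟩
  rwa [flat_add_five hm, flat_add_five hm, add_lt_add_iff_right]

theorem Chain.shift (hm : 0 < m) {a a' b b' c c' : ℤ} (h : Chain m p a a' b b' c c') (j : ℤ) :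
    Chain m p (a + j * m) (a' + j * m) (b + j * m) (b' + j * m) (c + j * m) (c' + j * m) := by
  obtain ⟨h1, h2, h3, h4, h5, h6⟩ := h
  rw [flat_add_five hm] at h6
  simp only [Chain, add_right_comm _ (j * m) (5 * m), flat_shift hm, add_lt_add_iff_right]
  exact ⟨h1, h2, h3, h4, h5, h6⟩

/-- Two chords with common end 1, on different sides of `p`, become crossing after collapse. A third
chord completing a triple must satisfy c ≤ p and q ≤ c'. If both are strict, it crosses (0,p) and
(2,q); equality puts `p` or `q` at a translate of 1, and the rotated star there yields a triple. -/
theorem Star.no_bad_chain (hm : 3 ≤ m) {E : Set (ℤ × ℤ)} (hS : Star m E p q) (hE : Good m E)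
    {a' b' c c' : ℤ} (ha : (1, a') ∈ E) (hb : (1, b') ∈ E) (hc : (c, c') ∈ E)
    (h : Chain m p 1 a' 1 b' c c') : False := by
  obtain ⟨f1, f2, f3, f4, f5, f6⟩ := h
  obtain ⟨hp, hpq, hq, h0p, h1p, h1q, h2q⟩ := id hS
  have hm0 : 0 < m := by omega
  obtain ⟨hap, hpb⟩ : a' ≤ p ∧ p < b' := by
    rcases lt_of_flat_lt hm f1 with h | ⟨-, j, h1, h2, h3⟩
    · omega
    · rw [show j * m = 0 by linarith] at h2 h3
      omega
  have hqb : q ≤ b' := by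
    have := (hS.compatible hE hb).one 0 (by ring)
    omega
  have hc2 : 2 < c := by
    have e1 := flat_one_high (m := m) (p := p) hm (j := 0) (x := b') (by omega)
    have e2 := flat_two (m := m) (p := p) hm 0 0
    simp only [zero_mul, add_zero] at e1 e2
    rw [e1, ← e2] at f2
    rcases lt_of_flat_lt hm f2 with h | ⟨-, j, h1, -⟩
    · exact h
    · exact absurd (show j * m = 1 by linarith) (not_mul_eq (by omega) (by omega) j)
  have hca := le_of_flat_lt hm f3
  have hbc := le_of_flat_lt hm f5
  have hc5 : c' < 5 * m := by
    have e1 := flat_one_low (m := m) (p := p) hm (j := 0) (x := a') (by omega)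
    have e2 := flat_zero (m := m) (p := p) hm 5 0
    simp only [zero_mul, add_zero] at e1 e2
    rw [flat_add_five hm0, e1, zero_add, ← e2] at f6
    rcases lt_of_flat_lt hm f6 with h | ⟨h0, j, h1, -⟩
    · exact h
    · exact absurd (show (5 - j) * m = 1 by linarith) (not_mul_eq (by omega) (by omega) _)
  have key : ¬ (c < p ∧ q < c') := fun h =>
    hE.noTriple 0 2 c p q c' (by omega) hc2 h.1 hpq h.2 (by omega) h0p h2q hc
  by_cases hcp : c = p
  · obtain rfl : a' = p := by omega
    subst hcp
    rcases lt_of_flat_lt hm f3 with h | ⟨-, t, ht, h1, h2⟩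
    -- Here `p` is 1 + tm. The remaining work checks that (2,q) and the translates by tm of (0,p)
    -- and (2,q) cross, which needs `q` away from two boundary values.
    · omega
    have h3 := (hS.compatible hE (hE.twist _ _ h1p)).one t ht
    have ht0 : 0 < t := lt_of_mul_lt hm0 (by omega)
    have ht1 : 1 * m ≤ t * m := mul_le_mul_of_nonneg_right ht0 hm0.le
    have hq2 : q ≠ 2 + t * m := fun he => by
      have h4 := (hS.compatible hE (hE.twist _ _ h1q)).two t he
      exact not_mul_eq (m := m) (r := 1) (by omega) (by omega) (2 * t - 5 + 2 * (5 - 2 * t))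
        (by linarith [(by omega : 1 + 5 * m = 2 + t * m + t * m)])
    have hq3 : q ≠ c + t * m := fun he => by
      rcases lt_of_flat_lt hm f5 with h | ⟨-, j, h4, h5, h6⟩
      · omega
      · have h7 : j * m = (2 * t) * m := by linarith
        have h8 : q + t * m ≤ 1 + 5 * m := by omega
        have : (3 * t) * m = 5 * m := by linarith
        have := mul_right_cancel₀ hm0.ne' this
        omega
    exact hE.noTriple 2 (t * m) (2 + t * m) q (c + t * m) (q + t * m) (by omega) (by omega)
      (by omega) (by omega) (by omega) (by omega) h2q
      (hE.of_eq_shift t h0p (by ring) rfl) (hE.shift t _ _ h2q)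
  · obtain rfl : c' = q := by omega
    obtain rfl : b' = c' := by omega
    rcases lt_of_flat_lt hm f5 with h | ⟨-, t, ht, h1, h2⟩
    · omega
    have h3 := (hS.compatible hE (hE.twist _ _ hc)).one t ht
    have ht0 : 0 < t := lt_of_mul_lt hm0 (by omega)
    have hp1 : b' ≠ p + 1 := fun he => by
      have h4 := (hS.compatible hE (hE.twist _ _ h1p)).zero t (by omega)
      exact not_mul_eq (m := m) (r := 1) (by omega) (by omega) (2 * t - 5) (by
        have : 1 + 5 * m = p + t * m := by omega
        linarith)
    have hq1 : b' + 1 ≠ 5 * m := fun he =>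
      not_mul_eq (m := m) (r := 2) (by omega) (by omega) (5 - t) (by linarith)
    exact hE.noTriple 0 (p + t * m - 5 * m) (b' + t * m - 5 * m) p (t * m) (2 + t * m) (by omega)
      (by omega) (by omega) (by omega) (by omega) (by omega) h0p
      (hE.of_eq_twist (t - 5) h0p (by ring) (by ring))
      (hE.of_eq_twist (t - 5) h2q (by ring) (by ring))

theorem Star.lt_of_chain (hm : 3 ≤ m) {E : Set (ℤ × ℤ)} (hS : Star m E p q) (hE : Good m E)
    {a a' b b' c c' : ℤ} (ha : (a, a') ∈ E) (hb : (b, b') ∈ E) (hc : (c, c') ∈ E)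
    (h : Chain m p a a' b b' c c') : a < b := by
  rcases lt_of_flat_lt hm h.1 with h1 | ⟨rfl, j, rfl, -⟩
  · exact h1
  · have h2 := h.shift (by omega) (-j)
    rw [show 1 + j * m + -j * m = 1 by ring] at h2
    exact (hS.no_bad_chain hm hE (hE.of_eq_shift (-j) ha (by ring) rfl)
      (hE.of_eq_shift (-j) hb (by ring) rfl) (hE.shift (-j) _ _ hc) h2).elim

/-- The collapse of a good set containing a star is good. -/
theorem Star.collapse_good (hm : 3 ≤ m) {E : Set (ℤ × ℤ)} (hS : Star m E p q) (hE : Good m E) :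
    Good (m - 1) (collapse m p '' E) := by
  have hp5 := hS.lt.trans hS.lt_five
  refine ⟨hE.toPeriodic.collapse hm hS.two_lt hp5, ?_⟩
  rintro _ _ _ _ _ _ h1 h2 h3 h4 h5 h6 ⟨⟨a, a'⟩, ha, rfl, rfl⟩ ⟨⟨b, b'⟩, hb, rfl, rfl⟩
    ⟨⟨c, c'⟩, hc, rfl, rfl⟩
  have hm0 : 0 < m := by omega
  have r0 : Chain m p a a' b b' c c' := ⟨h1, h2, h3, h4, h5, by rwa [flat_add_five hm0]⟩
  have r1 := r0.rotate hm0
  have r2 := r1.rotate hm0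
  have r3 := r2.rotate hm0
  have r4 := r3.rotate hm0
  have r5 := r4.rotate hm0
  have ta := hE.twist _ _ ha
  have tb := hE.twist _ _ hb
  have tc := hE.twist _ _ hc
  exact hE.noTriple a b c a' b' c' (hS.lt_of_chain hm hE ha hb hc r0)
    (hS.lt_of_chain hm hE hb hc ta r1) (hS.lt_of_chain hm hE hc ta tb r2)
    (hS.lt_of_chain hm hE ta tb tc r3)
    (hS.lt_of_chain hm hE tb tc (hE.twist _ _ ta) r4)
    (hS.lt_of_chain hm hE tc (hE.twist _ _ ta) (hE.twist _ _ tb) r5) ha hb hc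

/-- The collapse of a maximal set containing a star is maximal, and the set is recovered from its
collapse. -/
theorem Star.collapse_maxGood (hm : 3 ≤ m) {E : Set (ℤ × ℤ)} (hS : Star m E p q)
    (hE : MaxGood m E) : MaxGood (m - 1) (collapse m p '' E) := by
  refine ⟨hS.collapse_good hm hE.good, fun T hT hET => ?_⟩
  have h1 : E ⊆ pullback m p q T := fun z hz =>
    ⟨hS.subset_region hE.good hz, hET ⟨z, hz, rfl⟩⟩
  have h2 := hE.eq_of_subset (hT.pullback hm) h1
  rintro ⟨x, y⟩ h
  obtain ⟨z, hz, hzx⟩ := exists_preimage hm hS.two_lt hS.lt hS.lt_five (hT.lt _ _ h)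
    (hT.lt_add _ _ h)
  refine ⟨z, ?_, hzx⟩
  rw [← h2]
  exact ⟨hz, hzx ▸ h⟩

end

/-! ### Fibres of the collapse and the number of orbits. -/

section

variable {m p q : ℤ} {E : Set (ℤ × ℤ)}

theorem mem_orb {a b u v : ℤ} : (u, v) ∈ orb m a b ↔
    ∃ j : ℤ, (u = a + j * m ∧ v = b + j * m) ∨ (u = b + j * m ∧ v = a + 5 * m + j * m) := by
  simp only [orb, Set.mem_ofPred_eq, Prod.mk.injEq]

/-- The star chords (1,p) and (1,q) lie in different orbits, so removing them costs two orbits: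
under the contrary assumption three rotations of (0,p) and (2,q) pairwise cross. -/
theorem Star.not_one_p_one_q (hm : 3 ≤ m) (hS : Star m E p q) (hE : Good m E) {t : ℤ}
    (hp : p = 1 + t * m) (hq : q = 1 + (5 - t) * m) : False := by
  obtain ⟨hp2, hpq, hq5, h0p, h1p, h1q, h2q⟩ := hS
  have hm0 : 0 < m := by omega
  have h1 : t < 5 - t := lt_of_mul_lt hm0 (by linarith)
  have h2 : 0 < t := lt_of_mul_lt hm0 (by omega)
  have h3 : 1 * m ≤ t * m := mul_le_mul_of_nonneg_right h2 hm0.le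
  have h4 : t * m ≤ 2 * m := mul_le_mul_of_nonneg_right (by omega) hm0.le
  have h5 : q + t * m = 1 + 5 * m := by rw [hq]; ring
  exact hE.noTriple (t * m) p (2 + t * m) (p + t * m) (5 * m) (q + t * m) (by omega) (by omega)
    (by omega) (by omega) (by omega) (by omega) (hE.of_eq_shift t h0p (by ring) rfl)
    (hE.of_eq_twist 0 h0p (by ring) (by ring)) (hE.shift t _ _ h2q)

/-- The orbits of (0,p) and (2,q) are different too: otherwise (1,p) reversed and rotated becomes
(2, q + 1), which `Compatible` allows only if q + 1 is 5m, impossible modulo m. -/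
theorem Star.not_zero_p_two_q (hm : 3 ≤ m) (hS : Star m E p q) (hE : Good m E) {t : ℤ}
    (hp : p = 2 + t * m) (hq : q = (5 - t) * m) : False := by
  have h1 : (2, q + 1) ∈ E :=
    hE.of_eq_twist (-t) hS.one_p (by rw [hp]; ring) (by rw [hq]; ring)
  have h2 := (hS.compatible hE h1).two 0 (by ring)
  have h3 := hS.lt_five
  exact not_mul_eq (m := m) (r := 1) (by omega) (by omega) t
    (by linarith [(by omega : q + 1 = 5 * m)])

/-- The chords whose collapse determines them. -/
def core (m p q : ℤ) (E : Set (ℤ × ℤ)) : Set (ℤ × ℤ) :=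
  (((E \ orb m 0 1) \ orb m 0 2) \ orb m 1 p) \ orb m 1 q

theorem Star.core_periodic (hS : Star m E p q) (hE : Good m E) :
    Periodic m (core m p q E) := by
  have := hS.two_lt
  have := hS.lt
  have := hS.lt_five
  exact ((((hE.toPeriodic.diff (.orb (by omega) (by omega))).diff
    (.orb (by omega) (by omega))).diff (.orb (by omega) (by omega))).diff
    (.orb (by omega) (by omega)))

theorem core_subset : core m p q E ⊆ E := fun _ h => h.1.1.1.1

/-- For merged near ends 0 and 1, compatibility gives p ≤ v and x < p. So the far ends are merged as
well, which forces x = p - 1 and v = p at a rotated star. What compatibility leaves there is a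
coincidence of star orbits or a chord removed from the core. -/
theorem Star.collapse_inj_zero (hm : 3 ≤ m) (hS : Star m E p q) (hE : Good m E) {v x : ℤ}
    (he : (0, v) ∈ core m p q E) (hf : (1, x) ∈ core m p q E)
    (h1 : flat m p 0 v = flat m p 1 x) (h2 : flat m p v (5 * m) = flat m p x (1 + 5 * m)) :
    False := by
  obtain ⟨⟨⟨⟨he, he1⟩, he2⟩, he3⟩, he4⟩ := he
  obtain ⟨⟨⟨⟨hf, hf1⟩, hf2⟩, hf3⟩, hf4⟩ := hf
  have hm0 : 0 < m := by omega
  have hp := hS.two_lt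
  have hpq := hS.lt
  have hq5 := hS.lt_five
  have hv : p ≤ v := by
    rcases (hS.compatible hE he).zero 0 (by ring) with h | h
    · have := hE.lt _ _ he
      obtain rfl | rfl : v = 1 ∨ v = 2 := by omega
      · exact (he1 self_mem_orb).elim
      · exact (he2 self_mem_orb).elim
    · omega
  have hx : x < p := by
    have hxp : x ≠ p := fun h => hf3 (h ▸ self_mem_orb)
    by_contra! hlt
    have e1 := flat_zero (m := m) (p := p) hm 0 v
    have e2 := flat_one_high (m := m) (p := p) hm (j := 0) (x := x) (by omega)
    simp only [zero_mul, add_zero] at e1 e2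
    omega
  have hx1 := hE.lt _ _ hf
  obtain ⟨hvx, ⟨t, hxt, h3⟩ | ⟨t, hxt, h3⟩⟩ := succ_of_flat_eq hm h2.symm (by omega)
  · have hpt : p = 1 + t * m := by omega
    have h4 := (hS.compatible hE (hE.twist _ _ hf)).zero t hxt
    have h5 : t * 2 < 6 := lt_of_mul_lt hm0 (by linarith [(by omega : p + t * m ≤ 1 + 5 * m)])
    have h6 : 4 < t * 2 := lt_of_mul_lt hm0 (by linarith)
    omega
  · have hpt : p = 2 + t * m := by omega
    obtain rfl : v = p := by omega
    have h4 := (hS.compatible hE (hE.twist _ _ hf)).one t hxt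
    have h5 := (hS.compatible hE (hE.twist _ _ he)).two t hpt
    obtain h6 | h6 : q + t * m = 5 * m ∨ q + t * m = 1 + 5 * m := by omega
    · exact hS.not_zero_p_two_q hm hE hpt (by linarith)
    · exact hf4 (mem_orb.2 ⟨t - 5, Or.inr ⟨by linarith, by linarith⟩⟩)

/-- The analogous argument on the side of `q`: merged near ends 1 and 2 force x = q and v = q + 1.
-/
theorem Star.collapse_inj_one (hm : 3 ≤ m) (hS : Star m E p q) (hE : Good m E) {v x : ℤ}
    (he : (1, v) ∈ core m p q E) (hf : (2, x) ∈ core m p q E)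
    (h1 : flat m p 1 v = flat m p 2 x) (h2 : flat m p v (1 + 5 * m) = flat m p x (2 + 5 * m)) :
    False := by
  obtain ⟨⟨⟨⟨he, he1⟩, he2⟩, he3⟩, he4⟩ := he
  obtain ⟨⟨⟨⟨hf, hf1⟩, hf2⟩, hf3⟩, hf4⟩ := hf
  have hm0 : 0 < m := by omega
  have hp := hS.two_lt
  have hpq := hS.lt
  have hq5 := hS.lt_five
  have hv : q < v := by
    have hvq : v ≠ q := fun h => he4 (h ▸ self_mem_orb)
    rcases (hS.compatible hE he).one 0 (by ring) with h | h
    · have e1 := flat_one_low (m := m) (p := p) hm h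
      have e2 := flat_two (m := m) (p := p) hm 0 x
      simp only [zero_mul, add_zero] at e1 e2
      omega
    · omega
  have hv5 := hE.lt_add _ _ he
  have hx5 := hE.lt_add _ _ hf
  have hx : x ≤ q := by
    rcases (hS.compatible hE hf).two 0 (by ring) with h | h
    · omega
    obtain rfl | rfl : x = 5 * m ∨ x = 1 + 5 * m := by omega
    · exact (hf2 (mem_orb.2 ⟨0, Or.inr ⟨by ring, by ring⟩⟩)).elim
    · obtain h3 | h3 : v = 5 * m ∨ v + 2 ≤ 1 + 5 * m := by omega
      · exact (he1 (mem_orb.2 ⟨0, Or.inr ⟨by ring, by rw [h3]; ring⟩⟩)).elim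
      · have := flat_lt_of_add_two_le (p := p) hm h3 (1 + 5 * m) (2 + 5 * m)
        omega
  have hx2 := hE.lt _ _ hf
  obtain ⟨hvx, ⟨t, hxt, h3⟩ | ⟨t, hxt, h3⟩⟩ := succ_of_flat_eq hm h2.symm (by omega)
  · obtain rfl : x = q := by omega
    have h4 := (hS.compatible hE (hE.twist _ _ hf)).zero t hxt
    obtain h6 | h6 : p + t * m = 1 + 5 * m ∨ p + t * m = 2 + 5 * m := by omega
    · exact he3 (mem_orb.2 ⟨t - 5, Or.inr ⟨by linarith, by linarith⟩⟩)
    · exact hS.not_zero_p_two_q hm hE (t := 5 - t) (by linarith) (by linarith)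
  · obtain rfl : x = q := by omega
    have h4 := (hS.compatible hE (hE.twist _ _ hf)).one t hxt
    have h5 := (hS.compatible hE (hE.twist _ _ he)).two t (by omega)
    have ht : 0 < t := lt_of_mul_lt hm0 (by omega)
    have ht1 : 1 * m ≤ t * m := mul_le_mul_of_nonneg_right ht hm0.le
    obtain h6 | h6 : x + t * m = 1 + 5 * m ∨ x + t * m = 2 + 5 * m := by omega
    · have : (2 * t) * m = 5 * m := by linarith
      have := mul_right_cancel₀ hm0.ne' this
      omega
    · exact not_mul_eq (m := m) (r := 1) (by omega) (by omega) (2 * t - 5) (by linarith)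

theorem Star.not_lt_of_collapse_eq (hm : 3 ≤ m) (hS : Star m E p q) (hE : Good m E)
    {u v w x : ℤ} (he : (u, v) ∈ core m p q E) (hf : (w, x) ∈ core m p q E)
    (h : collapse m p (u, v) = collapse m p (w, x)) : ¬ u < w := by
  intro huw
  have hm0 : 0 < m := by omega
  have hC := hS.core_periodic hE
  have sh : ∀ j, flat m p (u + j * m) (v + j * m) = flat m p (w + j * m) (x + j * m) ∧
      flat m p (v + j * m) (u + j * m + 5 * m) = flat m p (x + j * m) (w + j * m + 5 * m) := by
    intro j
    have := collapse_shift (p := p) hm0 j u v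
    rw [h, ← collapse_shift hm0] at this
    exact Prod.ext_iff.1 this
  obtain ⟨rfl, ⟨j, rfl, -⟩ | ⟨j, rfl, -⟩⟩ := succ_of_flat_eq hm (Prod.ext_iff.1 h).1 huw
  · have e1 := hC.shift (-j) _ _ he
    have e2 := hC.shift (-j) _ _ hf
    obtain ⟨e3, e4⟩ := sh (-j)
    have i1 : j * m + -j * m = 0 := by ring
    have i2 : j * m + 1 + -j * m = 1 := by ring
    simp only [i1, i2, zero_add] at e1 e2 e3 e4
    exact hS.collapse_inj_zero hm hE e1 e2 e3 e4
  · have e1 := hC.shift (-j) _ _ he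
    have e2 := hC.shift (-j) _ _ hf
    obtain ⟨e3, e4⟩ := sh (-j)
    have i1 : 1 + j * m + -j * m = 1 := by ring
    have i2 : 1 + j * m + 1 + -j * m = 2 := by ring
    simp only [i1, i2] at e1 e2 e3 e4
    exact hS.collapse_inj_one hm hE e1 e2 e3 e4

theorem Star.collapse_injOn (hm : 3 ≤ m) (hS : Star m E p q) (hE : Good m E) :
    Set.InjOn (collapse m p) (core m p q E) := by
  have hm0 : 0 < m := by omega
  have hC := hS.core_periodic hE
  have first : ∀ {u v w x}, (u, v) ∈ core m p q E → (w, x) ∈ core m p q E →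
      collapse m p (u, v) = collapse m p (w, x) → u = w := fun he hf h =>
    le_antisymm (not_lt.1 (hS.not_lt_of_collapse_eq hm hE hf he h.symm))
      (not_lt.1 (hS.not_lt_of_collapse_eq hm hE he hf h))
  rintro ⟨u, v⟩ he ⟨w, x⟩ hf h
  have h1 := first he hf h
  have h2 := first (hC.twist _ _ he) (hC.twist _ _ hf) (by
    rw [collapse_twist hm0, collapse_twist hm0, h])
  rw [h1, h2]

theorem collapse_mem_orb (hm : 0 < m) {a b u v : ℤ} (h : (u, v) ∈ orb m a b) :
    collapse m p (u, v) ∈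
      orb (m - 1) (collapse m p (a, b)).1 (collapse m p (a, b)).2 := by
  obtain ⟨j, ⟨rfl, rfl⟩ | ⟨rfl, rfl⟩⟩ := mem_orb.1 h
  · rw [collapse_shift hm]
    exact mem_orb.2 ⟨j, Or.inl ⟨rfl, rfl⟩⟩
  · rw [collapse_shift hm, collapse_twist hm]
    exact mem_orb.2 ⟨j, Or.inr ⟨rfl, rfl⟩⟩

/-- The chords outside of the core have the collapse of a chord of the boundary or of the star in
the core. -/
theorem Star.exists_mem_core (hm : 3 ≤ m) (hS : Star m E p q) (hE : Good m E)
    (hbd : boundary m ⊆ E) {z : ℤ × ℤ} (hz : z ∈ E) (hzc : z ∉ core m p q E) :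
    ∃ w ∈ core m p q E, (w ∈ boundary m ∨ w = (0, p) ∨ w = (2, q)) ∧
      collapse m p z ∈ orb (m - 1) (collapse m p w).1 (collapse m p w).2 := by
  have hm0 : 0 < m := by omega
  have hp := hS.two_lt
  have hpq := hS.lt
  have hq5 := hS.lt_five
  have n1 := not_mul_eq (m := m) (r := 1) (by omega) (by omega)
  have n2 := not_mul_eq (m := m) (r := 2) (by omega) (by omega)
  have h12b : ((1, 2) : ℤ × ℤ) ∈ boundary m := by
    simp only [boundary, Set.mem_ofPred_eq]; omega
  have h12 : (1, 2) ∈ core m p q E := by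
    refine ⟨⟨⟨⟨hbd h12b, ?_⟩, ?_⟩, ?_⟩, ?_⟩ <;> rw [mem_orb] <;>
      rintro ⟨j, ⟨h1, h2⟩ | ⟨h1, h2⟩⟩
    · exact n1 j (by linarith)
    · have : j * m = 0 := by linarith
      omega
    · exact n1 j (by linarith)
    · exact n1 (-j) (by linarith)
    · have : j * m = 0 := by linarith
      omega
    · exact n1 (5 + j) (by linarith)
    · have : j * m = 0 := by linarith
      omega
    · exact n1 (5 + j) (by linarith)
  have f0 : ∀ x, flat m p 0 x = 0 := fun x => by simpa using flat_zero (m := m) (p := p) hm 0 x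
  have f2 : ∀ x, flat m p 2 x = 1 := fun x => by simpa using flat_two (m := m) (p := p) hm 0 x
  have f1l : ∀ x, x ≤ p → flat m p 1 x = 0 := fun x h => by
    simpa using flat_one_low (m := m) (p := p) hm (j := 0) (x := x) (by omega)
  have f1h : ∀ x, p < x → flat m p 1 x = 1 := fun x h => by
    simpa using flat_one_high (m := m) (p := p) hm (j := 0) (x := x) (by omega)
  have c12 := collapse_one_two (p := p) hm hp
  -- The far end only matters through its side of the threshold `p`, so moving it by one changes
  -- nothing away from the threshold.
  have eqflat : ∀ u x, (∀ t, u = 1 + t * m → p + t * m ≠ x) →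
      flat m p u x = flat m p u (x + 1) := by
    intro u x h
    have : u % m = 1 → (p + u - 1 < x ↔ p + u - 1 < x + 1) := by
      intro hu
      obtain ⟨t, ht⟩ := eq_of_mod hu
      have := h t ht
      omega
    simp only [flat]
    congr 2
    rw [eq_iff_iff]
    refine or_congr Iff.rfl (and_congr_right this)
  have hcases : z ∈ orb m 0 1 ∨ z ∈ orb m 0 2 ∨ z ∈ orb m 1 p ∨ z ∈ orb m 1 q := by
    by_contra! hcon
    exact hzc ⟨⟨⟨⟨hz, hcon.1⟩, hcon.2.1⟩, hcon.2.2.1⟩, hcon.2.2.2⟩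
  obtain ⟨u, v⟩ := z
  rcases hcases with h | h | h | h
  · refine ⟨(1, 2), h12, Or.inl h12b, ?_⟩
    have h1 := collapse_mem_orb (p := p) hm0 h
    have e : collapse m p (0, 1) = collapse m p (1, 2) := by
      rw [c12]
      simp [collapse, f0, f1h (5 * m) (by omega)]
    rwa [e] at h1
  · refine ⟨(1, 2), h12, Or.inl h12b, ?_⟩
    have h1 := collapse_mem_orb (p := p) hm0 h
    have e : collapse m p (0, 2) = collapse m p (1, 2) := by
      rw [c12]
      simp [collapse, f0, f2]
    rwa [e] at h1
  · have h1 := collapse_mem_orb (p := p) hm0 h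
    -- Normally (0,p) represents the collapse of (1,p). If it is a rotation of (1,q), it has been
    -- removed from the core too, and (2,q) takes its place.
    by_cases hc : (0, p) ∈ orb m 1 q
    · obtain ⟨t, ⟨h2, h3⟩ | ⟨h2, h3⟩⟩ := mem_orb.1 hc
      · exact (n1 (-t) (by linarith)).elim
      have hqt : q = (-t) * m := by linarith
      have hpt : p = 1 + (5 + t) * m := by linarith
      refine ⟨(2, q), ⟨⟨⟨⟨hS.two_q, ?_⟩, ?_⟩, ?_⟩, ?_⟩, Or.inr (Or.inr rfl),
        mem_orb_trans h1 ?_⟩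
      · rw [mem_orb]
        rintro ⟨j, ⟨h4, h5⟩ | ⟨h4, h5⟩⟩
        · exact n2 j (by linarith)
        · exact n1 j (by linarith)
      · rw [mem_orb]
        rintro ⟨j, ⟨h4, h5⟩ | ⟨h4, h5⟩⟩
        · exact n2 j (by linarith)
        · have : j * m = 0 := by linarith
          omega
      · rw [mem_orb]
        rintro ⟨j, ⟨h4, h5⟩ | ⟨h4, h5⟩⟩
        · exact n1 j (by linarith)
        · exact n1 (5 + t + j) (by linarith)
      · rw [mem_orb]
        rintro ⟨j, ⟨h4, h5⟩ | ⟨h4, h5⟩⟩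
        · exact n1 j (by linarith)
        · exact n2 (j - t) (by linarith)
      · have e1 : flat m p q (2 + 5 * m) = (-t) * (m - 1) := by rw [hqt, flat_zero hm]
        have e2 : flat m p p (1 + 5 * m) = 1 + (5 + t) * (m - 1) := by
          conv_lhs => rw [show flat m p p = flat m p (1 + (5 + t) * m) by rw [← hpt]]
          refine flat_one_high hm ?_
          have h5 : 5 + t < -t := lt_of_mul_lt hm0 (by linarith)
          have h6 : (2 * (5 + t)) * m ≤ 4 * m := mul_le_mul_of_nonneg_right (by omega) hm0.le
          linarith
        refine mem_orb.2 ⟨t, Or.inr ?_⟩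
        simp only [collapse, f2, e1, e2, f1l p le_rfl]
        constructor <;> ring
    · refine ⟨(0, p), ⟨⟨⟨⟨hS.zero_p, ?_⟩, ?_⟩, ?_⟩, hc⟩, Or.inr (Or.inl rfl), ?_⟩
      · rw [mem_orb]
        rintro ⟨j, ⟨h4, h5⟩ | ⟨h4, h5⟩⟩
        · have : j * m = 0 := by linarith
          omega
        · exact n1 (-j) (by linarith)
      · rw [mem_orb]
        rintro ⟨j, ⟨h4, h5⟩ | ⟨h4, h5⟩⟩
        · have : j * m = 0 := by linarith
          omega
        · exact n2 (-j) (by linarith)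
      · rw [mem_orb]
        rintro ⟨j, ⟨h4, h5⟩ | ⟨h4, h5⟩⟩
        · exact n1 (-j) (by linarith)
        · exact n1 (-5 - 2 * j) (by linarith)
      · have e : collapse m p (1, p) = collapse m p (0, p) := by
          have := eqflat p (5 * m) (fun t ht he => n1 (5 - 2 * t) (by linarith))
          simp only [collapse, f0, f1l p le_rfl, zero_add, this, add_comm 1 (5 * m)]
        rwa [e] at h1
  · have h1 := collapse_mem_orb (p := p) hm0 h
    by_cases hc : (2, q) ∈ orb m 1 p
    · obtain ⟨t, ⟨h2, h3⟩ | ⟨h2, h3⟩⟩ := mem_orb.1 hc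
      · exact (n1 t (by linarith)).elim
      have hpt : p = 2 + (-t) * m := by linarith
      have hqt : q = 1 + (5 + t) * m := by linarith
      refine ⟨(0, p), ⟨⟨⟨⟨hS.zero_p, ?_⟩, ?_⟩, ?_⟩, ?_⟩, Or.inr (Or.inl rfl),
        mem_orb_trans h1 ?_⟩
      · rw [mem_orb]
        rintro ⟨j, ⟨h4, h5⟩ | ⟨h4, h5⟩⟩
        · have : j * m = 0 := by linarith
          omega
        · exact n1 (-j) (by linarith)
      · rw [mem_orb]
        rintro ⟨j, ⟨h4, h5⟩ | ⟨h4, h5⟩⟩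
        · have : j * m = 0 := by linarith
          omega
        · exact n2 (-j) (by linarith)
      · rw [mem_orb]
        rintro ⟨j, ⟨h4, h5⟩ | ⟨h4, h5⟩⟩
        · exact n1 (-j) (by linarith)
        · exact n2 (t - j) (by linarith)
      · rw [mem_orb]
        rintro ⟨j, ⟨h4, h5⟩ | ⟨h4, h5⟩⟩
        · exact n1 (-j) (by linarith)
        · exact n1 (-5 - t - j) (by linarith)
      · have e1 : flat m p p (5 * m) = 1 + (-t) * (m - 1) := by
          conv_lhs => rw [show flat m p p = flat m p (2 + (-t) * m) by rw [← hpt]]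
          exact flat_two hm _ _
        have e2 : flat m p q (1 + 5 * m) = (5 + t) * (m - 1) := by
          rw [hqt]
          exact flat_one_low hm (by linarith)
        refine mem_orb.2 ⟨t, Or.inr ?_⟩
        simp only [collapse, f0, zero_add, e1, e2, f1h q hpq]
        constructor <;> ring
    · refine ⟨(2, q), ⟨⟨⟨⟨hS.two_q, ?_⟩, ?_⟩, hc⟩, ?_⟩, Or.inr (Or.inr rfl), ?_⟩
      · rw [mem_orb]
        rintro ⟨j, ⟨h4, h5⟩ | ⟨h4, h5⟩⟩
        · exact n2 j (by linarith)
        · exact n1 j (by linarith)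
      · rw [mem_orb]
        rintro ⟨j, ⟨h4, h5⟩ | ⟨h4, h5⟩⟩
        · exact n2 j (by linarith)
        · have : j * m = 0 := by linarith
          omega
      · rw [mem_orb]
        rintro ⟨j, ⟨h4, h5⟩ | ⟨h4, h5⟩⟩
        · exact n1 j (by linarith)
        · exact n1 (5 + 2 * j) (by linarith)
      · have e : collapse m p (1, q) = collapse m p (2, q) := by
          have := eqflat q (1 + 5 * m) (fun t ht he =>
            hS.not_one_p_one_q hm hE (t := 5 - t) (by linarith) (by linarith))
          rw [show 1 + 5 * m + 1 = 2 + 5 * m by ring] at this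
          simp only [collapse, f2, f1h q hpq, this]
        rwa [e] at h1

theorem Star.collapse_core (hm : 3 ≤ m) (hS : Star m E p q) (hE : Good m E)
    (hbd : boundary m ⊆ E) : collapse m p '' core m p q E = collapse m p '' E := by
  refine Set.Subset.antisymm (Set.image_mono core_subset) ?_
  rintro _ ⟨z, hz, rfl⟩
  by_cases hc : z ∈ core m p q E
  · exact ⟨z, hc, rfl⟩
  obtain ⟨w, hw, -, h⟩ := hS.exists_mem_core hm hE hbd hz hc
  exact ((hS.core_periodic hE).collapse hm hS.two_lt (hS.lt.trans hS.lt_five)).orb_subset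
    ⟨w, hw, rfl⟩ h

/-- The collapse is bijective from the core, and the core lacks exactly four distinct orbits of two
oriented chords each. -/
theorem Star.count_eq (hm : 3 ≤ m) (hS : Star m E p q) (hE : Good m E) (hbd : boundary m ⊆ E) :
    count m E = count (m - 1) (collapse m p '' E) + 8 := by
  have hm0 : 0 < m := by omega
  have hp := hS.two_lt
  have hpq := hS.lt
  have hq5 := hS.lt_five
  have n1 := not_mul_eq (m := m) (r := 1) (by omega) (by omega)
  have n2 := not_mul_eq (m := m) (r := 2) (by omega) (by omega)
  have z1 : ∀ {j : ℤ}, (1 : ℤ) = 1 + j * m → j * m = 0 := fun h => by linarith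
  have P1 := hE.toPeriodic.diff (.orb (a := 0) (b := 1) (by omega) (by omega))
  have P2 := P1.diff (.orb (a := 0) (b := 2) (by omega) (by omega))
  have P3 := P2.diff (.orb (a := 1) (b := p) (by omega) (by omega))
  have b1 : (0, 1) ∈ E := hbd (by simp only [boundary, Set.mem_ofPred_eq]; omega)
  have b2 : (0, 2) ∈ E := hbd (by simp only [boundary, Set.mem_ofPred_eq]; omega)
  have c1 := count_diff_orb hE.toPeriodic b1
  have c2 := count_diff_orb P1 (a := 0) (b := 2) ⟨b2, by
    rw [mem_orb]
    rintro ⟨j, ⟨h4, h5⟩ | ⟨h4, h5⟩⟩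
    · exact n1 j (by linarith)
    · exact n1 (-j) (by linarith)⟩
  have no01 : ∀ x, 1 < x → x < 5 * m → (1, x) ∉ orb m 0 1 := by
    intro x h1 h2
    rw [mem_orb]
    rintro ⟨j, ⟨h4, h5⟩ | ⟨h4, h5⟩⟩
    · exact n1 j (by linarith)
    · have := z1 h4
      omega
  have no02 : ∀ x, 1 < x → x < 5 * m → (1, x) ∉ orb m 0 2 := by
    intro x h1 h2
    rw [mem_orb]
    rintro ⟨j, ⟨h4, h5⟩ | ⟨h4, h5⟩⟩
    · exact n1 j (by linarith)
    · exact n1 (-j) (by linarith)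
  have c3 := count_diff_orb P2 (a := 1) (b := p)
    ⟨⟨hS.one_p, no01 p (by omega) (by omega)⟩, no02 p (by omega) (by omega)⟩
  have c4 := count_diff_orb P3 (a := 1) (b := q)
    ⟨⟨⟨hS.one_q, no01 q (by omega) (by omega)⟩, no02 q (by omega) (by omega)⟩, by
    rw [mem_orb]
    rintro ⟨j, ⟨h4, h5⟩ | ⟨h4, h5⟩⟩
    · have := z1 h4
      omega
    · exact hS.not_one_p_one_q hm hE (t := -j) (by linarith) (by linarith)⟩
  have c5 := count_eq_of_bijOn hm0 (by omega : 0 < m - 1) (hS.core_periodic hE)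
    ((hS.core_periodic hE).collapse hm hp (by omega)) (collapse m p) (collapse_shift hm0)
    (hS.collapse_injOn hm hE).bijOn_image
  rw [hS.collapse_core hm hE hbd] at c5
  change _ = count m (core m p q E) + 2 at c4
  omega

end

/-! ### Exchanging chords outside of a star. -/

section

variable {m p q : ℤ} {E F : Set (ℤ × ℤ)}

theorem flat_eq (u x : ℤ) :
    flat m p u x = flatMin m u + (if u % m = 1 ∧ p + u - 1 < x then 1 else 0) := by
  simp only [flat, flatMin]
  split_ifs <;> omega

/-- Long chords outside of the star are still long after collapse. -/
theorem Star.flat_add_three_le (hm : 3 ≤ m) (hS : Star m E p q) (hE : Good m E) {u v : ℤ}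
    (h : (u, v) ∈ E) (huv : u + 3 ≤ v) (h0p : (u, v) ∉ orb m 0 p) (h1p : (u, v) ∉ orb m 1 p)
    (h1q : (u, v) ∉ orb m 1 q) (h2q : (u, v) ∉ orb m 2 q) :
    flat m p u v + 3 ≤ flat m p v (u + 5 * m) := by
  have hm0 : 0 < m := by omega
  have hp := hS.two_lt
  have hpq := hS.lt
  have hq5 := hS.lt_five
  have hc := hS.compatible hE h
  have hc' := hS.compatible hE (hE.twist _ _ h)
  have e0 : u % m = 0 → p + u ≤ v ∧ v ≠ p + u := by
    intro hu
    obtain ⟨j, hj⟩ := eq_of_mod hu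
    have := hc.zero j (by omega)
    refine ⟨by omega, fun h => h0p (mem_orb.2 ⟨j, Or.inl ⟨by omega, by omega⟩⟩)⟩
  have e1 : u % m = 1 → (v ≤ p + u - 1 ∨ q + u - 1 ≤ v) ∧ v ≠ p + u - 1 ∧ v ≠ q + u - 1 := by
    intro hu
    obtain ⟨j, hj⟩ := eq_of_mod hu
    have := hc.one j (by omega)
    exact ⟨by omega, fun h => h1p (mem_orb.2 ⟨j, Or.inl ⟨by omega, by omega⟩⟩),
      fun h => h1q (mem_orb.2 ⟨j, Or.inl ⟨by omega, by omega⟩⟩)⟩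
  have e2 : v % m = 1 → u + 5 * m ≠ p + v - 1 := by
    intro hv
    obtain ⟨j, hj⟩ := eq_of_mod hv
    exact fun h => h1p (mem_orb.2 ⟨j - 5, Or.inr ⟨by rw [sub_mul]; omega, by rw [sub_mul]; omega⟩⟩)
  have e3 : v % m = 2 → (u + 5 * m ≤ q + v - 2 ∨ 5 * m + v - 2 ≤ u + 5 * m) ∧
      u + 5 * m ≠ q + v - 2 := by
    intro hv
    obtain ⟨j, hj⟩ := eq_of_mod hv
    have := hc'.two j (by omega)
    exact ⟨by omega, fun h => h2q (mem_orb.2 ⟨j - 5, Or.inr ⟨by rw [sub_mul]; omega,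
      by rw [sub_mul]; omega⟩⟩)⟩
  have r0 := Int.emod_nonneg u hm0.ne'
  have step : ∀ w, ((w % m = 0 ∧ flatMin m (w + 1) = flatMin m w ∧ (w + 1) % m = 1) ∨
      (w % m ≠ 0 ∧ flatMin m (w + 1) = flatMin m w + 1 ∧ w % m = m - 1 ∧ (w + 1) % m = 0) ∨
      (w % m ≠ 0 ∧ flatMin m (w + 1) = flatMin m w + 1 ∧ (w + 1) % m = w % m + 1)) := by
    intro w
    have h1 := flatMin_succ hm w
    rcases mod_succ hm0 w with h2 | h2 <;> split_ifs at h1 <;> omega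
  have fu : (flat m p u v = flatMin m u ∧ (u % m ≠ 1 ∨ v ≤ p + u - 1)) ∨
      (flat m p u v = flatMin m u + 1 ∧ u % m = 1 ∧ p + u - 1 < v) := by
    have := flat_eq (m := m) (p := p) u v
    split_ifs at this <;> omega
  have fv : (flat m p v (u + 5 * m) = flatMin m v ∧ (v % m ≠ 1 ∨ u + 5 * m ≤ p + v - 1)) ∨
      (flat m p v (u + 5 * m) = flatMin m v + 1 ∧ v % m = 1 ∧ p + v - 1 < u + 5 * m) := by
    have := flat_eq (m := m) (p := p) v (u + 5 * m)
    split_ifs at this <;> omega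
  have s0 := step u
  have s1 := step (u + 1)
  have s2 := step (u + 1 + 1)
  have s3 := step (u + 1 + 1 + 1)
  have s4 := step (u + 1 + 1 + 1 + 1)
  have hmono := @flatMin_mono m hm (u + 1 + 1 + 1 + 1 + 1) v
  clear step h h0p h1p h1q h2q hc hc' hS hE
  generalize flat m p u v = A at *
  generalize flat m p v (u + 5 * m) = B at *
  -- Length at least 5 needs no information on the star, since few vertices are lost in five steps.
  -- Lengths 3 and 4 use compatibility and the exclusion of the star chords.
  obtain h3 | h4 | h5 : v = u + 1 + 1 + 1 ∨ v = u + 1 + 1 + 1 + 1 ∨ u + 1 + 1 + 1 + 1 + 1 ≤ v := by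
    omega
  · subst h3
    clear s3 s4 hmono
    rcases s0 with s0 | s0 | s0 <;> rcases s1 with s1 | s1 | s1 <;>
      first
      | (exfalso; clear fu fv e0 e1 e2 e3 s2; omega)
      | rcases s2 with s2 | s2 | s2 <;>
        first
        | (exfalso; clear fu fv e0 e1 e2 e3; omega)
        | rcases fu with fu | fu <;> rcases fv with fv | fv <;> omega
  · subst h4
    clear s4 hmono
    rcases s0 with s0 | s0 | s0 <;> rcases s1 with s1 | s1 | s1 <;>
      first
      | (exfalso; clear fu fv e0 e1 e2 e3 s2 s3; omega)
      | rcases s2 with s2 | s2 | s2 <;> rcases s3 with s3 | s3 | s3 <;>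
        first
        | (exfalso; clear fu fv e0 e1 e2 e3; omega)
        | rcases fu with fu | fu <;> rcases fv with fv | fv <;> omega
  · have := hmono h5
    clear e0 e1 e2 e3 hmono
    have : A ≤ flatMin m u + 1 := by clear s0 s1 s2 s3 s4; omega
    have : flatMin m v ≤ B := by clear s0 s1 s2 s3 s4; omega
    have fu : u % m ≠ 1 → A = flatMin m u := by clear s0 s1 s2 s3 s4; omega
    clear fv
    rcases s0 with s0 | s0 | s0 <;> rcases s1 with s1 | s1 | s1 <;>
      first
      | (exfalso; clear fu s2 s3 s4; omega)
      | rcases s2 with s2 | s2 | s2 <;> rcases s3 with s3 | s3 | s3 <;>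
        first
        | (exfalso; clear fu s4; omega)
        | rcases s4 with s4 | s4 | s4 <;> omega

theorem Star.collapse_mem_orb_iff (hm : 3 ≤ m) (hS : Star m E p q) (hE : Good m E)
    {z w : ℤ × ℤ} (hz : z ∈ core m p q E) (hw : w ∈ core m p q E)
    (h : collapse m p z ∈ orb (m - 1) (collapse m p w).1 (collapse m p w).2) :
    z ∈ orb m w.1 w.2 := by
  have hm0 : 0 < m := by omega
  have hC := hS.core_periodic hE
  obtain ⟨j, h | h⟩ := h
  · rw [← collapse_shift hm0] at h
    exact ⟨j, Or.inl (hS.collapse_injOn hm hE hz (hC.shift j _ _ hw) h)⟩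
  · have e := collapse_shift (p := p) hm0 j w.2 (w.1 + 5 * m)
    rw [collapse_twist hm0] at e
    rw [← e] at h
    exact ⟨j, Or.inr (hS.collapse_injOn hm hE hz (hC.shift j _ _ (hC.twist _ _ hw)) h)⟩

theorem orb_eq_of_mem {a b u v : ℤ} (h : (u, v) ∈ orb m a b) : orb m u v = orb m a b :=
  Set.Subset.antisymm (fun ⟨_, _⟩ hz => mem_orb_trans hz h)
    (fun ⟨_, _⟩ hz => mem_orb_trans hz (mem_orb_comm h))

theorem not_mem_boundary_of_long {a b : ℤ} (h : a + 3 ≤ b) (h' : b + 3 ≤ a + 5 * m) :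
    (a, b) ∉ boundary m := by
  simp only [boundary, Set.mem_ofPred_eq]
  omega

theorem boundary_subset_diff_orb {a b : ℤ} (hbd : boundary m ⊆ E) (h : a + 3 ≤ b)
    (h' : b + 3 ≤ a + 5 * m) : boundary m ⊆ E \ orb m a b := fun ⟨_, _⟩ hz =>
  ⟨hbd hz, fun hzo => not_mem_boundary_of_long h h'
    (boundary_periodic.orb_subset hz (mem_orb_comm hzo))⟩

/-- Every long chord of a maximal set can be exchanged in exactly one way. -/
def HasFlips (m : ℤ) : Prop :=
  ∀ E, MaxGood m E → ∀ a b, (a, b) ∈ E → a + 3 ≤ b → b + 3 ≤ a + 5 * m →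
    ∃ E₂, MaxGood m E₂ ∧ E₂ ≠ E ∧ E \ orb m a b ⊆ E₂ ∧
      ∀ E₃, MaxGood m E₃ → E \ orb m a b ⊆ E₃ → E₃ = E ∨ E₃ = E₂

/-- A chord outside of a star is exchanged by exchanging its collapse. -/
theorem Star.exists_flip_of_not_mem (hm : 3 ≤ m) (hS : Star m E p q) (hE : MaxGood m E)
    (ih : HasFlips (m - 1)) {a b : ℤ} (hab : (a, b) ∈ E) (h1 : a + 3 ≤ b)
    (h2 : b + 3 ≤ a + 5 * m) (h0p : (a, b) ∉ orb m 0 p) (h1p : (a, b) ∉ orb m 1 p)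
    (h1q : (a, b) ∉ orb m 1 q) (h2q : (a, b) ∉ orb m 2 q) :
    ∃ E₂, MaxGood m E₂ ∧ E₂ ≠ E ∧ E \ orb m a b ⊆ E₂ ∧
      ∀ E₃, MaxGood m E₃ → E \ orb m a b ⊆ E₃ → E₃ = E ∨ E₃ = E₂ := by
  have hm0 : 0 < m := by omega
  have hG := hE.good
  have hbd := hE.boundary_subset
  have hE' := hS.collapse_maxGood hm hE
  have hta := hG.twist _ _ hab
  have tw : ∀ {c d}, (a, b) ∉ orb m c d → (b, a + 5 * m) ∉ orb m c d := fun h h' =>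
    h (mem_orb_trans (mem_orb_comm (mem_orb.2 ⟨0, Or.inr ⟨by ring, by ring⟩⟩)) h')
  have l1 := hS.flat_add_three_le hm hG hab h1 h0p h1p h1q h2q
  have l2 := hS.flat_add_three_le hm hG hta (by omega) (tw h0p) (tw h1p) (tw h1q) (tw h2q)
  rw [flat_add_five hm0] at l2
  obtain ⟨T, hT, hne, hsub, huniq⟩ := ih _ hE' (collapse m p (a, b)).1 (collapse m p (a, b)).2
    ⟨_, hab, rfl⟩ l1 l2
  -- A long chord outside the star is in the core, so it is determined by its collapse, and deleting
  -- its orbit corresponds to deleting the collapsed orbit.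
  have hcore : (a, b) ∈ core m p q E := by
    have key : ∀ c d, (c, d) ∈ boundary m → (a, b) ∉ orb m c d := fun c d hcd h =>
      not_mem_boundary_of_long h1 h2 (boundary_periodic.orb_subset hcd h)
    refine ⟨⟨⟨⟨hab, key 0 1 ?_⟩, key 0 2 ?_⟩, h1p⟩, h1q⟩ <;>
      simp only [boundary, Set.mem_ofPred_eq] <;> omega
  have hpb : E \ orb m a b ⊆ pullback m p q T := by
    rintro ⟨u, v⟩ ⟨hz, hzo⟩
    refine ⟨hS.subset_region hG hz, hsub ⟨⟨_, hz, rfl⟩, fun hcon => ?_⟩⟩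
    by_cases hzc : (u, v) ∈ core m p q E
    · exact hzo (hS.collapse_mem_orb_iff hm hG hzc hcore hcon)
    · obtain ⟨⟨w, x⟩, hw, hw', hzw⟩ := hS.exists_mem_core hm hG hbd hz hzc
      have h3 := hS.collapse_mem_orb_iff hm hG hcore hw
        (mem_orb_trans (mem_orb_comm hcon) hzw)
      rcases hw' with hw' | hw' | hw'
      · exact not_mem_boundary_of_long h1 h2 (boundary_periodic.orb_subset hw' h3)
      · obtain ⟨h4, h5⟩ := Prod.mk.inj hw'
        rw [h4, h5] at h3
        exact h0p h3
      · obtain ⟨h4, h5⟩ := Prod.mk.inj hw'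
        rw [h4, h5] at h3
        exact h2q h3
  obtain ⟨E₂, hpE, hE₂⟩ := (hT.good.pullback (q := q) (p := p) hm).exists_maxGood
  refine ⟨E₂, hE₂, ?_, hpb.trans hpE, fun E₃ hE₃ hF => ?_⟩
  · rintro rfl
    refine hne (hT.eq_of_subset hE'.good ?_).symm
    rintro ⟨x, y⟩ h
    obtain ⟨z, hz, hzx⟩ := exists_preimage hm hS.two_lt hS.lt hS.lt_five (hT.good.lt _ _ h)
      (hT.good.lt_add _ _ h)
    exact ⟨z, hpE ⟨hz, hzx ▸ h⟩, hzx⟩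
  -- The deleted orbit avoids the star, so every completion contains the same star and can be
  -- collapsed by the same map; uniqueness then comes from m - 1.
  · have hS₃ : Star m E₃ p q :=
      ⟨hS.two_lt, hS.lt, hS.lt_five, hF ⟨hS.zero_p, fun h => h0p (mem_orb_comm h)⟩,
        hF ⟨hS.one_p, fun h => h1p (mem_orb_comm h)⟩, hF ⟨hS.one_q, fun h => h1q (mem_orb_comm h)⟩,
        hF ⟨hS.two_q, fun h => h2q (mem_orb_comm h)⟩⟩
    have h3 : E₃ ⊆ pullback m p q (collapse m p '' E₃) := fun z hz =>
      ⟨hS₃.subset_region hE₃.good hz, z, hz, rfl⟩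
    have h4 : E ⊆ pullback m p q (collapse m p '' E) := fun z hz =>
      ⟨hS.subset_region hG hz, z, hz, rfl⟩
    have h6 : collapse m p '' E \ orb (m - 1) (collapse m p (a, b)).1 (collapse m p (a, b)).2 ⊆
        collapse m p '' E₃ := by
      rintro _ ⟨⟨⟨u, v⟩, hz, rfl⟩, hzo⟩
      exact ⟨_, hF ⟨hz, fun h => hzo (collapse_mem_orb hm0 h)⟩, rfl⟩
    rcases huniq _ (hS₃.collapse_maxGood hm hE₃) h6 with h5 | h5
    · left
      rw [h5, hE.eq_of_subset (hE'.good.pullback hm) h4] at h3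
      exact (hE₃.eq_of_subset hG h3).symm
    · right
      rw [h5] at h3
      exact (hE₃.eq_of_subset hE₂.good (h3.trans hpE)).symm

/-! ### Exchanging a chord of a star -/

/-- Exchanging the chord from `0` to `p` of a star. -/
theorem Star.exists_good_zero_p (hm : 3 ≤ m) (hS : Star m E p q) (hE : Good m E)
    (hbd : boundary m ⊆ E) (hp : p + 3 ≤ 5 * m) :
    ∃ G, Good m G ∧ E \ orb m 0 p ⊆ G ∧ ∃ z ∈ G, z ∉ E := by
  have hm0 : 0 < m := by omega
  have hp2 := hS.two_lt
  have n1 := not_mul_eq (m := m) (r := 1) (by omega) (by omega)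
  have hF := hE.diff_orb hS.zero_p
  have hbF := boundary_subset_diff_orb hbd (a := 0) (b := p) (by omega) (by omega)
  obtain ⟨P, hP, hP', h0P, hfirst⟩ := exists_first (by omega) hbF
  have hpP : p < P := by
    have h1 := (hS.compatible hE h0P.1).zero 0 (by ring)
    have h2 : P ≠ p := fun h => h0P.2 (h ▸ self_mem_orb)
    omega
  -- Repeat the greedy construction without (0,p): the first neighbour moves to P > p. Either (1,P)
  -- is new, or the next chord (2,r) is, since (0,p), (1,P), (2,r) would cross in `E`.
  by_cases h1P : (1, P) ∈ E
  swap
  · exact ⟨_, hF.union_orb_one hm h0P hP hfirst, Set.subset_union_left, (1, P),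
      Or.inr self_mem_orb, h1P⟩
  obtain ⟨r, hr, hr', h1r, hnext⟩ := exists_next hbF hP hP'
  refine ⟨_, hF.union_orb_two hm h0P hP hfirst hr h1r hr' hnext, Set.subset_union_left, (2, r),
    Or.inr self_mem_orb, fun h2r => ?_⟩
  exact hE.not_fan hS.zero_p h1P h2r hp2 hpP hr hr'

/-- Exchanging the chord from `1` to `q` of a star. -/
theorem Star.exists_good_one_q (hm : 3 ≤ m) (hS : Star m E p q) (hE : Good m E)
    (hbd : boundary m ⊆ E) (hq : q + 2 ≤ 5 * m) (h0p : (0, p) ∉ orb m 1 q) :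
    ∃ G, Good m G ∧ E \ orb m 1 q ⊆ G ∧ ∃ z ∈ G, z ∉ E := by
  have hp := hS.two_lt
  have hpq := hS.lt
  have hF := hE.diff_orb hS.one_q
  have hbF := boundary_subset_diff_orb hbd (a := 1) (b := q) (by omega) (by omega)
  obtain ⟨r, hr, hr', h1r, hnext⟩ := exists_next hbF (p := p) (by omega) (by omega)
  refine ⟨_, hF.union_orb_two hm ⟨hS.zero_p, h0p⟩ hp (fun y hy hyp h => ?_) hr h1r hr' hnext,
    Set.subset_union_left, (2, r), Or.inr self_mem_orb, fun h2r => ?_⟩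
  · have := (hS.compatible hE h.1).zero 0 (by ring)
    omega
  · have h1 := (hS.compatible hE h1r.1).one 0 (by ring)
    have h2 := (hS.compatible hE h2r).two 0 (by ring)
    have h3 : r ≠ q := fun h => h1r.2 (h ▸ self_mem_orb)
    omega

/-- The mirror image of a set of chords. -/
def mirror (E : Set (ℤ × ℤ)) : Set (ℤ × ℤ) := {z | (2 - z.2, 2 - z.1) ∈ E}

theorem mem_mirror {u v : ℤ} : (u, v) ∈ mirror E ↔ (2 - v, 2 - u) ∈ E := Iff.rfl

theorem Good.mirror (hE : Good m E) : Good m (HalfCylinder.mirror E) where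
  shift j u v h := hE.of_eq_shift (-j) h (by ring) (by ring)
  twist u v h := hE.of_eq_twist (-5) h (by ring) (by ring)
  lt u v h := by have := hE.lt _ _ h; omega
  lt_add u v h := by have := hE.lt_add _ _ h; omega
  noTriple a b c a' b' c' h1 h2 h3 h4 h5 h6 ha hb hc :=
    hE.noTriple _ _ _ _ _ _ (by omega) (by omega) (by omega) (by omega) (by omega)
      (by omega) hc hb ha

theorem mirror_orb {a b : ℤ} : mirror (orb m a b) = orb m (2 - b) (2 - a) := by
  ext ⟨u, v⟩
  rw [mem_mirror, mem_orb, mem_orb]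
  constructor
  · rintro ⟨j, ⟨h1, h2⟩ | ⟨h1, h2⟩⟩
    · exact ⟨-j, Or.inl ⟨by linarith, by linarith⟩⟩
    · exact ⟨-j - 5, Or.inr ⟨by linarith, by linarith⟩⟩
  · rintro ⟨j, ⟨h1, h2⟩ | ⟨h1, h2⟩⟩
    · exact ⟨-j, Or.inl ⟨by linarith, by linarith⟩⟩
    · exact ⟨-j - 5, Or.inr ⟨by linarith, by linarith⟩⟩

theorem mirror_boundary : mirror (boundary m) = boundary m := by
  ext ⟨u, v⟩
  simp only [mem_mirror, boundary, Set.mem_ofPred_eq]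
  omega

theorem Star.mirror (hS : Star m E p q) (hE : Good m E) :
    Star m (HalfCylinder.mirror E) (2 - q + 5 * m) (2 - p + 5 * m) where
  two_lt := by have := hS.lt_five; omega
  lt := by have := hS.lt; omega
  lt_five := by have := hS.two_lt; omega
  zero_p := hE.of_eq_twist (-5) hS.two_q (by ring) (by ring)
  one_p := hE.of_eq_twist (-5) hS.one_q (by ring) (by ring)
  one_q := hE.of_eq_twist (-5) hS.one_p (by ring) (by ring)
  two_q := hE.of_eq_twist (-5) hS.zero_p (by ring) (by ring)

/-- The reflection fixing 1 exchanges the roles of (0,p) and (2,q), and of (1,p) and (1,q), so only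
half of the star needs explicit exchanges. -/
theorem exists_good_of_mirror {a b : ℤ}
    (h : ∃ G, Good m G ∧ mirror E \ orb m (2 - b) (2 - a) ⊆ G ∧ ∃ z ∈ G, z ∉ mirror E) :
    ∃ G, Good m G ∧ E \ orb m a b ⊆ G ∧ ∃ z ∈ G, z ∉ E := by
  obtain ⟨G, hG, hsub, ⟨u, v⟩, hz, hzE⟩ := h
  refine ⟨mirror G, hG.mirror, ?_, (2 - v, 2 - u), by simpa [mem_mirror] using hz, hzE⟩
  rintro ⟨x, y⟩ ⟨hx, hxo⟩
  refine hsub ⟨by simpa [mem_mirror] using hx, fun ho => hxo ?_⟩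
  rw [← mirror_orb] at ho
  simpa [mem_mirror] using ho

/-- Every long chord of a star can be exchanged. -/
theorem Star.exists_good (hm : 3 ≤ m) (hS : Star m E p q) (hE : Good m E)
    (hbd : boundary m ⊆ E) {a b : ℤ} (h1 : a + 3 ≤ b) (h2 : b + 3 ≤ a + 5 * m)
    (hab : (a, b) ∈ orb m 0 p ∨ (a, b) ∈ orb m 1 p ∨ (a, b) ∈ orb m 1 q ∨ (a, b) ∈ orb m 2 q) :
    ∃ G, Good m G ∧ E \ orb m a b ⊆ G ∧ ∃ z ∈ G, z ∉ E := by
  have hlong : ∀ c d, (a, b) ∈ orb m c d → c + 3 ≤ d ∧ d + 3 ≤ c + 5 * m := by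
    intro c d h
    obtain ⟨j, h | h⟩ := mem_orb.1 h <;> omega
  have hbd' : boundary m ⊆ HalfCylinder.mirror E := fun ⟨u, v⟩ h => by
    rw [← mirror_boundary, mem_mirror] at h
    exact hbd h
  have zp : ∀ {E p q}, Good m E → Star m E p q → boundary m ⊆ E → (a, b) ∈ orb m 0 p →
      ∃ G, Good m G ∧ E \ orb m a b ⊆ G ∧ ∃ z ∈ G, z ∉ E := by
    intro E p q hE hS hbd h
    rw [orb_eq_of_mem h]
    exact hS.exists_good_zero_p hm hE hbd (by have := hlong _ _ h; omega)
  have hpos := hS.lt_five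
  have flip1 : orb m (2 - q) (2 - 2) = orb m 0 (2 - q + 5 * m) :=
    (orb_eq_of_mem (mem_orb.2 ⟨0, Or.inr ⟨by ring, by ring⟩⟩)).symm
  have flip2 : orb m (2 - p) (2 - 1) = orb m 1 (2 - p + 5 * m) :=
    (orb_eq_of_mem (mem_orb.2 ⟨0, Or.inr ⟨by ring, by ring⟩⟩)).symm
  have m0 : (a, b) ∈ orb m 0 p → _ := zp hE hS hbd
  have m2 : (a, b) ∈ orb m 2 q → ∃ G, Good m G ∧ E \ orb m a b ⊆ G ∧ ∃ z ∈ G, z ∉ E := by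
    intro h
    rw [orb_eq_of_mem h]
    refine exists_good_of_mirror ?_
    rw [flip1]
    exact (hS.mirror hE).exists_good_zero_p hm hE.mirror hbd' (by have := hlong _ _ h; omega)
  rcases hab with h | h | h | h
  · exact m0 h
  -- The mirrored exchange of (1,p) keeps the mirror image of (2,q), so a coincidence of these two
  -- orbits is treated as the exchange of (2,q).
  · by_cases h2q : (a, b) ∈ orb m 2 q
    · exact m2 h2q
    have hl := hlong _ _ h
    rw [orb_eq_of_mem h]
    refine exists_good_of_mirror ?_
    rw [flip2]
    refine (hS.mirror hE).exists_good_one_q hm hE.mirror hbd' (by omega) fun hcon => h2q ?_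
    rw [← flip2, ← mirror_orb, mem_mirror, ← orb_eq_of_mem h] at hcon
    refine mem_orb_trans (mem_orb_comm hcon) (mem_orb.2 ⟨-5, Or.inr ⟨by ring, by ring⟩⟩)
  · by_cases h0p : (a, b) ∈ orb m 0 p
    · exact m0 h0p
    have hl := hlong _ _ h
    rw [orb_eq_of_mem h]
    refine hS.exists_good_one_q hm hE hbd (by omega) fun hcon => h0p ?_
    exact mem_orb_trans h (mem_orb_comm hcon)
  · exact m2 h

/-! ### Uniqueness of the exchange -/

/-- A maximal set, containing a star, that has one chord up to rotation outside of `F`. -/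
structure Completion (m : ℤ) (F T : Set (ℤ × ℤ)) (p q : ℤ) : Prop where
  maxGood : MaxGood m T
  subset : F ⊆ T
  star : Star m T p q
  close : ∀ z ∈ T, z ∉ F → T ⊆ F ∪ orb m z.1 z.2

namespace Completion

variable {T T' : Set (ℤ × ℤ)} {p' q' : ℤ}

theorem eq_of_mem (h : Completion m F T p q) (h' : Completion m F T' p' q') {z : ℤ × ℤ}
    (hz : z ∈ T) (hz' : z ∈ T') (hzF : z ∉ F) : T = T' := by
  refine (h.maxGood.eq_of_subset h'.maxGood.good ((h.close z hz hzF).trans ?_)).symm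
  exact Set.union_subset h'.subset (h'.maxGood.periodic.orb_subset hz')

theorem mem_of_not_mem_orb (h : Completion m F T p q) {z w : ℤ × ℤ} (hz : z ∈ T) (hzF : z ∉ F)
    (hw : w ∈ T) (hwz : w ∉ orb m z.1 z.2) : w ∈ F :=
  (h.close z hz hzF hw).resolve_right hwz

/-- If (0,p') is the added chord, then (1,p') and (2,q') come from `F` and are in both sets; with p
< p' they form a fan with (0,p). -/
theorem zero_p_lt (hm : 3 ≤ m) (h : Completion m F T p q) (h' : Completion m F T' p' q')
    (h1' : (0, p') ∉ F) : ¬ p < p' := by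
  intro hlt
  have hm0 : 0 < m := by omega
  have n1 := not_mul_eq (m := m) (r := 1) (by omega) (by omega)
  have n2 := not_mul_eq (m := m) (r := 2) (by omega) (by omega)
  have h2 : (1, p') ∈ F := h'.mem_of_not_mem_orb h'.star.zero_p h1' h'.star.one_p (by
    rw [mem_orb]
    rintro ⟨j, ⟨h4, h5⟩ | ⟨h4, h5⟩⟩
    · exact n1 j (by linarith)
    · exact n1 (5 + 2 * j) (by linarith))
  have h3 : (2, q') ∈ F := h'.mem_of_not_mem_orb h'.star.zero_p h1' h'.star.two_q (by
    rw [mem_orb]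
    rintro ⟨j, ⟨h4, h5⟩ | ⟨h4, h5⟩⟩
    · exact n2 j (by linarith)
    · exact h'.star.not_zero_p_two_q hm h'.maxGood.good (t := -j) (by linarith) (by linarith))
  exact h.maxGood.good.not_fan h.star.zero_p (h.subset h2) (h.subset h3) h.star.two_lt hlt
    h'.star.lt h'.star.lt_five

theorem eq_of_zero_p (hm : 3 ≤ m) (h : Completion m F T p q) (h' : Completion m F T' p' q')
    (h1 : (0, p) ∉ F) (h1' : (0, p') ∉ F) : T = T' := by
  obtain rfl : p = p' := le_antisymm (not_lt.1 (h'.zero_p_lt hm h h1))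
    (not_lt.1 (h.zero_p_lt hm h' h1'))
  exact h.eq_of_mem h' h.star.zero_p h'.star.zero_p h1

theorem two_q_lt (hm : 3 ≤ m) (h : Completion m F T p q) (h' : Completion m F T' p' q')
    (h1 : (2, q) ∉ F) : ¬ q < q' := by
  intro hlt
  have hm0 : 0 < m := by omega
  have n1 := not_mul_eq (m := m) (r := 1) (by omega) (by omega)
  have n2 := not_mul_eq (m := m) (r := 2) (by omega) (by omega)
  have h2 : (0, p) ∈ F := h.mem_of_not_mem_orb h.star.two_q h1 h.star.zero_p (by
    rw [mem_orb]
    rintro ⟨j, ⟨h4, h5⟩ | ⟨h4, h5⟩⟩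
    · exact n2 (-j) (by linarith)
    · exact h.star.not_zero_p_two_q hm h.maxGood.good (t := 5 + j) (by linarith) (by linarith))
  have h3 : (1, q) ∈ F := h.mem_of_not_mem_orb h.star.two_q h1 h.star.one_q (by
    rw [mem_orb]
    rintro ⟨j, ⟨h4, h5⟩ | ⟨h4, h5⟩⟩
    · exact n1 (-j) (by linarith)
    · exact n1 (-5 - 2 * j) (by linarith))
  exact h'.maxGood.good.not_fan (h'.subset h2) (h'.subset h3) h'.star.two_q h.star.two_lt
    h.star.lt hlt h'.star.lt_five

theorem eq_of_two_q (hm : 3 ≤ m) (h : Completion m F T p q) (h' : Completion m F T' p' q')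
    (h1 : (2, q) ∉ F) (h1' : (2, q') ∉ F) : T = T' := by
  obtain rfl : q = q' := le_antisymm (not_lt.1 (h'.two_q_lt hm h h1'))
    (not_lt.1 (h.two_q_lt hm h' h1))
  exact h.eq_of_mem h' h.star.two_q h'.star.two_q h1

/-- Here (0,p) and (0,p') are both in `F`, hence in both completions, and compatibility with each
star forces p = p'. The sets then share the added chord (1,p). -/
theorem eq_of_one_p (hm : 3 ≤ m) (h : Completion m F T p q) (h' : Completion m F T' p' q')
    (h1 : (1, p) ∉ F) (h1' : (0, p') ∈ F) : T = T' := by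
  have n1 := not_mul_eq (m := m) (r := 1) (by omega) (by omega)
  have h2 : (0, p) ∈ F := h.mem_of_not_mem_orb h.star.one_p h1 h.star.zero_p (by
    rw [mem_orb]
    rintro ⟨j, ⟨h4, h5⟩ | ⟨h4, h5⟩⟩
    · exact n1 (-j) (by linarith)
    · exact n1 (-5 - 2 * j) (by linarith))
  have h3 := (h.star.compatible h.maxGood.good (h.subset h1')).zero 0 (by ring)
  have h4 := (h'.star.compatible h'.maxGood.good (h'.subset h2)).zero 0 (by ring)
  have := h.star.two_lt
  have := h'.star.two_lt
  obtain rfl : p = p' := by omega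
  exact h.eq_of_mem h' h.star.one_p h'.star.one_p h1

theorem eq_of_one_q (hm : 3 ≤ m) (h : Completion m F T p q) (h' : Completion m F T' p' q')
    (h1 : (1, q) ∉ F) (h1' : (2, q') ∈ F) : T = T' := by
  have n1 := not_mul_eq (m := m) (r := 1) (by omega) (by omega)
  have h2 : (2, q) ∈ F := h.mem_of_not_mem_orb h.star.one_q h1 h.star.two_q (by
    rw [mem_orb]
    rintro ⟨j, ⟨h4, h5⟩ | ⟨h4, h5⟩⟩
    · exact n1 j (by linarith)
    · exact n1 (5 + 2 * j) (by linarith))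
  have h3 := (h.star.compatible h.maxGood.good (h.subset h1')).two 0 (by ring)
  have h4 := (h'.star.compatible h'.maxGood.good (h'.subset h2)).two 0 (by ring)
  have := h.star.lt_five
  have := h'.star.lt_five
  obtain rfl : q = q' := by omega
  exact h.eq_of_mem h' h.star.one_q h'.star.one_q h1

/-- If one set adds its (1,p), it equals any other set whose (0,p) is in `F`; if there is none, the
two others both add their (0,p) and agree. The same works with (1,q) and (2,q). Otherwise each set
adds its (0,p) or its (2,q), and two of the three do the same. -/
theorem eq_or_eq (hm : 3 ≤ m) {T₁ T₂ T₃ : Set (ℤ × ℤ)} {p₁ q₁ p₂ q₂ p₃ q₃ : ℤ}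
    (h₁ : Completion m F T₁ p₁ q₁) (h₂ : Completion m F T₂ p₂ q₂) (h₃ : Completion m F T₃ p₃ q₃)
    (s₁ : ¬ Star m F p₁ q₁) (s₂ : ¬ Star m F p₂ q₂) (s₃ : ¬ Star m F p₃ q₃) :
    T₁ = T₂ ∨ T₁ = T₃ ∨ T₂ = T₃ := by
  have miss : ∀ {T p q}, Completion m F T p q → ¬ Star m F p q →
      (0, p) ∉ F ∨ (1, p) ∉ F ∨ (1, q) ∉ F ∨ (2, q) ∉ F := by
    intro T p q h s
    by_contra! hcon
    exact s ⟨h.star.two_lt, h.star.lt, h.star.lt_five, hcon.1, hcon.2.1, hcon.2.2.1, hcon.2.2.2⟩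
  have m1 := miss h₁ s₁
  have m2 := miss h₂ s₂
  have m3 := miss h₃ s₃
  have a12 := h₁.eq_of_zero_p hm h₂
  have a13 := h₁.eq_of_zero_p hm h₃
  have a23 := h₂.eq_of_zero_p hm h₃
  have b12 := h₁.eq_of_two_q hm h₂
  have b13 := h₁.eq_of_two_q hm h₃
  have b23 := h₂.eq_of_two_q hm h₃
  have c12 := h₁.eq_of_one_p hm h₂
  have c13 := h₁.eq_of_one_p hm h₃
  have c23 := h₂.eq_of_one_p hm h₃
  have c21 := fun x y => (h₂.eq_of_one_p hm h₁ x y).symm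
  have c31 := fun x y => (h₃.eq_of_one_p hm h₁ x y).symm
  have c32 := fun x y => (h₃.eq_of_one_p hm h₂ x y).symm
  have d12 := h₁.eq_of_one_q hm h₂
  have d13 := h₁.eq_of_one_q hm h₃
  have d23 := h₂.eq_of_one_q hm h₃
  have d21 := fun x y => (h₂.eq_of_one_q hm h₁ x y).symm
  have d31 := fun x y => (h₃.eq_of_one_q hm h₁ x y).symm
  have d32 := fun x y => (h₃.eq_of_one_q hm h₂ x y).symm
  by_cases x1 : (1, p₁) ∈ F
  swap
  · by_cases y2 : (0, p₂) ∈ F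
    · exact Or.inl (c12 x1 y2)
    by_cases y3 : (0, p₃) ∈ F
    · exact Or.inr (Or.inl (c13 x1 y3))
    exact Or.inr (Or.inr (a23 y2 y3))
  by_cases x2 : (1, p₂) ∈ F
  swap
  · by_cases y1 : (0, p₁) ∈ F
    · exact Or.inl (c21 x2 y1)
    by_cases y3 : (0, p₃) ∈ F
    · exact Or.inr (Or.inr (c23 x2 y3))
    exact Or.inr (Or.inl (a13 y1 y3))
  by_cases x3 : (1, p₃) ∈ F
  swap
  · by_cases y1 : (0, p₁) ∈ F
    · exact Or.inr (Or.inl (c31 x3 y1))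
    by_cases y2 : (0, p₂) ∈ F
    · exact Or.inr (Or.inr (c32 x3 y2))
    exact Or.inl (a12 y1 y2)
  by_cases x1 : (1, q₁) ∈ F
  swap
  · by_cases y2 : (2, q₂) ∈ F
    · exact Or.inl (d12 x1 y2)
    by_cases y3 : (2, q₃) ∈ F
    · exact Or.inr (Or.inl (d13 x1 y3))
    exact Or.inr (Or.inr (b23 y2 y3))
  by_cases x2 : (1, q₂) ∈ F
  swap
  · by_cases y1 : (2, q₁) ∈ F
    · exact Or.inl (d21 x2 y1)
    by_cases y3 : (2, q₃) ∈ F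
    · exact Or.inr (Or.inr (d23 x2 y3))
    exact Or.inr (Or.inl (b13 y1 y3))
  by_cases x3 : (1, q₃) ∈ F
  swap
  · by_cases y1 : (2, q₁) ∈ F
    · exact Or.inr (Or.inl (d31 x3 y1))
    by_cases y2 : (2, q₂) ∈ F
    · exact Or.inr (Or.inr (d32 x3 y2))
    exact Or.inl (b12 y1 y2)
  have m1 : (0, p₁) ∉ F ∨ (2, q₁) ∉ F := by simpa only [*, not_true, false_or] using m1
  have m2 : (0, p₂) ∉ F ∨ (2, q₂) ∉ F := by simpa only [*, not_true, false_or] using m2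
  have m3 : (0, p₃) ∉ F ∨ (2, q₃) ∉ F := by simpa only [*, not_true, false_or] using m3
  rcases m1 with y1 | y1 <;> rcases m2 with y2 | y2 <;> rcases m3 with y3 | y3
  · exact Or.inl (a12 y1 y2)
  · exact Or.inl (a12 y1 y2)
  · exact Or.inr (Or.inl (a13 y1 y3))
  · exact Or.inr (Or.inr (b23 y2 y3))
  · exact Or.inr (Or.inr (a23 y2 y3))
  · exact Or.inr (Or.inl (b13 y1 y3))
  · exact Or.inl (b12 y1 y2)
  · exact Or.inl (b12 y1 y2)

end Completion

/-- Each star's chords at 0 and 2 are compatible with the other star, which bounds `p` and `q` both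
ways. -/
theorem Star.unique {p' q' : ℤ} (hS : Star m E p q) (hS' : Star m E p' q') (hE : Good m E) :
    p = p' ∧ q = q' := by
  have h1 := (hS.compatible hE hS'.zero_p).zero 0 (by ring)
  have h2 := (hS'.compatible hE hS.zero_p).zero 0 (by ring)
  have h3 := (hS.compatible hE hS'.two_q).two 0 (by ring)
  have h4 := (hS'.compatible hE hS.two_q).two 0 (by ring)
  have := hS.two_lt
  have := hS'.two_lt
  have := hS.lt_five
  have := hS'.lt_five
  omega

theorem hasFlips_step (hm : 3 ≤ m) (ih : HasFlips (m - 1))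
    (hcount : ∀ E F, MaxGood m E → MaxGood m F → count m E = count m F) : HasFlips m := by
  intro E hE a b hab h1 h2
  have hm0 : 0 < m := by omega
  obtain ⟨p, q, hS⟩ := hE.exists_star hm
  have hG := hE.good
  by_cases hstar : (a, b) ∈ orb m 0 p ∨ (a, b) ∈ orb m 1 p ∨ (a, b) ∈ orb m 1 q ∨
      (a, b) ∈ orb m 2 q
  swap
  · push Not at hstar
    exact hS.exists_flip_of_not_mem hm hE ih hab h1 h2 hstar.1 hstar.2.1 hstar.2.2.1 hstar.2.2.2
  set F := E \ orb m a b with hF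
  have hFG : Good m F := hG.diff_orb hab
  have hnS : ¬ Star m F p q := fun h => by
    rcases hstar with h' | h' | h' | h'
    · exact h.zero_p.2 (mem_orb_comm h')
    · exact h.one_p.2 (mem_orb_comm h')
    · exact h.one_q.2 (mem_orb_comm h')
    · exact h.two_q.2 (mem_orb_comm h')
  -- By the constant count, `F` with one added orbit is already as large as `T`. The star of `T`
  -- cannot lie in `F`: it would be a star of `E`, hence the one that was just broken.
  have hcompl : ∀ T, MaxGood m T → F ⊆ T → ∃ p' q', Completion m F T p' q' ∧ ¬ Star m F p' q' := by
    intro T hT hFT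
    obtain ⟨p', q', hS'⟩ := hT.exists_star hm
    refine ⟨p', q', ⟨hT, hFT, hS', ?_⟩, fun h => hnS ?_⟩
    · rintro ⟨u, v⟩ hz hzF
      have hO := Periodic.orb (m := m) (hT.good.lt _ _ hz) (hT.good.lt_add _ _ hz)
      have hU := hFG.toPeriodic.union hO
      have c1 := count_diff_orb hG.toPeriodic hab
      have c2 := count_diff_orb hU (a := u) (b := v) (Or.inr self_mem_orb)
      have c3 : (F ∪ orb m u v) \ orb m u v = F := by
        ext ⟨x, y⟩
        have : (x, y) ∈ F → (x, y) ∉ orb m u v := fun h1 h2 =>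
          hzF (hFG.orb_subset h1 (mem_orb_comm h2))
        simp only [Set.mem_sdiff, Set.mem_union]
        tauto
      rw [c3] at c2
      rw [← hF] at c1
      have c4 := hcount E T hE hT
      refine (eq_of_count_le hm0 hU hT.periodic
        (Set.union_subset hFT (hT.periodic.orb_subset hz)) ?_).ge
      omega
    · have h3 : Star m E p' q' := ⟨h.two_lt, h.lt, h.lt_five, h.zero_p.1, h.one_p.1, h.one_q.1,
        h.two_q.1⟩
      obtain ⟨rfl, rfl⟩ := hS.unique h3 hG
      exact h
  obtain ⟨G, hGood, hFG', z, hz, hzE⟩ := hS.exists_good hm hG hE.boundary_subset h1 h2 hstar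
  obtain ⟨E₂, hGE, hE₂⟩ := hGood.exists_maxGood
  have hne : E₂ ≠ E := fun h => hzE (h ▸ hGE hz)
  refine ⟨E₂, hE₂, hne, hFG'.trans hGE, fun E₃ hE₃ hFE => ?_⟩
  obtain ⟨p₁, q₁, d1, s1⟩ := hcompl E hE Set.sdiff_subset
  obtain ⟨p₂, q₂, d2, s2⟩ := hcompl E₂ hE₂ (hFG'.trans hGE)
  obtain ⟨p₃, q₃, d3, s3⟩ := hcompl E₃ hE₃ hFE
  rcases d1.eq_or_eq hm d2 d3 s1 s2 s3 with h | h | h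
  · exact absurd h.symm hne
  · exact Or.inl h.symm
  · exact Or.inr h.symm

end

section

variable {m : ℤ} {E F : Set (ℤ × ℤ)}

theorem count_boundary (hm : 0 < m) : (count m (boundary m) : ℤ) = 4 * m := by
  have : window m (boundary m) = (fun z : ℤ × ℤ => (z.1, z.1 + z.2)) ''
      ((Finset.Ico 0 m ×ˢ {1, 2, 5 * m - 1, 5 * m - 2} : Finset (ℤ × ℤ)) : Set (ℤ × ℤ)) := by
    ext ⟨u, v⟩
    simp only [window, boundary, Set.mem_ofPred_eq, Set.mem_image, Finset.mem_coe,
      Finset.mem_product, Finset.mem_Ico, Finset.mem_insert, Finset.mem_singleton, Prod.exists,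
      Prod.mk.injEq]
    constructor
    · rintro h
      exact ⟨u, v - u, by omega, rfl, by omega⟩
    · rintro ⟨x, y, h1, rfl, rfl⟩
      omega
  rw [count, this, Set.InjOn.ncard_image, Set.ncard_coe_finset, Finset.card_product, Int.card_Ico,
    Finset.card_insert_of_notMem, Finset.card_insert_of_notMem, Finset.card_pair]
  · push_cast
    omega
  · omega
  · simp only [Finset.mem_insert, Finset.mem_singleton]; omega
  · simp only [Finset.mem_insert, Finset.mem_singleton]; omega
  · rintro ⟨u, v⟩ - ⟨x, y⟩ - h
    simp only [Prod.mk.injEq] at h ⊢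
    omega

/-! ### One or two marked points -/

theorem maxGood_one (hE : MaxGood 1 E) : E = boundary 1 := by
  refine Set.Subset.antisymm (fun ⟨u, v⟩ hz => ?_) hE.boundary_subset
  have := hE.good.lt _ _ hz
  have := hE.good.lt_add _ _ hz
  simp only [boundary, Set.mem_ofPred_eq]
  omega

theorem hasFlips_one : HasFlips 1 := by
  intro E hE a b hab h1 h2
  omega

/-- The maximal sets for two marked points. -/
def decagon (i j : ℤ) : Set (ℤ × ℤ) :=
  {z | z.1 < z.2 ∧ z.2 < z.1 + 10 ∧ (z.2 ≤ z.1 + 2 ∨ z.1 + 8 ≤ z.2 ∨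
    (z.2 = z.1 + 3 ∧ z.1 % 2 = i) ∨ (z.2 = z.1 + 7 ∧ z.2 % 2 = i) ∨
    (z.2 = z.1 + 4 ∧ z.1 % 2 = j) ∨ (z.2 = z.1 + 6 ∧ z.2 % 2 = j))}

theorem mem_decagon {i j u v : ℤ} : (u, v) ∈ decagon i j ↔
    u < v ∧ v < u + 10 ∧ (v ≤ u + 2 ∨ u + 8 ≤ v ∨ (v = u + 3 ∧ u % 2 = i) ∨
      (v = u + 7 ∧ v % 2 = i) ∨ (v = u + 4 ∧ u % 2 = j) ∨ (v = u + 6 ∧ v % 2 = j)) := Iff.rfl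

theorem decagon_periodic (i j : ℤ) : Periodic 2 (decagon i j) where
  shift k u v h := by rw [mem_decagon] at h ⊢; omega
  twist u v h := by rw [mem_decagon] at h ⊢; omega
  lt u v h := h.1
  lt_add u v h := h.2.1

theorem decagon_good (i j : ℤ) : Good 2 (decagon i j) := by
  refine ⟨decagon_periodic i j, fun a b c a' b' c' h1 h2 h3 h4 h5 h6 ha hb hc => ?_⟩
  have long : ∀ {u v}, (u, v) ∈ decagon i j → u + 3 ≤ v → v ≤ u + 7 →
      (v = u + 3 ∧ u % 2 = i) ∨ (v = u + 7 ∧ v % 2 = i) ∨ (v = u + 4 ∧ u % 2 = j) ∨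
      (v = u + 6 ∧ v % 2 = j) := by
    intro u v h h1 h2
    rw [mem_decagon] at h
    omega
  have ha := long ha (by omega) (by omega)
  have hb := long hb (by omega) (by omega)
  have hc := long hc (by omega) (by omega)
  rcases ha with ha | ha | ha | ha <;> rcases hb with hb | hb | hb | hb <;>
    rcases hc with hc | hc | hc | hc <;> omega

theorem mem_orb_of_three {i a b u v : ℤ} (h : (b = a + 3 ∧ a % 2 = i) ∨ (b = a + 7 ∧ b % 2 = i))
    (h' : (v = u + 3 ∧ u % 2 = i) ∨ (v = u + 7 ∧ v % 2 = i)) : (u, v) ∈ orb 2 a b := by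
  rw [mem_orb]
  rcases h with h | h <;> rcases h' with h' | h'
  · exact ⟨(u - a) / 2, by omega⟩
  · exact ⟨(u - b) / 2, by omega⟩
  · exact ⟨(u - b) / 2, by omega⟩
  · exact ⟨(u - a) / 2, by omega⟩

theorem mem_orb_of_four {j a b u v : ℤ} (h : (b = a + 4 ∧ a % 2 = j) ∨ (b = a + 6 ∧ b % 2 = j))
    (h' : (v = u + 4 ∧ u % 2 = j) ∨ (v = u + 6 ∧ v % 2 = j)) : (u, v) ∈ orb 2 a b := by
  rw [mem_orb]
  rcases h with h | h <;> rcases h' with h' | h'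
  · exact ⟨(u - a) / 2, by omega⟩
  · exact ⟨(u - b) / 2, by omega⟩
  · exact ⟨(u - b) / 2, by omega⟩
  · exact ⟨(u - a) / 2, by omega⟩

/-- Lengths 3 and 4 each have two orbits, according to the parity of the starting vertex. Both
orbits of the same length together contain a crossing triple, and length 5 crosses its own
rotations. -/
theorem Good.subset_decagon (hE : Good 2 E) :
    ∃ i j, (i = 0 ∨ i = 1) ∧ (j = 0 ∨ j = 1) ∧ E ⊆ decagon i j := by
  have norm : ∀ {u v}, (u, v) ∈ E → (u % 2, v - u + u % 2) ∈ E := fun {u v} h =>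
    hE.of_eq_shift (-(u / 2)) h (by omega) (by omega)
  have h3 : (0, 3) ∈ E → (1, 4) ∈ E → False := fun h h' =>
    hE.noTriple 0 1 2 3 4 5 (by omega) (by omega) (by omega) (by omega) (by omega) (by omega) h h'
      (hE.shift 1 0 3 h)
  have h4 : (0, 4) ∈ E → (1, 5) ∈ E → False := fun h h' =>
    hE.noTriple 0 1 2 4 5 6 (by omega) (by omega) (by omega) (by omega) (by omega) (by omega) h h'
      (hE.shift 1 0 4 h)
  obtain ⟨i, hi, hi'⟩ : ∃ i : ℤ, (i = 0 ∨ i = 1) ∧ ∀ u, (u, u + 3) ∈ E → u % 2 = i := by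
    have key : ∀ u, (u, u + 3) ∈ E → (u % 2 = 0 ∧ (0, 3) ∈ E) ∨ (u % 2 = 1 ∧ (1, 4) ∈ E) := by
      intro u hu
      have h := norm hu
      rw [add_sub_cancel_left] at h
      rcases Int.emod_two_eq_zero_or_one u with e | e <;> rw [e] at h
      · exact Or.inl ⟨e, h⟩
      · exact Or.inr ⟨e, h⟩
    by_cases h : (0, 3) ∈ E
    · exact ⟨0, Or.inl rfl, fun u hu => (key u hu).elim (·.1) fun h' => (h3 h h'.2).elim⟩
    · exact ⟨1, Or.inr rfl, fun u hu => (key u hu).elim (fun h' => (h h'.2).elim) (·.1)⟩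
  obtain ⟨j, hj, hj'⟩ : ∃ i : ℤ, (i = 0 ∨ i = 1) ∧ ∀ u, (u, u + 4) ∈ E → u % 2 = i := by
    have key : ∀ u, (u, u + 4) ∈ E → (u % 2 = 0 ∧ (0, 4) ∈ E) ∨ (u % 2 = 1 ∧ (1, 5) ∈ E) := by
      intro u hu
      have h := norm hu
      rw [add_sub_cancel_left] at h
      rcases Int.emod_two_eq_zero_or_one u with e | e <;> rw [e] at h
      · exact Or.inl ⟨e, h⟩
      · exact Or.inr ⟨e, h⟩
    by_cases h : (0, 4) ∈ E
    · exact ⟨0, Or.inl rfl, fun u hu => (key u hu).elim (·.1) fun h' => (h4 h h'.2).elim⟩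
    · exact ⟨1, Or.inr rfl, fun u hu => (key u hu).elim (fun h' => (h h'.2).elim) (·.1)⟩
  refine ⟨i, j, hi, hj, fun ⟨u, v⟩ hz => ?_⟩
  have l1 := hE.lt _ _ hz
  have l2 := hE.lt_add _ _ hz
  have l3 := hE.length_le hz
  have e3 : v = u + 3 → u % 2 = i := fun h => hi' u (h ▸ hz)
  have e4 : v = u + 4 → u % 2 = j := fun h => hj' u (h ▸ hz)
  have e7 : v = u + 7 → v % 2 = i := fun h =>
    hi' v (by have := hE.twist _ _ hz; rwa [show u + 5 * 2 = v + 3 by omega] at this)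
  have e6 : v = u + 6 → v % 2 = j := fun h =>
    hj' v (by have := hE.twist _ _ hz; rwa [show u + 5 * 2 = v + 4 by omega] at this)
  rw [mem_decagon]
  omega

theorem eq_of_decagon_subset {i j i' j' : ℤ} (hi : i = 0 ∨ i = 1) (hj : j = 0 ∨ j = 1)
    (h : decagon i j ⊆ decagon i' j') : i = i' ∧ j = j' := by
  have h1 : (i, i + 3) ∈ decagon i j := by rw [mem_decagon]; omega
  have h2 : (j, j + 4) ∈ decagon i j := by rw [mem_decagon]; omega
  have h1 := h h1
  have h2 := h h2
  rw [mem_decagon] at h1 h2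
  omega

theorem decagon_maxGood {i j : ℤ} (hi : i = 0 ∨ i = 1) (hj : j = 0 ∨ j = 1) :
    MaxGood 2 (decagon i j) := by
  refine ⟨decagon_good i j, fun F hF hsub => ?_⟩
  obtain ⟨i', j', -, -, h⟩ := Good.subset_decagon hF
  obtain ⟨rfl, rfl⟩ := eq_of_decagon_subset hi hj (hsub.trans h)
  exact h

theorem maxGood_two (hE : MaxGood 2 E) :
    ∃ i j, (i = 0 ∨ i = 1) ∧ (j = 0 ∨ j = 1) ∧ E = decagon i j := by
  obtain ⟨i, j, hi, hj, h⟩ := hE.good.subset_decagon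
  exact ⟨i, j, hi, hj, (hE.eq_of_subset (decagon_good i j) h).symm⟩

theorem count_decagon {i j : ℤ} (hi : i = 0 ∨ i = 1) (hj : j = 0 ∨ j = 1) :
    count 2 (decagon i j) = 12 := by
  have h1 : (i, i + 3) ∈ decagon i j := by rw [mem_decagon]; omega
  have h2 : (j, j + 4) ∈ decagon i j \ orb 2 i (i + 3) := by
    refine ⟨by rw [mem_decagon]; omega, ?_⟩
    rw [mem_orb]
    rintro ⟨k, h | h⟩ <;> omega
  have e : (decagon i j \ orb 2 i (i + 3)) \ orb 2 j (j + 4) = boundary 2 := by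
    ext ⟨u, v⟩
    simp only [boundary, Set.mem_sdiff, mem_decagon, mem_orb, Set.mem_ofPred_eq]
    constructor
    · rintro ⟨⟨h3, h4⟩, h5⟩
      rw [← mem_orb] at h4 h5
      have h4 := mt (mem_orb_of_three (i := i) (by omega)) h4
      have h5 := mt (mem_orb_of_four (j := j) (by omega)) h5
      omega
    · intro h
      refine ⟨⟨by omega, ?_⟩, ?_⟩ <;> rintro ⟨k, h | h⟩ <;> omega
  have hP := decagon_periodic i j
  have c1 := count_diff_orb hP h1
  have c2 := count_diff_orb
    (hP.diff (.orb (hP.lt _ _ h1) (hP.lt_add _ _ h1))) h2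
  have c3 := count_boundary (m := 2) (by norm_num)
  rw [e] at c2
  omega

/-- The four maximal sets are given by two independent parities; an exchange reverses one and the
remaining chord fixes the other. -/
theorem hasFlips_two : HasFlips 2 := by
  intro E hE a b hab h1 h2
  obtain ⟨i, j, hi, hj, rfl⟩ := maxGood_two hE
  rw [mem_decagon] at hab
  have hkey : ((b = a + 3 ∧ a % 2 = i) ∨ (b = a + 7 ∧ b % 2 = i)) ∨
      ((b = a + 4 ∧ a % 2 = j) ∨ (b = a + 6 ∧ b % 2 = j)) := by omega
  clear hab
  rcases hkey with hkey | hkey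
  · refine ⟨decagon (1 - i) j, decagon_maxGood (by omega) hj, fun h => ?_, ?_, ?_⟩
    · have := eq_of_decagon_subset (by omega) hj h.subset
      omega
    · rintro ⟨u, v⟩ ⟨hz, ho⟩
      have ho := mt (mem_orb_of_three hkey) ho
      refine ⟨hz.1, hz.2.1, ?_⟩
      rcases hz.2.2 with h | h | h | h | h
      · exact Or.inl h
      · exact Or.inr (Or.inl h)
      · exact absurd (Or.inl h) ho
      · exact absurd (Or.inr h) ho
      · exact Or.inr (Or.inr (Or.inr (Or.inr h)))
    · intro E₃ hE₃ hsub
      obtain ⟨i', j', hi', hj', rfl⟩ := maxGood_two hE₃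
      have h3 : (j, j + 4) ∈ decagon i j \ orb 2 a b := by
        refine ⟨by rw [mem_decagon]; omega, ?_⟩
        rw [mem_orb]
        clear hsub hE hE₃
        rintro ⟨k, h | h⟩ <;> rcases hkey with hkey | hkey <;> omega
      have h3 := hsub h3
      rw [mem_decagon] at h3
      clear hkey
      obtain rfl : j = j' := by omega
      obtain rfl | rfl : i' = i ∨ i' = 1 - i := by omega
      · exact Or.inl rfl
      · exact Or.inr rfl
  · refine ⟨decagon i (1 - j), decagon_maxGood hi (by omega), fun h => ?_, ?_, ?_⟩
    · have := eq_of_decagon_subset hi (by omega) h.subset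
      omega
    · rintro ⟨u, v⟩ ⟨hz, ho⟩
      have ho := mt (mem_orb_of_four hkey) ho
      refine ⟨hz.1, hz.2.1, ?_⟩
      rcases hz.2.2 with h | h | h | h | h
      · exact Or.inl h
      · exact Or.inr (Or.inl h)
      · exact Or.inr (Or.inr (Or.inl h))
      · exact Or.inr (Or.inr (Or.inr (Or.inl h)))
      · exact absurd h ho
    · intro E₃ hE₃ hsub
      obtain ⟨i', j', hi', hj', rfl⟩ := maxGood_two hE₃
      have h3 : (i, i + 3) ∈ decagon i j \ orb 2 a b := by
        refine ⟨by rw [mem_decagon]; omega, ?_⟩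
        rw [mem_orb]
        clear hsub hE hE₃
        rintro ⟨k, h | h⟩ <;> rcases hkey with hkey | hkey <;> omega
      have h3 := hsub h3
      rw [mem_decagon] at h3
      clear hkey
      obtain rfl : i = i' := by omega
      obtain rfl | rfl : j' = j ∨ j' = 1 - j := by omega
      · exact Or.inl rfl
      · exact Or.inr rfl

/-! ### Any number of marked points -/

theorem count_and_hasFlips (n : ℕ) :
    (∀ E, MaxGood (n + 1 : ℤ) E → count (n + 1 : ℤ) E = 8 * n + 4) ∧ HasFlips (n + 1 : ℤ) := by
  induction n with
  | zero =>
    refine ⟨fun E hE => ?_, by simpa using hasFlips_one⟩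
    norm_num at hE ⊢
    have := count_boundary (m := 1) (by norm_num)
    rw [maxGood_one hE]
    omega
  | succ k ih =>
    obtain rfl | hk := Nat.eq_zero_or_pos k
    · norm_num
      refine ⟨fun E hE => ?_, hasFlips_two⟩
      obtain ⟨i, j, hi, hj, rfl⟩ := maxGood_two hE
      exact count_decagon hi hj
    -- The collapse needs 0, 1, 2 to be distinct modulo the period, so periods 1 and 2 are separate
    -- base cases.
    have hm : (3 : ℤ) ≤ ((k + 1 : ℕ) : ℤ) + 1 := by omega
    have e : ((k + 1 : ℕ) : ℤ) + 1 - 1 = k + 1 := by push_cast; ring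
    have hc : ∀ E, MaxGood (((k + 1 : ℕ) : ℤ) + 1) E →
        count (((k + 1 : ℕ) : ℤ) + 1) E = 8 * (k + 1) + 4 := by
      intro E hE
      obtain ⟨p, q, hS⟩ := hE.exists_star hm
      have h := hS.collapse_maxGood hm hE
      rw [hS.count_eq hm hE.good hE.boundary_subset]
      rw [e] at h ⊢
      rw [ih.1 _ h]
      ring
    refine ⟨hc, hasFlips_step hm (e ▸ ih.2) fun E F hE hF => ?_⟩
    rw [hc E hE, hc F hF]

theorem MaxGood.count_eq {n : ℕ} (hn : 1 ≤ n) (hE : MaxGood n E) : count n E = 8 * (n - 1) + 4 := by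
  obtain ⟨k, rfl⟩ := Nat.exists_eq_add_of_le' hn
  push_cast at hE ⊢
  simpa using (count_and_hasFlips k).1 E hE

theorem hasFlips {n : ℕ} (hn : 1 ≤ n) : HasFlips n := by
  obtain ⟨k, rfl⟩ := Nat.exists_eq_add_of_le' hn
  exact_mod_cast (count_and_hasFlips k).2

end

section

/-! ### From the half-cylinder to chords of a polygon -/

theorem crossingFree_three_iff {L : Set CoverEdge} :
    CrossingFree 3 L ↔ ∀ e ∈ L, ∀ f ∈ L, ∀ g ∈ L, e.lo < f.lo → f.lo < g.lo → g.lo < e.hi →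
      e.hi < f.hi → f.hi < g.hi → False := by
  classical
  constructor
  · intro h e he f hf g hg h1 h2 h3 h4 h5
    have n1 : e ≠ f := fun h => by rw [h] at h1; omega
    have n2 : e ≠ g := fun h => by rw [h] at h1; omega
    have n3 : f ≠ g := fun h => by rw [h] at h2; omega
    refine h {e, f, g} ?_ ⟨Finset.card_eq_three.2 ⟨e, f, g, n1, n2, n3, rfl⟩, ?_⟩
    · intro x hx
      simp only [Finset.coe_insert, Finset.coe_singleton, Set.mem_insert_iff,
        Set.mem_singleton_iff] at hx
      rcases hx with rfl | rfl | rfl <;> assumption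
    · intro x hx y hy hxy
      simp only [Finset.coe_insert, Finset.coe_singleton, Set.mem_insert_iff,
        Set.mem_singleton_iff] at hx hy
      unfold CoverEdge.Intersects
      rcases hx with rfl | rfl | rfl <;> rcases hy with rfl | rfl | rfl <;>
        first
        | exact absurd rfl hxy
        | omega
  · rintro h s hs ⟨hc, hp⟩
    obtain ⟨e, f, g, n1, n2, n3, rfl⟩ := Finset.card_eq_three.1 hc
    have i1 := hp (x := e) (by simp) (y := f) (by simp) n1
    have i2 := hp (x := e) (by simp) (y := g) (by simp) n2
    have i3 := hp (x := f) (by simp) (y := g) (by simp) n3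
    have he : e ∈ L := hs (by simp)
    have hf : f ∈ L := hs (by simp)
    have hg : g ∈ L := hs (by simp)
    unfold CoverEdge.Intersects at i1 i2 i3
    rcases i1 with i1 | i1 <;> rcases i2 with i2 | i2 <;> rcases i3 with i3 | i3
    · exact h e he f hf g hg (by omega) (by omega) (by omega) (by omega) (by omega)
    · exact h e he g hg f hf (by omega) (by omega) (by omega) (by omega) (by omega)
    · omega
    · exact h g hg e he f hf (by omega) (by omega) (by omega) (by omega) (by omega)
    · exact h f hf e he g hg (by omega) (by omega) (by omega) (by omega) (by omega)
    · omega
    · exact h f hf g hg e he (by omega) (by omega) (by omega) (by omega) (by omega)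
    · exact h g hg f hf e he (by omega) (by omega) (by omega) (by omega) (by omega)

variable {n : ℕ}

theorem proj_eq_iff {a b : CoverEdge} :
    proj n a = proj n b ↔ ∃ l : ℤ, b.lo = a.lo + l * n ∧ b.hi = a.hi + l * n := by
  constructor
  · intro h
    obtain ⟨l, rfl⟩ := Quotient.exact h
    exact ⟨l, rfl, rfl⟩
  · rintro ⟨l, h1, h2⟩
    exact Quotient.sound ⟨l, CoverEdge.ext h1 h2⟩

theorem proj_surjective (e : Edge n) : ∃ a, proj n a = e := Quotient.exists_rep e

theorem proj_shift (a : CoverEdge) (l : ℤ) : proj n (a.shift (l * n)) = proj n a :=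
  (proj_eq_iff.2 ⟨l, rfl, rfl⟩).symm

theorem length_proj (a : CoverEdge) : ((proj n a).length : ℤ) = a.hi - a.lo :=
  Int.toNat_of_nonneg (by have := a.lt; omega)

theorem isRelevant_proj {a : CoverEdge} :
    (proj n a).IsRelevant 2 ↔ a.lo + 3 ≤ a.hi ∧ a.hi ≤ a.lo + 2 * n := by
  have := length_proj (n := n) a
  unfold Edge.IsRelevant
  omega

/-- The chords of the `5 * n`-gon given by a set of relevant edges, together with the sides and the
chords of length two. -/
def chords (s : Set (RelevantEdge n 2)) : Set (ℤ × ℤ) :=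
  {z | ∃ e ∈ s, ∃ a : CoverEdge, proj n a = e.1 ∧ (z = (a.lo, a.hi) ∨ z = (a.hi, a.lo + 5 * n))} ∪
    boundary n

/-- The relevant edges given by a set of chords of the `5 * n`-gon. -/
def edges (n : ℕ) (E : Set (ℤ × ℤ)) : Set (RelevantEdge n 2) :=
  {e | ∃ a : CoverEdge, proj n a = e.1 ∧ (a.lo, a.hi) ∈ E}

/-- A set of relevant edges without three pairwise crossing ones. -/
def IsFace (s : Set (RelevantEdge n 2)) : Prop := CrossingFree 3 (lift (Subtype.val '' s))

variable {s t : Set (RelevantEdge n 2)} {E F : Set (ℤ × ℤ)}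

theorem chords_mono (h : s ⊆ t) : chords s ⊆ chords t :=
  Set.union_subset_union_left _ fun _ ⟨e, he, hz⟩ => ⟨e, h he, hz⟩

theorem edges_mono (h : E ⊆ F) : edges n E ⊆ edges n F :=
  fun _ ⟨a, ha, hz⟩ => ⟨a, ha, h hz⟩

theorem chords_periodic (s : Set (RelevantEdge n 2)) : Periodic n (chords s) := by
  have hlen : ∀ {e : RelevantEdge n 2} {a : CoverEdge}, proj n a = e.1 →
      a.lo < a.hi ∧ a.hi ≤ a.lo + 2 * n ∧ (0 : ℤ) < n := by
    rintro ⟨e, he⟩ a rfl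
    rw [isRelevant_proj] at he
    omega
  have hB := boundary_periodic (m := n)
  refine ⟨?_, ?_, ?_, ?_⟩
  · rintro j u v (⟨e, he, a, ha, hz | hz⟩ | h)
    · obtain ⟨rfl, rfl⟩ := Prod.mk.inj hz
      exact Or.inl ⟨e, he, a.shift (j * n), by rw [proj_shift, ha], Or.inl rfl⟩
    · obtain ⟨rfl, rfl⟩ := Prod.mk.inj hz
      exact Or.inl ⟨e, he, a.shift (j * n), by rw [proj_shift, ha],
        Or.inr (by simp only [CoverEdge.shift]; ext <;> ring)⟩
    · exact Or.inr (hB.shift j u v h)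
  · rintro u v (⟨e, he, a, ha, hz | hz⟩ | h)
    · obtain ⟨rfl, rfl⟩ := Prod.mk.inj hz
      exact Or.inl ⟨e, he, a, ha, Or.inr rfl⟩
    · obtain ⟨rfl, rfl⟩ := Prod.mk.inj hz
      exact Or.inl ⟨e, he, a.shift (5 * n), by rw [proj_shift, ha], Or.inl rfl⟩
    · exact Or.inr (hB.twist u v h)
  · rintro u v (⟨e, he, a, ha, hz | hz⟩ | h)
    · have := hlen ha
      obtain ⟨rfl, rfl⟩ := Prod.mk.inj hz
      omega
    · have := hlen ha
      obtain ⟨rfl, rfl⟩ := Prod.mk.inj hz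
      omega
    · exact hB.lt u v h
  · rintro u v (⟨e, he, a, ha, hz | hz⟩ | h)
    · have := hlen ha
      obtain ⟨rfl, rfl⟩ := Prod.mk.inj hz
      omega
    · have := hlen ha
      obtain ⟨rfl, rfl⟩ := Prod.mk.inj hz
      omega
    · exact hB.lt_add u v h

theorem mem_chords_of_mem {a : CoverEdge} {h : (proj n a).IsRelevant 2}
    (ha : (⟨proj n a, h⟩ : RelevantEdge n 2) ∈ s) : (a.lo, a.hi) ∈ chords s :=
  Or.inl ⟨_, ha, a, rfl, Or.inl rfl⟩

theorem mem_of_mem_chords {a : CoverEdge} (h : (proj n a).IsRelevant 2)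
    (ha : (a.lo, a.hi) ∈ chords s) : (⟨proj n a, h⟩ : RelevantEdge n 2) ∈ s := by
  have hl := isRelevant_proj.1 h
  rcases ha with ⟨⟨e, he'⟩, he, b, rfl, hz | hz⟩ | hb
  · obtain ⟨h1, h2⟩ := Prod.mk.inj hz
    obtain rfl : a = b := CoverEdge.ext h1 h2
    exact he
  · obtain ⟨h1, h2⟩ := Prod.mk.inj hz
    rw [isRelevant_proj] at he'
    omega
  · simp only [boundary, Set.mem_ofPred_eq] at hb
    omega

theorem edges_chords (s : Set (RelevantEdge n 2)) : edges n (chords s) = s := by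
  ext ⟨e, he⟩
  constructor
  · rintro ⟨a, rfl, ha⟩
    exact mem_of_mem_chords he ha
  · intro h
    obtain ⟨a, rfl⟩ := proj_surjective e
    exact ⟨a, rfl, mem_chords_of_mem h⟩

/-- By `Good.length_le`, a long chord has length at most 2n in one of its two orientations, and is
therefore the image of a relevant edge. -/
theorem chords_edges (hE : Good n E) (hbd : boundary n ⊆ E) : chords (edges n E) = E := by
  apply Set.Subset.antisymm
  · rintro ⟨u, v⟩ (⟨⟨_, _⟩, ⟨b, rfl, hb⟩, a, ha, hz⟩ | h)
    · obtain ⟨l, h1, h2⟩ := proj_eq_iff.1 ha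
      have : (a.lo, a.hi) ∈ E := hE.of_eq_shift (-l) hb (by linarith) (by linarith)
      rcases hz with hz | hz
      · rw [hz]; exact this
      · rw [hz]; exact hE.twist _ _ this
    · exact hbd h
  · rintro ⟨u, v⟩ hz
    by_cases hb : (u, v) ∈ boundary n
    · exact Or.inr hb
    have h1 := hE.lt _ _ hz
    have h2 := hE.lt_add _ _ hz
    simp only [boundary, Set.mem_ofPred_eq] at hb
    rcases hE.length_le hz with h3 | h3
    · exact Or.inl ⟨⟨proj n ⟨u, v, h1⟩, isRelevant_proj.2 (by dsimp only; omega)⟩, ⟨_, rfl, hz⟩,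
        ⟨u, v, h1⟩, rfl, Or.inl rfl⟩
    · have hlt : v - 5 * n < u := by omega
      exact Or.inl ⟨⟨proj n ⟨v - 5 * n, u, hlt⟩, isRelevant_proj.2 (by dsimp only; omega)⟩,
        ⟨_, rfl, hE.of_eq_twist (-5) hz (by ring) (by ring)⟩, ⟨v - 5 * n, u, hlt⟩, rfl,
        Or.inr (by ext <;> simp)⟩

theorem mem_lift_image {a : CoverEdge} : a ∈ lift (Subtype.val '' s) ↔
    ∃ h : (proj n a).IsRelevant 2, (⟨proj n a, h⟩ : RelevantEdge n 2) ∈ s := by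
  constructor
  · rintro ⟨⟨e, he⟩, hs, h⟩
    obtain rfl : e = proj n a := h
    exact ⟨he, hs⟩
  · rintro ⟨h, hs⟩
    exact ⟨_, hs, rfl⟩

/-- The issue is that the polygon has crossing triples that do not come from three crossing edges on
the line; invariance under rotation removes the difference. -/
theorem isFace_iff : IsFace s ↔ Good n (chords s) := by
  have hP := chords_periodic s
  rw [IsFace, crossingFree_three_iff]
  constructor
  · intro h
    have key : ∀ {a b c a' b' c' : ℤ}, a < b → b < c → c < a' → a' < b' → b' < c' →
        (a, a') ∈ chords s → (b, b') ∈ chords s → (c, c') ∈ chords s →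
        a' ≤ a + 2 * n → b' ≤ b + 2 * n → c' ≤ c + 2 * n → False := by
      intro a b c a' b' c' h1 h2 h3 h4 h5 ha hb hc la lb lc
      have memL : ∀ {u v : ℤ} (huv : u < v), (u, v) ∈ chords s → u + 3 ≤ v → v ≤ u + 2 * n →
          (⟨u, v, huv⟩ : CoverEdge) ∈ lift (Subtype.val '' s) := by
        intro u v huv h1 h2 h3
        have hr : (proj n ⟨u, v, huv⟩).IsRelevant 2 := isRelevant_proj.2 ⟨h2, h3⟩
        exact mem_lift_image.2 ⟨hr, mem_of_mem_chords hr h1⟩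
      exact h _ (memL (by omega) ha (by omega) la) _ (memL (by omega) hb (by omega) lb) _
        (memL (by omega) hc (by omega) lc) h1 h2 h3 h4 h5
    -- The short sides of the three chords go round the whole polygon. Turning the second back by n
    -- and the third by 2n gives three crossing edges of the cover.
    have centre : ∀ {p₁ p₂ p₃ p₄ p₅ p₆ : ℤ}, p₁ < p₂ → p₂ < p₃ → p₃ < p₄ → p₄ < p₅ → p₅ < p₆ →
        p₆ < p₁ + 5 * n → (p₁, p₄) ∈ chords s → (p₃, p₆) ∈ chords s →
        (p₅, p₂ + 5 * n) ∈ chords s → p₄ ≤ p₁ + 2 * n → p₆ ≤ p₃ + 2 * n →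
        p₂ + 5 * n ≤ p₅ + 2 * n → False := by
      intro p₁ p₂ p₃ p₄ p₅ p₆ h1 h2 h3 h4 h5 h6 hA hB hC lA lB lC
      exact key (by omega) (by omega) (by omega) (by omega) (by omega) hA
        (hP.shift (-1) _ _ hB) (hP.shift (-2) _ _ hC) (by omega) (by omega) (by omega)
    refine ⟨hP, fun a b c a' b' c' h1 h2 h3 h4 h5 h6 ha hb hc => ?_⟩
    have short : ∀ {u v : ℤ}, (u, v) ∈ chords s → u + 3 ≤ v → v + 3 ≤ u + 5 * n →
        v ≤ u + 2 * n ∨ u + 5 * n ≤ v + 2 * n := by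
      rintro u v (⟨⟨e, he⟩, -, x, rfl, hz | hz⟩ | hb) h1 h2
      · rw [isRelevant_proj] at he
        obtain ⟨rfl, rfl⟩ := Prod.mk.inj hz
        exact Or.inl he.2
      · rw [isRelevant_proj] at he
        obtain ⟨rfl, rfl⟩ := Prod.mk.inj hz
        right; omega
      · simp only [boundary, Set.mem_ofPred_eq] at hb
        omega
    have ta := hP.twist _ _ ha
    have tb := hP.twist _ _ hb
    have tc := hP.twist _ _ hc
    have ub := hP.of_eq_twist (u' := b' - 5 * n) (v' := b) (-5) hb (by ring) (by ring)
    have uc := hP.of_eq_twist (u' := c' - 5 * n) (v' := c) (-5) hc (by ring) (by ring)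
    -- The eight choices of short sides: in six, the short orientations start at cyclically
    -- consecutive endpoints and cross on the line; the other two surround the centre.
    rcases short ha (by omega) (by omega) with la | la <;>
      rcases short hb (by omega) (by omega) with lb | lb <;>
      rcases short hc (by omega) (by omega) with lc | lc
    · exact key h1 h2 h3 h4 h5 ha hb hc la lb lc
    · exact key (by omega) h1 h2 h3 h4 uc ha hb (by omega) la lb
    · exact centre h1 h2 h3 h4 h5 h6 ha hc tb la lc lb
    · exact key (by omega) (by omega) h1 h2 h3 ub uc ha (by omega) (by omega) la
    · exact key h2 h3 h4 h5 h6 hb hc ta lb lc la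
    · exact centre h2 h3 h4 h5 h6 (by omega) hb ta tc lb la lc
    · exact key h3 h4 h5 h6 (by omega) hc ta tb lc la lb
    · exact key h4 h5 h6 (by omega) (by omega) ta tb tc la lb lc
  · intro h e he f hf g hg h1 h2 h3 h4 h5
    obtain ⟨re, he⟩ := mem_lift_image.1 he
    obtain ⟨rf, hf⟩ := mem_lift_image.1 hf
    obtain ⟨rg, hg⟩ := mem_lift_image.1 hg
    refine h.noTriple _ _ _ _ _ _ h1 h2 h3 h4 h5 ?_ (mem_chords_of_mem he) (mem_chords_of_mem hf)
      (mem_chords_of_mem hg)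
    rw [isRelevant_proj] at re rg
    omega

theorem finite_relevantEdge (n : ℕ) : Finite (RelevantEdge n 2) := by
  obtain rfl | hn := Nat.eq_zero_or_pos n
  · refine @Finite.of_subsingleton _ ⟨fun ⟨e, he⟩ => ?_⟩
    unfold Edge.IsRelevant at he
    omega
  have : ({e : Edge n | e.IsRelevant 2} : Set (Edge n)) ⊆ (fun z : ℤ × ℤ =>
      if h : z.1 < z.2 then proj n ⟨z.1, z.2, h⟩ else proj n ⟨0, 1, by norm_num⟩) ''
      (Set.Icc 0 (n : ℤ) ×ˢ Set.Icc 0 (3 * n : ℤ)) := by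
    intro e he
    obtain ⟨a, rfl⟩ := proj_surjective e
    simp only [Set.mem_ofPred_eq, isRelevant_proj] at he
    have h0 := Int.emod_nonneg a.lo (by omega : (n : ℤ) ≠ 0)
    have h1 := Int.emod_lt_of_pos a.lo (by omega : (0 : ℤ) < n)
    have h2 := Int.emod_def a.lo n
    refine ⟨(a.lo % n, a.hi - a.lo + a.lo % n), ?_, ?_⟩
    · simp only [Set.mem_prod, Set.mem_Icc]
      omega
    · dsimp only
      rw [dif_pos (by omega), proj_eq_iff]
      exact ⟨a.lo / n, by dsimp only; linarith, by dsimp only; linarith⟩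
  exact (((Set.finite_Icc _ _).prod (Set.finite_Icc _ _)).image _).subset this

/-- Each relevant edge contributes one orbit, so two oriented chords, on top of the 4n short ones.
This converts the invariant count into the size of a facet. -/
theorem count_chords (hn : 1 ≤ n) (s : Set (RelevantEdge n 2)) :
    count n (chords s) = 4 * n + 2 * s.ncard := by
  have := finite_relevantEdge n
  induction s, s.toFinite using Set.Finite.induction_on with
  | empty =>
    have h : chords (∅ : Set (RelevantEdge n 2)) = boundary n := by simp [chords]
    have := count_boundary (m := n) (by omega)
    rw [h, Set.ncard_empty]
    omega
  | @insert e s he hs ih =>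
    obtain ⟨e, hr⟩ := e
    obtain ⟨a, rfl⟩ := proj_surjective e
    have hmem : (a.lo, a.hi) ∈ chords (insert ⟨proj n a, hr⟩ s) :=
      mem_chords_of_mem (Set.mem_insert _ _)
    have hlen := isRelevant_proj.1 hr
    have hd : chords (insert ⟨proj n a, hr⟩ s) \ orb n a.lo a.hi = chords s := by
      apply Set.Subset.antisymm
      · rintro ⟨u, v⟩ ⟨⟨f, hf, b, hb, hz⟩ | h, ho⟩
        · rcases hf with rfl | hf
          · refine absurd ?_ ho
            obtain ⟨l, h1, h2⟩ := proj_eq_iff.1 hb.symm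
            rw [mem_orb]
            rcases hz with hz | hz <;> obtain ⟨rfl, rfl⟩ := Prod.mk.inj hz
            · exact ⟨l, Or.inl ⟨h1, h2⟩⟩
            · exact ⟨l, Or.inr ⟨h2, by linarith⟩⟩
          · exact Or.inl ⟨f, hf, b, hb, hz⟩
        · exact Or.inr h
      · rintro ⟨u, v⟩ h
        refine ⟨chords_mono (Set.subset_insert _ _) h, fun ho => he ?_⟩
        exact mem_of_mem_chords hr ((chords_periodic s).orb_subset h (mem_orb_comm ho))
    rw [count_diff_orb (chords_periodic _) hmem, hd, ih, Set.ncard_insert_of_notMem he hs]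
    ring

theorem MaxGood.exists_chords (hE : MaxGood n E) : chords (edges n E) = E :=
  chords_edges hE.good hE.boundary_subset

theorem maximal_isFace_iff : Maximal IsFace s ↔ MaxGood n (chords s) := by
  constructor
  · refine fun h => ⟨isFace_iff.1 h.prop, fun F hF hsub => ?_⟩
    have hc : chords (edges n F) = F := chords_edges hF (Set.subset_union_right.trans hsub)
    have h1 : IsFace (edges n F) := by rwa [isFace_iff, hc]
    have h2 : s ⊆ edges n F := by simpa only [edges_chords] using edges_mono (n := n) hsub
    rw [← hc]
    exact chords_mono (h.le_of_ge h1 h2)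
  · refine fun h => ⟨isFace_iff.2 h.good, fun t ht hst => ?_⟩
    have := edges_mono (n := n) (h.le_of_ge (isFace_iff.1 ht) (chords_mono hst))
    simpa only [edges_chords] using this

theorem IsFace.exists_maximal (hs : IsFace s) : ∃ t, s ⊆ t ∧ Maximal IsFace t := by
  obtain ⟨F, hF, hmax⟩ := (isFace_iff.1 hs).exists_maxGood
  refine ⟨edges n F, by simpa only [edges_chords] using edges_mono (n := n) hF, ?_⟩
  rwa [maximal_isFace_iff, hmax.exists_chords]

theorem ncard_of_maximal (hn : 1 ≤ n) (hs : Maximal IsFace s) : s.ncard = 2 * (n - 1) := by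
  have h1 := (maximal_isFace_iff.1 hs).count_eq hn
  rw [count_chords hn] at h1
  omega

theorem exists_flip (hn : 1 ≤ n) (hs : Maximal IsFace s) {e : RelevantEdge n 2} (he : e ∈ s) :
    ∃ s₂, Maximal IsFace s₂ ∧ s₂ ≠ s ∧ s \ {e} ⊆ s₂ ∧
      ∀ s₃, Maximal IsFace s₃ → s \ {e} ⊆ s₃ → s₃ = s ∨ s₃ = s₂ := by
  obtain ⟨e, hr⟩ := e
  obtain ⟨a, rfl⟩ := proj_surjective e
  have hlen := isRelevant_proj.1 hr
  obtain ⟨E₂, hE₂, hne, hsub, huniq⟩ := hasFlips hn _ (maximal_isFace_iff.1 hs) a.lo a.hi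
    (mem_chords_of_mem he) (by omega) (by omega)
  have key : ∀ t : Set (RelevantEdge n 2), s \ {⟨proj n a, hr⟩} ⊆ t ↔
      chords s \ orb n a.lo a.hi ⊆ chords t := by
    intro t
    constructor
    · rintro h ⟨u, v⟩ ⟨⟨f, hf, b, hb, hz⟩ | h', ho⟩
      · refine Or.inl ⟨f, h ⟨hf, ?_⟩, b, hb, hz⟩
        rintro rfl
        refine ho ?_
        obtain ⟨l, h1, h2⟩ := proj_eq_iff.1 hb.symm
        rw [mem_orb]
        rcases hz with hz | hz <;> obtain ⟨rfl, rfl⟩ := Prod.mk.inj hz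
        · exact ⟨l, Or.inl ⟨h1, h2⟩⟩
        · exact ⟨l, Or.inr ⟨h2, by linarith⟩⟩
      · exact Or.inr h'
    · rintro h ⟨f, hf⟩ ⟨hfs, hfe⟩
      obtain ⟨b, rfl⟩ := proj_surjective f
      refine mem_of_mem_chords hf (h ⟨mem_chords_of_mem hfs, fun ho => hfe ?_⟩)
      have hlb := isRelevant_proj.1 hf
      rw [mem_orb] at ho
      obtain ⟨l, ⟨h1, h2⟩ | ⟨h1, h2⟩⟩ := ho
      · exact Subtype.ext (proj_eq_iff.2 ⟨l, h1, h2⟩).symm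
      · omega
  have hc := hE₂.exists_chords
  refine ⟨edges n E₂, by rwa [maximal_isFace_iff, hc], fun h => hne ?_, ?_, fun s₃ h₃ hsub₃ => ?_⟩
  · rw [← hc, h]
  · rwa [key, hc]
  · rcases huniq _ (maximal_isFace_iff.1 h₃) ((key _).1 hsub₃) with h | h
    · left; rw [← edges_chords s₃, h, edges_chords]
    · right; rw [← edges_chords s₃, h]

end

section

variable {n : ℕ} {s : Set (RelevantEdge n 2)} {T T' : Set (Edge n)}

/-! ### Triangulations and faces -/

theorem length_le_of_crossingFree (hn : 1 ≤ n) (hT : CrossingFree 3 (lift T)) {e : Edge n}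
    (he : e ∈ T) :
    e.length ≤ 2 * n := by
  obtain ⟨a, rfl⟩ := proj_surjective e
  by_contra! hlt
  have hl := length_proj (n := n) a
  have hmem : ∀ j : ℤ, a.shift (j * n) ∈ lift T := fun j => by
    rw [lift, Set.mem_preimage, proj_shift]
    exact he
  refine crossingFree_three_iff.1 hT _ (hmem 0) _ (hmem 1) _ (hmem 2) ?_ ?_ ?_ ?_ ?_ <;>
    simp only [CoverEdge.shift] <;> omega

/-- The edges of length at most two, together with a set of relevant edges. -/
def withShort (s : Set (RelevantEdge n 2)) : Set (Edge n) :=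
  {e | e.length ≤ 2} ∪ Subtype.val '' s

/-- The members of a 3-crossing have length at least 3, so short edges are harmless. -/
theorem crossingFree_withShort : CrossingFree 3 (lift (withShort s)) ↔ IsFace s := by
  refine ⟨fun h => h.mono (Set.preimage_mono Set.subset_union_right), fun h => ?_⟩
  rw [IsFace, crossingFree_three_iff] at h
  rw [crossingFree_three_iff]
  intro e he f hf g hg h1 h2 h3 h4 h5
  have key : ∀ a ∈ lift (withShort s), a.lo + 3 ≤ a.hi → a ∈ lift (Subtype.val '' s) := by
    rintro a (ha | ha) hlt
    · have := length_proj (n := n) a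
      simp only [Set.mem_ofPred_eq] at ha
      omega
    · exact ha
  exact h e (key e he (by omega)) f (key f hf (by omega)) g (key g hg (by omega)) h1 h2 h3 h4 h5

theorem relevantPart_mono (h : T ⊆ T') : relevantPart 2 T ⊆ relevantPart 2 T' := fun _ he => h he

theorem relevantPart_withShort (s : Set (RelevantEdge n 2)) : relevantPart 2 (withShort s) = s := by
  ext e
  constructor
  · rintro (h | ⟨f, hf, h⟩)
    · exact absurd e.2.1 (not_lt.2 h)
    · rwa [← Subtype.ext h]
  · exact fun h => Or.inr ⟨e, h, rfl⟩

theorem withShort_mono {t : Set (RelevantEdge n 2)} (h : s ⊆ t) : withShort s ⊆ withShort t :=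
  Set.union_subset_union_right _ (Set.image_mono h)

theorem withShort_insert_sdiff (e f : RelevantEdge n 2) :
    withShort (insert f (s \ {e})) = insert f.1 (withShort s \ {e.1}) := by
  have h : e.1 ∉ {x : Edge n | x.length ≤ 2} := not_le.2 e.2.1
  simp only [withShort, Set.image_insert_eq, Set.image_sdiff Subtype.val_injective,
    Set.image_singleton, Set.union_insert, Set.union_sdiff_distrib, Set.sdiff_singleton_eq_self h]

theorem subset_withShort (hn : 1 ≤ n) (hT : CrossingFree 3 (lift T)) :
    T ⊆ withShort (relevantPart 2 T) := by
  intro e he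
  by_cases h : e.length ≤ 2
  · exact Or.inl h
  · exact Or.inr ⟨⟨e, not_le.1 h, length_le_of_crossingFree hn hT he⟩, he, rfl⟩

theorem isFace_relevantPart (hT : CrossingFree 3 (lift T)) : IsFace (relevantPart 2 T) :=
  hT.mono (Set.preimage_mono (by rintro _ ⟨e, he, rfl⟩; exact he))

theorem IsTriangulation.withShort_relevantPart (hn : 1 ≤ n) (hT : IsTriangulation 2 T) :
    withShort (relevantPart 2 T) = T :=
  Set.Subset.antisymm (hT.le_of_ge (crossingFree_withShort.2 (isFace_relevantPart hT.prop))
    (subset_withShort hn hT.prop)) (subset_withShort hn hT.prop)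

theorem isTriangulation_withShort (hn : 1 ≤ n) (hs : Maximal IsFace s) :
    IsTriangulation 2 (withShort s) := by
  refine ⟨crossingFree_withShort.2 hs.prop, fun T hT hsub => ?_⟩
  have h1 := relevantPart_mono hsub
  rw [relevantPart_withShort] at h1
  exact (subset_withShort hn hT).trans (withShort_mono (hs.le_of_ge (isFace_relevantPart hT) h1))

theorem IsTriangulation.maximal_relevantPart (hn : 1 ≤ n) (hT : IsTriangulation 2 T) :
    Maximal IsFace (relevantPart 2 T) := by
  refine ⟨isFace_relevantPart hT.prop, fun t ht hsub => ?_⟩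
  have h1 : T ⊆ withShort t := (subset_withShort hn hT.prop).trans (withShort_mono hsub)
  have h2 := relevantPart_mono (hT.le_of_ge (crossingFree_withShort.2 ht) h1)
  rwa [relevantPart_withShort] at h2

theorem injOn_relevantPart (hn : 1 ≤ n) :
    Set.InjOn (relevantPart (n := n) 2) {T | IsTriangulation 2 T} := by
  intro T hT T' hT' h
  rw [← IsTriangulation.withShort_relevantPart hn hT, h,
    IsTriangulation.withShort_relevantPart hn hT']

/-! ### The complex -/

theorem isFacet_iff {t : Finset (RelevantEdge n 2)} :
    (complex n 2).IsFacet t ↔ t.Nonempty ∧ Maximal IsFace (t : Set (RelevantEdge n 2)) := by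
  have := finite_relevantEdge n
  constructor
  · intro h
    refine ⟨h.prop.1, h.prop.2, fun u hu htu => ?_⟩
    obtain ⟨u, rfl⟩ := u.toFinite.exists_finset_coe
    exact Finset.coe_subset.2 (h.le_of_ge ⟨h.prop.1.mono (Finset.coe_subset.1 htu), hu⟩
      (Finset.coe_subset.1 htu))
  · rintro ⟨hne, h⟩
    exact ⟨⟨hne, h.prop⟩, fun u hu htu => Finset.coe_subset.1 (h.le_of_ge hu.2
      (Finset.coe_subset.2 htu))⟩

theorem isFacet_iff_exists (hn : 1 ≤ n) {t : Finset (RelevantEdge n 2)} :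
    (complex n 2).IsFacet t ↔ t.Nonempty ∧ ∃ T : Set (Edge n), IsTriangulation 2 T ∧
      relevantPart 2 T = (t : Set (RelevantEdge n 2)) := by
  rw [isFacet_iff]
  refine and_congr_right fun _ => ⟨fun h => ?_, ?_⟩
  · exact ⟨_, isTriangulation_withShort hn h, relevantPart_withShort _⟩
  · rintro ⟨T, hT, h⟩
    exact h ▸ hT.maximal_relevantPart hn

theorem isPure (hn : 1 ≤ n) : (complex n 2).IsPure (2 * (n - 1)) := by
  have := finite_relevantEdge n
  refine ⟨fun t ht => ?_, fun t ht => ?_⟩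
  · obtain ⟨u, htu, hu⟩ := IsFace.exists_maximal ht.2
    obtain ⟨u, rfl⟩ := u.toFinite.exists_finset_coe
    exact ⟨u, isFacet_iff.2 ⟨ht.1.mono (Finset.coe_subset.1 htu), hu⟩, Finset.coe_subset.1 htu⟩
  · rw [← Set.ncard_coe_finset, ncard_of_maximal hn (isFacet_iff.1 ht).2]

theorem isWeakPseudomanifold (hn : 1 ≤ n) :
    (complex n 2).IsWeakPseudomanifold (2 * (n - 1)) := by
  classical
  have := finite_relevantEdge n
  refine ⟨isPure hn, fun r hr hcard => ?_⟩
  obtain ⟨u, hu, hru⟩ := (isPure hn).1 r hr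
  have hcu := (isPure hn).2 u hu
  obtain ⟨e, he⟩ : ∃ e, u \ r = {e} := by
    rw [← Finset.card_eq_one, Finset.card_sdiff_of_subset hru]
    omega
  have heu : e ∈ u := by
    have : e ∈ u \ r := by simp [he]
    exact (Finset.mem_sdiff.1 this).1
  have hr' : (u : Set (RelevantEdge n 2)) \ {e} = r := by
    rw [← Finset.coe_singleton, ← Finset.coe_sdiff, ← he, Finset.sdiff_sdiff_eq_self hru]
  obtain ⟨u₂, hu₂, hne, hsub, huniq⟩ := exists_flip hn (isFacet_iff.1 hu).2 (e := e) (by simpa)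
  obtain ⟨u₂, rfl⟩ := u₂.toFinite.exists_finset_coe
  rw [hr'] at hsub huniq
  have : {t : Finset (RelevantEdge n 2) | (complex n 2).IsFacet t ∧ r ⊆ t} = {u, u₂} := by
    ext t
    constructor
    · rintro ⟨ht, hrt⟩
      rcases huniq _ (isFacet_iff.1 ht).2 (Finset.coe_subset.2 hrt) with h | h
      · exact Or.inl (Finset.coe_injective h)
      · exact Or.inr (Finset.coe_injective h)
    · rintro (rfl | rfl)
      · exact ⟨hu, hru⟩
      · have := Finset.coe_subset.1 hsub
        exact ⟨isFacet_iff.2 ⟨hr.1.mono this, hu₂⟩, this⟩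
  rw [this, Set.encard_pair]
  rintro rfl
  exact hne rfl

/-! ### The flip graph -/

theorem eq_insert_of_sdiff_subset {α : Type*} {s t : Set α} {e : α} (hs : s.Finite) (ht : t.Finite)
    (he : e ∈ s) (hsub : s \ {e} ⊆ t) (hcard : t.ncard = s.ncard) (hne : t ≠ s) :
    ∃ f, f ∉ s ∧ t = insert f (s \ {e}) := by
  have h1 := Set.ncard_sdiff_singleton_add_one he hs
  have h2 := Set.ncard_sdiff_add_ncard_of_subset hsub ht
  obtain ⟨f, hf⟩ := Set.ncard_eq_one.1 (by omega : (t \ (s \ {e})).ncard = 1)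
  have ht' : t = insert f (s \ {e}) := by
    rw [← Set.sdiff_union_of_subset hsub, hf, Set.singleton_union]
  refine ⟨f, fun hfs => hne ?_, ht'⟩
  have : f ∉ s \ {e} := by
    have : f ∈ t \ (s \ {e}) := by simp [hf]
    exact this.2
  obtain rfl : f = e := by
    by_contra hfe
    exact this ⟨hfs, hfe⟩
  rw [ht', Set.insert_sdiff_singleton, Set.insert_eq_of_mem hfs]

theorem flipGraph_adj_iff (hn : 1 ≤ n) {T T' : {T : Set (Edge n) // IsTriangulation 2 T}} :
    (flipGraph n 2).Adj T T' ↔ T'.1 ≠ T.1 ∧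
      ∃ e ∈ relevantPart 2 T.1, relevantPart 2 T.1 \ {e} ⊆ relevantPart 2 T'.1 := by
  obtain ⟨T, hT⟩ := T
  obtain ⟨T', hT'⟩ := T'
  have := finite_relevantEdge n
  have hTs := hT.withShort_relevantPart hn
  have hTs' := hT'.withShort_relevantPart hn
  constructor
  · rintro ⟨e, f, he, hf, h⟩
    dsimp only at he hf h ⊢
    have hne : T' ≠ T := fun h' => hf (by rw [← h', h]; exact Set.mem_insert _ _)
    refine ⟨hne, ?_⟩
    have hsub : T \ {e} ⊆ T' := h ▸ Set.subset_insert _ _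
    -- A short edge is in every triangulation, so removing it would leave `T` inside `T'`, against
    -- maximality.
    by_cases hl : e.length ≤ 2
    · have heT' : e ∈ T' := hTs' ▸ Or.inl hl
      refine absurd (Set.Subset.antisymm (hT.le_of_ge hT'.prop ?_) ?_) hne <;>
      · intro x hx
        by_cases hxe : x = e
        · exact hxe ▸ heT'
        · exact hsub ⟨hx, hxe⟩
    · refine ⟨⟨e, not_le.1 hl, length_le_of_crossingFree hn hT.prop he⟩, he, fun x hx => ?_⟩
      exact hsub ⟨hx.1, fun h => hx.2 (Subtype.ext h)⟩
  · rintro ⟨hne, e, he, hsub⟩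
    dsimp only at hne he hsub
    obtain ⟨f, hf, h⟩ := eq_insert_of_sdiff_subset (Set.toFinite _) (Set.toFinite _) he hsub
      (by rw [ncard_of_maximal hn (hT.maximal_relevantPart hn),
        ncard_of_maximal hn (hT'.maximal_relevantPart hn)])
      (fun h => hne (injOn_relevantPart hn hT' hT h))
    refine ⟨e.1, f.1, he, hf, ?_⟩
    dsimp only
    rw [← hTs', h, withShort_insert_sdiff, hTs]

theorem flipGraph_neighborSet_ncard (hn : 1 ≤ n) (T : {T : Set (Edge n) // IsTriangulation 2 T}) :
    ((flipGraph n 2).neighborSet T).Finite ∧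
      ((flipGraph n 2).neighborSet T).ncard = 2 * (n - 1) := by
  have := finite_relevantEdge n
  set s := relevantPart 2 T.1 with hs
  have hmax : Maximal IsFace s := T.2.maximal_relevantPart hn
  -- `φ e` is the facet obtained by exchanging `e`; the neighbours of `T` correspond bijectively to
  -- the elements of `s`.
  choose! φ hφ hne hsub huniq using fun e (he : e ∈ s) => exists_flip hn hmax he
  have htri : ∀ e ∈ s, IsTriangulation 2 (withShort (φ e)) := fun e he =>
    isTriangulation_withShort hn (hφ e he)
  have himg : Subtype.val '' (flipGraph n 2).neighborSet T = (fun e => withShort (φ e)) '' s := by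
    ext T'
    constructor
    · rintro ⟨T', h, rfl⟩
      obtain ⟨hT', e, he, h⟩ := (flipGraph_adj_iff hn).1 h
      refine ⟨e, he, ?_⟩
      rcases huniq e he _ (T'.2.maximal_relevantPart hn) h with h | h
      · exact absurd (injOn_relevantPart hn T'.2 T.2 h) hT'
      · dsimp only
        rw [← h, T'.2.withShort_relevantPart hn]
    · rintro ⟨e, he, rfl⟩
      refine ⟨⟨_, htri e he⟩, (flipGraph_adj_iff hn).2 ⟨fun h => hne e he ?_, e, he, ?_⟩, rfl⟩
      · rw [hs, ← h, relevantPart_withShort]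
      · rw [relevantPart_withShort]
        exact hsub e he
  have hinj : Set.InjOn (fun e => withShort (φ e)) s := by
    intro e he e' he' h
    have h1 : φ e = φ e' := by
      rw [← relevantPart_withShort (φ e), ← relevantPart_withShort (φ e')]
      exact congrArg _ h
    -- A common result of exchanging two different edges contains all of `s` except `e` and all of
    -- `s` except `e'`, hence `s`, and equals it by maximality.
    by_contra hee
    refine hne e he (Set.Subset.antisymm (hmax.le_of_ge (hφ e he).prop ?_) ?_) <;>
    · intro x hx
      by_cases hxe : x = e
      · exact h1 ▸ hsub e' he' ⟨hx, fun h => hee (hxe.symm.trans h)⟩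
      · exact hsub e he ⟨hx, hxe⟩
  constructor
  · refine Set.Finite.of_finite_image ?_ Subtype.val_injective.injOn
    rw [himg]
    exact s.toFinite.image _
  · rw [← Set.ncard_image_of_injective _ Subtype.val_injective, himg, hinj.ncard_image,
      ncard_of_maximal hn hmax]

theorem exists_locallyFinite_isRegularOfDegree (hn : 1 ≤ n) :
    ∃ _ : (flipGraph n 2).LocallyFinite, (flipGraph n 2).IsRegularOfDegree (2 * (n - 1)) := by
  have hfin := fun T => (flipGraph_neighborSet_ncard hn T).1
  let _ : (flipGraph n 2).LocallyFinite := fun T => (hfin T).fintype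
  refine ⟨inferInstance, fun T => ?_⟩
  rw [← SimpleGraph.card_neighborSet_eq_degree, ← Nat.card_eq_fintype_card, Nat.card_coe_set_eq]
  exact (flipGraph_neighborSet_ncard hn T).2

end

end HalfCylinder

/-- For every `n ≥ 1`, the flip graph of `2`-triangulations of the half-cylinder with `n` marked
points is regular, of degree `2 * (n - 1)`; and the associated simplicial complex, whose facets
correspond to the `2`-triangulations, is pure with `2 * (n - 1)` vertices in each facet, and is a weak
pseudomanifold. -/
theorem theorem1p1 (n : ℕ) (hn : 1 ≤ n) :
    (∃ _ : (HalfCylinder.flipGraph n 2).LocallyFinite,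
      (HalfCylinder.flipGraph n 2).IsRegularOfDegree (2 * (n - 1))) ∧
    (∀ s : Finset (HalfCylinder.RelevantEdge n 2),
      (HalfCylinder.complex n 2).IsFacet s ↔
        s.Nonempty ∧ ∃ T : Set (HalfCylinder.Edge n), HalfCylinder.IsTriangulation 2 T ∧
          HalfCylinder.relevantPart 2 T = (s : Set (HalfCylinder.RelevantEdge n 2))) ∧
    Set.InjOn (HalfCylinder.relevantPart (n := n) 2) {T | HalfCylinder.IsTriangulation 2 T} ∧
    (HalfCylinder.complex n 2).IsPure (2 * (n - 1)) ∧
    (HalfCylinder.complex n 2).IsWeakPseudomanifold (2 * (n - 1)) :=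
  ⟨HalfCylinder.exists_locallyFinite_isRegularOfDegree hn,
    fun _ => HalfCylinder.isFacet_iff_exists hn, HalfCylinder.injOn_relevantPart hn,
    HalfCylinder.isPure hn, HalfCylinder.isWeakPseudomanifold hn⟩
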